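/- Let $\mathbf{KP}$ be Kripke–Platek set theory (Extensionality, Pair, Union, Infinity, $\Delta_0$-Separation, $\Delta_0$-Collection, and Set Induction for all formulas), formulated in the language $\{\in\}$ as a Tait-style sequent calculus in which $a=b$ abbreviates $(\forall x\in a)(x\in b)\wedge(\forall x\in b)(x\in a)$; $\mathbf{KP}\vdash A$ means that the sequent $\{A\}$ is derivable. For an ordinal $\theta$ let $T(\theta)$ be the set of formal terms, with order $\prec$, generated simultaneously as follows; $a\preceq b$ means $a\prec b$ or $a=b$. Terms $\Omega$, $\Gamma_\xi$, $\psi a$ are called strongly critical; terms other than $0$ and sums are called additive principal. For a term $a$, $Ka$ is the set of arguments of $\psi$ in $a$: $K0=K\Omega=K\Gamma_\xi=\emptyset$, $K(a+b)=K(\varphi ab)=Ka\cup Kb$, $K(\psi a)=\{a\}\cup Ka$. Terms: (1) $0,\Omega\in T(\theta)$ and $\Gamma_\xi\in T(\theta)$ for all $\xi\le\theta$. (2) If $a,b\in T(\theta)$, $a$ is additive principal, and $b$ is either additive principal with $b\preceq a$ or a sum with first summand $\preceq a$, then $a+b\in T(\theta)$ (a sum $a_1+\dots+a_n$ with $n>2$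 is read as $a_1+(a_2+\dots+a_n)$). (3) If $a,b\in T(\theta)$, $a,b\prec\Omega$, and one of the following holds: $b=0$ and $a$ is not strongly critical; $b$ is strongly critical and $b\preceq a$; $b$ is a sum; $b=\varphi cd$ with $c\preceq a$; then $\varphi ab\in T(\theta)$. (4) If $b\in T(\theta)$ and $\Omega\prec b$, then $\varphi 0b\in T(\theta)$. (5) If $a\in T(\theta)$ and $x\prec a$ for all $x\in Ka$, then $\psi a\in T(\theta)$. Order: $0\prec b$ for $b\neq 0$; $\Gamma_\xi\prec\Gamma_\eta$ iff $\xi<\eta$; $\Gamma_\xi\prec\psi a\prec\Omega$ and $\Gamma_\xi\prec\Omega$; $\psi a\prec\psi b$ iff $a\prec b$; for additive principal $b$, $c+d\prec b$ iff $c\prec b$, and $b\prec c+d$ iff $b\preceq c$; $c+d\prec e+f$ iff $c\prec e$, or $c=e$ and $d\prec f$; for strongly critical $b$, $\varphi cd\prec b$ iff $c,d\prec b$, and $b\prec\varphi cd$ iff $b\preceq c$ or $b\preceq d$; $\varphi cd\prec\varphi ef$ iff ($c\prec e$ and $d\prec\varphi ef$) or ($c=e$ and $d\prec f$) or ($e\prec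 c$ and $\varphi cd\prec f$); there are no further instances of $\prec$. Put $e_0:=\Omega+1$, where $1:=\varphi 00$, and $e_{n+1}:=\omega^{e_n}:=\varphi 0e_n$, and write $\psi_\theta(e_n)$ for the term $\psi e_n$ of $T(\theta)$. Let $\mathrm{Acc}_\theta$ be the class of all $a\in T(\theta)$ with $a\prec\Omega$ for which there are an ordinal $\alpha$ and a function $f$ with domain $\alpha$ and range $\{b\in T(\theta)\mid b\preceq a\}$ such that $f(\gamma)\prec f(\delta)$ whenever $\gamma<\delta<\alpha$. Terms are coded as sets, so that "$S=T(\theta)$ with order $\prec$" and the statements below are formulas of $\mathbf{KP}$ with the free variable $\theta$. Theorem. For every $n<\omega$, $$\mathbf{KP}\vdash\forall\theta\;\psi_\theta(e_n)\in\mathrm{Acc}_\theta ,$$ and also $$\mathbf{KP}\vdash\forall\theta\,\exists\alpha\,\exists f\,\big[\mathrm{dom}(f)=\alpha\wedge\mathrm{range}(f)=\{a\in T(\theta)\mid a\prec\psi_\theta(e_n)\}\wedge\forall\gamma,\delta\in\mathrm{dom}(f)\,(\gamma<\delta\rightarrow f(\gamma)\prec f(\delta))\big],$$ where $\theta$ and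 $\alpha$ range over ordinals. That is, $\mathbf{KP}$ proves, uniformly in the parameter $\theta$, that the initial segment of $T(\theta)$ below $\psi_\theta(e_n)$ is order-isomorphic to an ordinal. -/

import Mathlib

/-! # Kripke-Platek set theory and the relativised notation systems -/

namespace KPSet

/-! ## Formulas

Formulas are in negation normal form.  There are countably many free variables `free 0, free 1, …`;
bound variables are nameless: in `Fml n` the bound variables in scope are `0, …, n - 1`, numbered from
the outside in, and a quantifier in front of a member of `Fml (n + 1)` binds the variable `n`.
The formulas proper are the members of `Fml 0`. -/

inductive Tm (n : ℕ) : Type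
  | free (i : ℕ) : Tm n
  | bd (j : Fin n) : Tm n
  deriving DecidableEq

/-- The bound variable number `k`. -/
def v {n : ℕ} (k : ℕ) (h : k < n := by decide) : Tm n := Tm.bd ⟨k, h⟩

inductive Fml : ℕ → Type
  | mem {n : ℕ} (s t : Tm n) : Fml n
  | nmem {n : ℕ} (s t : Tm n) : Fml n
  | and {n : ℕ} (A B : Fml n) : Fml n
  | or {n : ℕ} (A B : Fml n) : Fml n
  | all {n : ℕ} (A : Fml (n + 1)) : Fml n
  | ex {n : ℕ} (A : Fml (n + 1)) : Fml n
  | ball {n : ℕ} (t : Tm n) (A : Fml (n + 1)) : Fml n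
  | bex {n : ℕ} (t : Tm n) (A : Fml (n + 1)) : Fml n
  deriving DecidableEq

infixr:65 " ⋏ " => Fml.and
infixr:60 " ⋎ " => Fml.or

/-- Weakening: the same variable in a scope with one more bound variable. -/
def Tm.lift {n : ℕ} : Tm n → Tm (n + 1)
  | .free i => .free i
  | .bd j => .bd j.castSucc

def Tm.subst {n m : ℕ} (σ : Fin n → Tm m) : Tm n → Tm m
  | .free i => .free i
  | .bd j => σ j

/-- The substitution `σ` moved under a quantifier, which keeps its own bound variable. -/
def up {n m : ℕ} (σ : Fin n → Tm m) : Fin (n + 1) → Tm (m + 1) :=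
  Fin.snoc (α := fun _ => Tm (m + 1)) (fun i => (σ i).lift) (Tm.bd (Fin.last m))

namespace Fml

/-- Simultaneous substitution of variables for the bound variables in scope. -/
def subst : {n m : ℕ} → (Fin n → Tm m) → Fml n → Fml m
  | _, _, σ, .mem s t => .mem (s.subst σ) (t.subst σ)
  | _, _, σ, .nmem s t => .nmem (s.subst σ) (t.subst σ)
  | _, _, σ, .and A B => .and (A.subst σ) (B.subst σ)
  | _, _, σ, .or A B => .or (A.subst σ) (B.subst σ)
  | _, _, σ, .all A => .all (A.subst (up σ))
  | _, _, σ, .ex A => .ex (A.subst (up σ))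
  | _, _, σ, .ball t A => .ball (t.subst σ) (A.subst (up σ))
  | _, _, σ, .bex t A => .bex (t.subst σ) (A.subst (up σ))

/-- `A(t)` for a formula `A(x)` with one distinguished variable `x`. -/
def app {m : ℕ} (A : Fml 1) (t : Tm m) : Fml m := A.subst (fun _ => t)

def neg : {n : ℕ} → Fml n → Fml n
  | _, .mem s t => .nmem s t
  | _, .nmem s t => .mem s t
  | _, .and A B => .or A.neg B.neg
  | _, .or A B => .and A.neg B.neg
  | _, .all A => .ex A.neg
  | _, .ex A => .all A.neg
  | _, .ball t A => .bex t A.neg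
  | _, .bex t A => .ball t A.neg

def imp {n : ℕ} (A B : Fml n) : Fml n := A.neg ⋎ B

def iff {n : ℕ} (A B : Fml n) : Fml n := imp A B ⋏ imp B A

/-- `s = t` abbreviates `(∀ x ∈ s) x ∈ t ∧ (∀ x ∈ t) x ∈ s`. -/
def eq {n : ℕ} (s t : Tm n) : Fml n :=
  ball s (mem (.bd (Fin.last n)) t.lift) ⋏ ball t (mem (.bd (Fin.last n)) s.lift)

/-- `Δ₀`-formulas: no unbounded quantifiers. -/
def IsDelta0 : {n : ℕ} → Fml n → Prop
  | _, .mem _ _ => True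
  | _, .nmem _ _ => True
  | _, .and A B => A.IsDelta0 ∧ B.IsDelta0
  | _, .or A B => A.IsDelta0 ∧ B.IsDelta0
  | _, .all _ => False
  | _, .ex _ => False
  | _, .ball _ A => A.IsDelta0
  | _, .bex _ A => A.IsDelta0

/-- The free variable `free a` occurs in the formula. -/
def Occurs (a : ℕ) : {n : ℕ} → Fml n → Prop
  | _, .mem s t => s = .free a ∨ t = .free a
  | _, .nmem s t => s = .free a ∨ t = .free a
  | _, .and A B => A.Occurs a ∨ B.Occurs a
  | _, .or A B => A.Occurs a ∨ B.Occurs a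
  | _, .all A => A.Occurs a
  | _, .ex A => A.Occurs a
  | _, .ball t A => t = .free a ∨ A.Occurs a
  | _, .bex t A => t = .free a ∨ A.Occurs a

end Fml

open Fml

infixr:55 " ⇒ₖ " => Fml.imp
infix:52 " ⇔ₖ " => Fml.iff
infix:70 " ∈ₖ " => Fml.mem
infix:70 " =ₖ " => Fml.eq

/-! ## The theory `KP` -/

/-- Derivability in the Tait-style sequent calculus of Kripke-Platek set theory (with Infinity and full
set induction).  A sequent, a finite set of formulas, is read as the disjunction of its members. -/
inductive Derivable : Finset (Fml 0) → Prop
  | logical (Γ : Finset (Fml 0)) (A : Fml 0) : Derivable (insert A (insert A.neg Γ))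
  | extensionality (Γ : Finset (Fml 0)) (a b : ℕ) (B : Fml 1) :
      Derivable (insert ((.free a =ₖ .free b) ⋏ B.app (.free a) ⇒ₖ B.app (.free b)) Γ)
  | pair (Γ : Finset (Fml 0)) (a b : ℕ) :
      Derivable (insert (ex ((.free a ∈ₖ v 0) ⋏ (.free b ∈ₖ v 0))) Γ)
  | union (Γ : Finset (Fml 0)) (a : ℕ) :
      Derivable (insert (ex (ball (.free a) (ball (v 1) (v 2 ∈ₖ v 0)))) Γ)
  | separation (Γ : Finset (Fml 0)) (a : ℕ) (B : Fml 1) (hB : B.IsDelta0) :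
      Derivable (insert (ex (ball (v 0) ((v 1 ∈ₖ .free a) ⋏ B.app (v 1)) ⋏
        ball (.free a) (B.app (v 1) ⇒ₖ v 1 ∈ₖ v 0))) Γ)
  | setInduction (Γ : Finset (Fml 0)) (F : Fml 1) :
      Derivable (insert (all (ball (v 0) (F.app (v 1)) ⇒ₖ F.app (v 0)) ⇒ₖ all F) Γ)
  | infinity (Γ : Finset (Fml 0)) :
      Derivable (insert (ex (bex (v 0) (v 1 ∈ₖ v 0) ⋏ ball (v 0) (bex (v 0) (v 1 ∈ₖ v 2)))) Γ)
  | collection (Γ : Finset (Fml 0)) (a : ℕ) (G : Fml 2) (hG : G.IsDelta0) :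
      Derivable (insert (ball (.free a) (ex G) ⇒ₖ
        ex (ball (.free a) (bex (v 0) (G.subst ![v 1, v 2])))) Γ)
  | and_intro (Γ : Finset (Fml 0)) (A B : Fml 0) :
      Derivable (insert A Γ) → Derivable (insert B Γ) → Derivable (insert (A ⋏ B) Γ)
  | or_left (Γ : Finset (Fml 0)) (A B : Fml 0) :
      Derivable (insert A Γ) → Derivable (insert (A ⋎ B) Γ)
  | or_right (Γ : Finset (Fml 0)) (A B : Fml 0) :
      Derivable (insert B Γ) → Derivable (insert (A ⋎ B) Γ)
  | bex_intro (Γ : Finset (Fml 0)) (a b : ℕ) (F : Fml 1) :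
      Derivable (insert ((.free a ∈ₖ .free b) ⋏ F.app (.free a)) Γ) →
      Derivable (insert (bex (.free b) F) Γ)
  | ex_intro (Γ : Finset (Fml 0)) (a : ℕ) (F : Fml 1) :
      Derivable (insert (F.app (.free a)) Γ) → Derivable (insert (ex F) Γ)
  | ball_intro (Γ : Finset (Fml 0)) (a b : ℕ) (F : Fml 1)
      (h : ∀ C ∈ insert (ball (.free b) F) Γ, ¬ C.Occurs a) :
      Derivable (insert (.free a ∈ₖ .free b ⇒ₖ F.app (.free a)) Γ) →
      Derivable (insert (ball (.free b) F) Γ)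
  | all_intro (Γ : Finset (Fml 0)) (a : ℕ) (F : Fml 1)
      (h : ∀ C ∈ insert (all F) Γ, ¬ C.Occurs a) :
      Derivable (insert (F.app (.free a)) Γ) → Derivable (insert (all F) Γ)
  | cut (Γ : Finset (Fml 0)) (A : Fml 0) :
      Derivable (insert A Γ) → Derivable (insert A.neg Γ) → Derivable Γ

/-- `KP ⊢ A`. -/
def KPProves (A : Fml 0) : Prop := Derivable {A}

/-! ## Elementary set-theoretic formulas -/

/-- `x` is an ordinal: a transitive set of transitive sets. -/
def isOrd {n : ℕ} (x : Tm n) : Fml n := subst ![x] <|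
  ball (v 0) (ball (v 1) ((v 2 ∈ₖ v 0) ⋏ ball (v 2) (v 3 ∈ₖ v 1)))

/-- `u = {a, b}`. -/
def isUPair {n : ℕ} (u a b : Tm n) : Fml n := subst ![u, a, b] <|
  (v 1 ∈ₖ v 0) ⋏ (v 2 ∈ₖ v 0) ⋏ ball (v 0) ((v 3 =ₖ v 1) ⋎ (v 3 =ₖ v 2))

/-- `p = ⟨a, b⟩ = {{a}, {a, b}}`. -/
def isPair {n : ℕ} (p a b : Tm n) : Fml n := subst ![p, a, b] <|
  bex (v 0) (bex (v 0)
    (isUPair (v 3) (v 1) (v 1) ⋏ isUPair (v 4) (v 1) (v 2) ⋏ isUPair (v 0) (v 3) (v 4)))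

/-- `⟨a, b⟩ ∈ r`. -/
def rel {n : ℕ} (r a b : Tm n) : Fml n := subst ![r, a, b] <|
  bex (v 0) (isPair (v 3) (v 1) (v 2))

/-- `⟨a, b⟩ ∈ r` or `a = b`. -/
def relEq {n : ℕ} (r a b : Tm n) : Fml n := rel r a b ⋎ (a =ₖ b)

/-- `x` is the von Neumann numeral `k`. -/
def isNum {n : ℕ} : ℕ → Tm n → Fml n
  | 0, x => subst ![x] <| ball (v 0) (.nmem (v 1) (v 0))
  | k + 1, x => subst ![x] <| bex (v 0)
      (isNum k (v 1) ⋏ ball (v 0) ((v 2 ∈ₖ v 1) ⋎ (v 2 =ₖ v 1)) ⋏ ball (v 1) (v 2 ∈ₖ v 0))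

/-! ## Codes of terms

The formal terms over the symbols `0, Ω, Γ_ξ, +, φ, ψ` are coded as sets:
`0 = ⟨0, ∅⟩`, `Ω = ⟨1, ∅⟩`, `Γ_ξ = ⟨2, ξ⟩`, `a + b = ⟨3, ⟨a, b⟩⟩`, `φ a b = ⟨4, ⟨a, b⟩⟩`, `ψ a = ⟨5, a⟩`.
A sum `a₁ + … + aₙ` of more than two terms is coded as `a₁ + (a₂ + (… + aₙ))`. -/

/-- `s = ⟨k, x⟩`. -/
def isCode {n : ℕ} (k : ℕ) (s x : Tm n) : Fml n := subst ![s, x] <|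
  bex (v 0) (bex (v 2) (isNum k (v 3) ⋏ isPair (v 0) (v 3) (v 1)))

/-- `s = ⟨k, x⟩` for some `x`. -/
def hasTag {n : ℕ} (k : ℕ) (s : Tm n) : Fml n := subst ![s] <|
  bex (v 0) (bex (v 1) (isCode k (v 0) (v 2)))

/-- `s = ⟨k, ∅⟩`. -/
def isConst {n : ℕ} (k : ℕ) (s : Tm n) : Fml n := subst ![s] <|
  bex (v 0) (bex (v 1) (isNum 0 (v 2) ⋏ isCode k (v 0) (v 2)))

/-- `s = ⟨k, ⟨a, b⟩⟩`. -/
def isBin {n : ℕ} (k : ℕ) (s a b : Tm n) : Fml n := subst ![s, a, b] <|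
  bex (v 0) (bex (v 3) (isPair (v 4) (v 1) (v 2) ⋏ isCode k (v 0) (v 4)))

def isZero {n : ℕ} (s : Tm n) : Fml n := isConst 0 s
def isOmega {n : ℕ} (s : Tm n) : Fml n := isConst 1 s
def isGamma {n : ℕ} (s x : Tm n) : Fml n := isCode 2 s x
def isPlus {n : ℕ} (s a b : Tm n) : Fml n := isBin 3 s a b
def isPhi {n : ℕ} (s a b : Tm n) : Fml n := isBin 4 s a b
def isPsi {n : ℕ} (s a : Tm n) : Fml n := isCode 5 s a

/-- The term `s` is `Ω`, some `Γ_ξ`, or of the form `ψ a`. -/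
def strCrit {n : ℕ} (s : Tm n) : Fml n := hasTag 1 s ⋎ hasTag 2 s ⋎ hasTag 5 s

/-- The term `s` is neither `0` nor a sum. -/
def addPrin {n : ℕ} (s : Tm n) : Fml n := strCrit s ⋎ hasTag 4 s

/-! ## The notation system `T(θ)`

In the formulas below `S` stands for the set `T(θ)`, `L` for the order `≺` of `T(θ)` and `K` for the
relation `x ∈ Ka`, both as sets of pairs. -/

/-- For `a, b ∈ S`: the recursive condition for `a ≺ b`. -/
def ltClause {n : ℕ} (S L a b : Tm n) : Fml n := subst ![S, L, a, b] <|
  -- `0 ≺ b` for `b` other than `0`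
  (hasTag 0 (v 2) ⋏ (hasTag 0 (v 3)).neg) ⋎
  -- `Γ_ξ ≺ Ω`, `Γ_ξ ≺ ψ d`, `ψ c ≺ Ω`
  (hasTag 2 (v 2) ⋏ hasTag 1 (v 3)) ⋎
  (hasTag 2 (v 2) ⋏ hasTag 5 (v 3)) ⋎
  (hasTag 5 (v 2) ⋏ hasTag 1 (v 3)) ⋎
  -- `Γ_ξ ≺ Γ_η` iff `ξ ∈ η`
  bex (v 2) (bex (v 4) (isGamma (v 2) (v 5) ⋏
    bex (v 3) (bex (v 6) (isGamma (v 3) (v 7) ⋏ (v 5 ∈ₖ v 7))))) ⋎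
  -- `c + d ≺ b` iff `c ≺ b`, for additive principal `b`
  bex (v 0) (bex (v 0) (isPlus (v 2) (v 4) (v 5) ⋏ addPrin (v 3) ⋏ rel (v 1) (v 4) (v 3))) ⋎
  -- `a ≺ c + d` iff `a ≼ c`, for additive principal `a`
  bex (v 0) (bex (v 0) (isPlus (v 3) (v 4) (v 5) ⋏ addPrin (v 2) ⋏ relEq (v 1) (v 2) (v 4))) ⋎
  -- `c + d ≺ e + f` iff `c ≺ e`, or `c = e` and `d ≺ f`
  bex (v 0) (bex (v 0) (isPlus (v 2) (v 4) (v 5) ⋏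
    bex (v 0) (bex (v 0) (isPlus (v 3) (v 6) (v 7) ⋏
      (rel (v 1) (v 4) (v 6) ⋎ ((v 4 =ₖ v 6) ⋏ rel (v 1) (v 5) (v 7))))))) ⋎
  -- `φ c d ≺ b` iff `c ≺ b` and `d ≺ b`, for strongly critical `b`
  bex (v 0) (bex (v 0) (isPhi (v 2) (v 4) (v 5) ⋏ strCrit (v 3) ⋏
    rel (v 1) (v 4) (v 3) ⋏ rel (v 1) (v 5) (v 3))) ⋎
  -- `a ≺ φ c d` iff `a ≼ c` or `a ≼ d`, for strongly critical `a`
  bex (v 0) (bex (v 0) (isPhi (v 3) (v 4) (v 5) ⋏ strCrit (v 2) ⋏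
    (relEq (v 1) (v 2) (v 4) ⋎ relEq (v 1) (v 2) (v 5)))) ⋎
  -- `φ c d ≺ φ e f`
  bex (v 0) (bex (v 0) (isPhi (v 2) (v 4) (v 5) ⋏
    bex (v 0) (bex (v 0) (isPhi (v 3) (v 6) (v 7) ⋏
      ((rel (v 1) (v 4) (v 6) ⋏ rel (v 1) (v 5) (v 3)) ⋎
       ((v 4 =ₖ v 6) ⋏ rel (v 1) (v 5) (v 7)) ⋎
       (rel (v 1) (v 6) (v 4) ⋏ rel (v 1) (v 2) (v 7))))))) ⋎
  -- `ψ c ≺ ψ d` iff `c ≺ d`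
  bex (v 0) (isPsi (v 2) (v 4) ⋏ bex (v 0) (isPsi (v 3) (v 5) ⋏ rel (v 1) (v 4) (v 5)))

/-- For `x, a ∈ S`: the recursive condition for `x ∈ Ka`, where `Ka` is the set of the arguments of `ψ`
in `a`, that is `K(c + d) = K(φ c d) = Kc ∪ Kd`, `K(ψ c) = {c} ∪ Kc`, and `Ka = ∅` otherwise. -/
def kClause {n : ℕ} (S K x a : Tm n) : Fml n := subst ![S, K, x, a] <|
  bex (v 0) (bex (v 0) ((isPlus (v 3) (v 4) (v 5) ⋎ isPhi (v 3) (v 4) (v 5)) ⋏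
    (rel (v 1) (v 2) (v 4) ⋎ rel (v 1) (v 2) (v 5)))) ⋎
  bex (v 0) (isPsi (v 3) (v 4) ⋏ ((v 2 =ₖ v 4) ⋎ rel (v 1) (v 2) (v 4)))

/-- For `a, b ∈ S`: `a + b` is in normal form, that is `a` is additive principal and `b` is an
additive principal term `≼ a` or a sum with first summand `≼ a`. -/
def plusNF {n : ℕ} (S L a b : Tm n) : Fml n := subst ![S, L, a, b] <|
  addPrin (v 2) ⋏ ((addPrin (v 3) ⋏ relEq (v 1) (v 3) (v 2)) ⋎
    bex (v 0) (bex (v 0) (isPlus (v 3) (v 4) (v 5) ⋏ relEq (v 1) (v 4) (v 2))))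

/-- For `a, b ∈ S`: `φ a b` is in normal form.  Either `a, b ≺ Ω` and `a, b` are below the value of
`φ a b`, or `a = 0` and `Ω ≺ b`. -/
def phiNF {n : ℕ} (S L a b : Tm n) : Fml n := subst ![S, L, a, b] <|
  bex (v 0) (isOmega (v 4) ⋏
    ((rel (v 1) (v 2) (v 4) ⋏ rel (v 1) (v 3) (v 4) ⋏
      ((hasTag 0 (v 3) ⋏ (strCrit (v 2)).neg) ⋎
       (strCrit (v 3) ⋏ relEq (v 1) (v 3) (v 2)) ⋎
       hasTag 3 (v 3) ⋎
       bex (v 0) (bex (v 0) (isPhi (v 3) (v 5) (v 6) ⋏ relEq (v 1) (v 5) (v 2))))) ⋎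
     (hasTag 0 (v 2) ⋏ rel (v 1) (v 4) (v 3))))

/-- For `a ∈ S`: `ψ a` is in normal form, that is `x ≺ a` for all `x ∈ Ka`. -/
def psiNF {n : ℕ} (S L K a : Tm n) : Fml n := subst ![S, L, K, a] <|
  ball (v 0) (rel (v 2) (v 4) (v 3) ⇒ₖ rel (v 1) (v 4) (v 3))

/-- `s` is one of the terms `0`, `Ω`, `Γ_ξ` with `ξ ≤ θ`, or a normal form `a + b`, `φ a b`, `ψ a` with
`a, b ∈ S`. -/
def generated {n : ℕ} (θ S L K s : Tm n) : Fml n := subst ![θ, S, L, K, s] <|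
  isZero (v 4) ⋎ isOmega (v 4) ⋎
  bex (v 0) (isGamma (v 4) (v 5)) ⋎ isGamma (v 4) (v 0) ⋎
  bex (v 1) (bex (v 1)
    ((plusNF (v 1) (v 2) (v 5) (v 6) ⋏ isPlus (v 4) (v 5) (v 6)) ⋎
     (phiNF (v 1) (v 2) (v 5) (v 6) ⋏ isPhi (v 4) (v 5) (v 6)))) ⋎
  bex (v 1) (psiNF (v 1) (v 2) (v 3) (v 5) ⋏ isPsi (v 4) (v 5))

/-- `S` contains all the terms described in `generated`. -/
def closed {n : ℕ} (θ S L K : Tm n) : Fml n := subst ![θ, S, L, K] <|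
  bex (v 1) (isZero (v 4)) ⋏ bex (v 1) (isOmega (v 4)) ⋏
  ball (v 0) (bex (v 1) (isGamma (v 5) (v 4))) ⋏ bex (v 1) (isGamma (v 4) (v 0)) ⋏
  ball (v 1) (ball (v 1)
    ((plusNF (v 1) (v 2) (v 4) (v 5) ⇒ₖ bex (v 1) (isPlus (v 6) (v 4) (v 5))) ⋏
     (phiNF (v 1) (v 2) (v 4) (v 5) ⇒ₖ bex (v 1) (isPhi (v 6) (v 4) (v 5))))) ⋏
  ball (v 1) (psiNF (v 1) (v 2) (v 3) (v 4) ⇒ₖ bex (v 1) (isPsi (v 5) (v 4)))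

/-- The `Δ₀`-formula saying that `S` is `T(θ)`, that `L` is the order `≺` on `S` and that `K` is the
relation `x ∈ Ka` on `S`.  As components of a term are of smaller rank than the term, the recursive
conditions determine `S`, and `L` and `K` on `S`. -/
def isSystem {n : ℕ} (θ S L K : Tm n) : Fml n := subst ![θ, S, L, K] <|
  ball (v 1) (generated (v 0) (v 1) (v 2) (v 3) (v 4)) ⋏
  closed (v 0) (v 1) (v 2) (v 3) ⋏
  ball (v 1) (ball (v 1) (rel (v 2) (v 4) (v 5) ⇔ₖ ltClause (v 1) (v 2) (v 4) (v 5))) ⋏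
  ball (v 1) (ball (v 1) (rel (v 3) (v 4) (v 5) ⇔ₖ kClause (v 1) (v 3) (v 4) (v 5)))

/-- `s ∈ S` is the term `e_k`, where `e_0 = Ω + 1` (with `1 = φ 0 0`) and `e_{k+1} = ω^{e_k} = φ 0 e_k`. -/
def isE {n : ℕ} : ℕ → Tm n → Tm n → Fml n
  | 0, S, s => subst ![S, s] <| bex (v 0) (bex (v 0) (bex (v 0)
      (isZero (v 2) ⋏ isOmega (v 3) ⋏ isPhi (v 4) (v 2) (v 2) ⋏ isPlus (v 1) (v 3) (v 4))))
  | k + 1, S, s => subst ![S, s] <| bex (v 0) (bex (v 0)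
      (isZero (v 2) ⋏ isE k (v 0) (v 3) ⋏ isPhi (v 1) (v 2) (v 3)))

/-- `s ∈ S` is the term `ψ e_k`. -/
def isPsiE {n : ℕ} (k : ℕ) (S s : Tm n) : Fml n := subst ![S, s] <|
  (v 1 ∈ₖ v 0) ⋏ bex (v 0) (isE k (v 0) (v 2) ⋏ isPsi (v 1) (v 2))

/-! ## Accessible terms -/

/-- `α` is an ordinal, and `f` is a function with domain `α`, with values in `S`, and with
`γ < δ → f γ ≺ f δ` for all `γ, δ < α`. -/
def isOrderEmb {n : ℕ} (S L α f : Tm n) : Fml n := subst ![S, L, α, f] <|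
  isOrd (v 2) ⋏
  ball (v 3) (bex (v 2) (bex (v 0) (isPair (v 4) (v 5) (v 6)))) ⋏
  ball (v 2) (bex (v 0) (rel (v 3) (v 4) (v 5))) ⋏
  ball (v 2) (ball (v 0) (ball (v 0)
    (rel (v 3) (v 4) (v 5) ⋏ rel (v 3) (v 4) (v 6) ⇒ₖ v 5 =ₖ v 6))) ⋏
  ball (v 2) (ball (v 2) (ball (v 0) (ball (v 0)
    ((v 4 ∈ₖ v 5) ⋏ rel (v 3) (v 4) (v 6) ⋏ rel (v 3) (v 5) (v 7) ⇒ₖ rel (v 1) (v 6) (v 7)))))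

/-- `{b ∈ S | b ≼ p}` is the range of an order preserving function on an ordinal. -/
def initSegLe {n : ℕ} (S L p : Tm n) : Fml n := subst ![S, L, p] <|
  ex (ex (isOrderEmb (v 0) (v 1) (v 3) (v 4) ⋏
    ball (v 0) (bex (v 3) (rel (v 4) (v 6) (v 5)) ⇔ₖ relEq (v 1) (v 5) (v 2))))

/-- `{b ∈ S | b ≺ p}` is the range of an order preserving function on an ordinal. -/
def initSegLt {n : ℕ} (S L p : Tm n) : Fml n := subst ![S, L, p] <|
  ex (ex (isOrderEmb (v 0) (v 1) (v 3) (v 4) ⋏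
    ball (v 0) (bex (v 3) (rel (v 4) (v 6) (v 5)) ⇔ₖ rel (v 1) (v 5) (v 2))))

/-- `p ∈ Acc_θ`, where `S = T(θ)` and `L` is its order: `p ∈ T(θ)`, `p ≺ Ω`, and `{b | b ≼ p}` is the
range of an order preserving function on an ordinal. -/
def isAcc {n : ℕ} (S L p : Tm n) : Fml n := subst ![S, L, p] <|
  (v 2 ∈ₖ v 0) ⋏ bex (v 0) (isOmega (v 3) ⋏ rel (v 1) (v 2) (v 3)) ⋏ initSegLe (v 0) (v 1) (v 2)

/-- `ψ_θ(e_k) ∈ Acc_θ`. -/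
def psiEAcc {n : ℕ} (k : ℕ) (θ : Tm n) : Fml n := subst ![θ] <|
  ex (ex (ex (ex (isSystem (v 0) (v 1) (v 2) (v 3) ⋏ isPsiE k (v 1) (v 4) ⋏
    isAcc (v 1) (v 2) (v 4)))))

/-- `A_k(θ)`: there are an ordinal `α` and an order preserving function on `α` with range
`{a ∈ T(θ) | a ≺ ψ_θ(e_k)}`. -/
def psiEOrderType {n : ℕ} (k : ℕ) (θ : Tm n) : Fml n := subst ![θ] <|
  ex (ex (ex (ex (isSystem (v 0) (v 1) (v 2) (v 3) ⋏ isPsiE k (v 1) (v 4) ⋏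
    initSegLt (v 1) (v 2) (v 4)))))

/-- `∀ θ A(θ)`, where `θ` ranges over the ordinals. -/
def allOrd (A : Fml 1) : Fml 0 := all (isOrd (v 0) ⇒ₖ A)

end KPSet

namespace KPSet

/-! ## Semantics -/

section Semantics

variable {M : Type}

/-! Derivability in `KP` is replaced by truth in models. The calculus is complete for extensional
models in which every element is named by a free variable (`KPProves_of_eval`): from an underivable
sequent a Henkin-style maximal set is built, and its free variables, identified when they have the
same elements, form a model. It then suffices to carry out the well-ordering proof inside an
arbitrary, possibly ill-founded, model. Induction, separation and collection are available there
only for predicates given by formulas (`Def`) or by Δ₀-formulas (`D0`).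

Inside a model, `T(θ)` is obtained as a set from fixed points of finitary operators (`exists_sys`),
and `≺` is shown to be linear by inductions on terms. Two facts govern the accessible terms. A term
below `Ω` with only accessible predecessors is accessible: Δ₀-collection gathers isomorphisms for
the predecessors, and these agree with each other (`initSegLt_of_forall`). Conversely, below an
accessible term induction along `≺` holds for every formula, since it can be pulled back to an
ordinal (`acc_induction`). Hence the accessible terms are closed under normal-form sums and `φ`, and
they contain all `Γ_ξ`.

Call a term good if `ψ x` is accessible for all arguments `x` of `ψ` in it (`AccArgs`). Good terms
below `Ω` are accessible (`acc_of_accArgs`), so transfinite induction over the good terms is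
available below `Ω`, and then up to `Ω + 1`. Gentzen's jump passes from transfinite induction up to
`a` to transfinite induction up to `ω^a` (`ti_phi`). Since only sums in normal form are terms, the
addition in the jump is simulated by sets `h` that behave like `z ↦ h 0 + z` (`Shift`). Every
application of the jump uses a more complex formula, so the iteration runs over the external number
`n` and yields each `e_n` separately.

Finally, accessibility of `ψ a` is progressive in `a` over the good terms (`prog_acc_psi`): the
strongly critical terms below `ψ a` are of the form `Γ_ξ`, or `ψ b` with `b ≺ a` where all arguments
of `ψ` in `b` are below `b`. No `ψ` occurs in `e_n`, so `e_n` is good and `ψ e_n` is accessible. The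
isomorphisms for its predecessors are glued once more to obtain the second assertion. -/

def Tm.eval {n : ℕ} (ρ : ℕ → M) (e : Fin n → M) : Tm n → M
  | .free i => ρ i
  | .bd j => e j

variable {ρ : ℕ → M} {n m : ℕ}

theorem Tm.eval_lift (e : Fin n → M) (x : M) (t : Tm n) :
    t.lift.eval ρ (Fin.snoc (α := fun _ => M) e x) = t.eval ρ e := by
  cases t <;> simp [Tm.lift, Tm.eval]

theorem Tm.eval_subst (σ : Fin n → Tm m) (e : Fin m → M) (t : Tm n) :
    (t.subst σ).eval ρ e = t.eval ρ (fun i => (σ i).eval ρ e) := by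
  cases t <;> simp [Tm.subst, Tm.eval]

theorem eval_up (σ : Fin n → Tm m) (e : Fin m → M) (x : M) :
    (fun i => (up σ i).eval ρ (Fin.snoc (α := fun _ => M) e x)) =
      Fin.snoc (α := fun _ => M) (fun i => (σ i).eval ρ e) x := by
  funext i
  refine Fin.lastCases ?_ (fun j => ?_) i
  · simp [up, Tm.eval]
  · simp [up, Tm.eval_lift]

variable [Membership M M]

/-- The value of a formula under the interpretation `ρ` of the free variables and `e` of the bound
variables in scope. -/
def Fml.eval (ρ : ℕ → M) : {n : ℕ} → Fml n → (Fin n → M) → Prop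
  | _, .mem s t, e => s.eval ρ e ∈ t.eval ρ e
  | _, .nmem s t, e => ¬ s.eval ρ e ∈ t.eval ρ e
  | _, .and A B, e => A.eval ρ e ∧ B.eval ρ e
  | _, .or A B, e => A.eval ρ e ∨ B.eval ρ e
  | _, .all A, e => ∀ x : M, A.eval ρ (Fin.snoc (α := fun _ => M) e x)
  | _, .ex A, e => ∃ x : M, A.eval ρ (Fin.snoc (α := fun _ => M) e x)
  | _, .ball t A, e => ∀ x : M, x ∈ t.eval ρ e → A.eval ρ (Fin.snoc (α := fun _ => M) e x)
  | _, .bex t A, e => ∃ x : M, x ∈ t.eval ρ e ∧ A.eval ρ (Fin.snoc (α := fun _ => M) e x)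

theorem Fml.eval_subst (A : Fml n) : ∀ {m : ℕ} (σ : Fin n → Tm m) (e : Fin m → M),
    (A.subst σ).eval ρ e ↔ A.eval ρ (fun i => (σ i).eval ρ e) := by
  induction A with
  | mem s t => intro m σ e; simp [Fml.subst, Fml.eval, Tm.eval_subst]
  | nmem s t => intro m σ e; simp [Fml.subst, Fml.eval, Tm.eval_subst]
  | and A B ihA ihB => intro m σ e; simp [Fml.subst, Fml.eval, ihA, ihB]
  | or A B ihA ihB => intro m σ e; simp [Fml.subst, Fml.eval, ihA, ihB]
  | all A ih => intro m σ e; simp [Fml.subst, Fml.eval, ih, eval_up]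
  | ex A ih => intro m σ e; simp [Fml.subst, Fml.eval, ih, eval_up]
  | ball t A ih => intro m σ e; simp [Fml.subst, Fml.eval, ih, eval_up, Tm.eval_subst]
  | bex t A ih => intro m σ e; simp [Fml.subst, Fml.eval, ih, eval_up, Tm.eval_subst]

theorem Fml.eval_app (A : Fml 1) (t : Tm m) (e : Fin m → M) :
    (A.app t).eval ρ e ↔ A.eval ρ (fun _ => t.eval ρ e) := A.eval_subst _ _

theorem Fml.eval_neg (A : Fml n) : ∀ e : Fin n → M, A.neg.eval ρ e ↔ ¬ A.eval ρ e := by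
  induction A with
  | mem s t => intro e; simp [Fml.neg, Fml.eval]
  | nmem s t => intro e; simp [Fml.neg, Fml.eval]
  | and A B ihA ihB => intro e; simp [Fml.neg, Fml.eval, ihA, ihB]; tauto
  | or A B ihA ihB => intro e; simp [Fml.neg, Fml.eval, ihA, ihB]
  | all A ih => intro e; simp [Fml.neg, Fml.eval, ih]
  | ex A ih => intro e; simp [Fml.neg, Fml.eval, ih]
  | ball t A ih => intro e; simp [Fml.neg, Fml.eval, ih]
  | bex t A ih => intro e; simp [Fml.neg, Fml.eval, ih]

theorem Fml.eval_imp (A B : Fml n) (e : Fin n → M) :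
    (A ⇒ₖ B).eval ρ e ↔ (A.eval ρ e → B.eval ρ e) := by
  simp only [Fml.imp, Fml.eval, Fml.eval_neg]; tauto

theorem Fml.eval_iff (A B : Fml n) (e : Fin n → M) :
    (A ⇔ₖ B).eval ρ e ↔ (A.eval ρ e ↔ B.eval ρ e) := by
  simp only [Fml.iff, Fml.eval, Fml.eval_imp]; tauto

theorem Fml.eval_eq_ext (s t : Tm n) (e : Fin n → M) :
    (s =ₖ t).eval ρ e ↔ ∀ x, x ∈ s.eval ρ e ↔ x ∈ t.eval ρ e := by
  simp only [Fml.eq, Fml.eval, Tm.eval_lift]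
  simp only [Tm.eval, Fin.snoc_last]
  exact ⟨fun h x => ⟨h.1 x, h.2 x⟩, fun h => ⟨fun x => (h x).1, fun x => (h x).2⟩⟩

end Semantics

/-- Extensional models of `KP` in which every element is the value of a free variable. -/
class KPModel (M : Type) extends Membership M M where
  ρ : ℕ → M
  surj : Function.Surjective ρ
  ext : ∀ {x y : M}, (∀ z, z ∈ x ↔ z ∈ y) → x = y
  pair : ∀ a b : M, ∃ u : M, a ∈ u ∧ b ∈ u
  union : ∀ a : M, ∃ u : M, ∀ x ∈ a, ∀ y ∈ x, y ∈ u
  sep : ∀ (A : Fml 1), A.IsDelta0 → ∀ a : M, ∃ u : M, ∀ x, x ∈ u ↔ x ∈ a ∧ A.eval ρ (fun _ => x)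
  ind : ∀ A : Fml 1, (∀ x, (∀ y ∈ x, A.eval ρ (fun _ => y)) → A.eval ρ (fun _ => x)) →
    ∀ x, A.eval ρ (fun _ => x)
  inf : ∃ x : M, (∃ y, y ∈ x) ∧ ∀ y ∈ x, ∃ z ∈ x, y ∈ z
  coll : ∀ G : Fml 2, G.IsDelta0 → ∀ a : M, (∀ x ∈ a, ∃ y, G.eval ρ ![x, y]) →
    ∃ u : M, ∀ x ∈ a, ∃ y ∈ u, G.eval ρ ![x, y]

theorem Fml.eval_eq {M : Type} [KPModel M] {ρ : ℕ → M} {n : ℕ} (s t : Tm n) (e : Fin n → M) :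
    (s =ₖ t).eval ρ e ↔ s.eval ρ e = t.eval ρ e := by
  rw [Fml.eval_eq_ext]
  exact ⟨KPModel.ext, fun h => by simp [h]⟩

/-! ## Completeness -/

def Tm.code {n : ℕ} : Tm n → ℕ
  | .free i => Nat.pair 0 i
  | .bd j => Nat.pair 1 j

theorem Tm.code_injective {n : ℕ} : Function.Injective (Tm.code (n := n)) := by
  intro s t h
  cases s <;> cases t <;> simp_all [Tm.code, Nat.pair_eq_pair, Fin.ext_iff]

/-- The codes serve only to make the set of formulas countable. The scope `n` need not be recorded,
since codes are compared only between formulas of equal scope. -/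
def Fml.code : {n : ℕ} → Fml n → ℕ
  | _, .mem s t => Nat.pair 0 (Nat.pair s.code t.code)
  | _, .nmem s t => Nat.pair 1 (Nat.pair s.code t.code)
  | _, .and A B => Nat.pair 2 (Nat.pair A.code B.code)
  | _, .or A B => Nat.pair 3 (Nat.pair A.code B.code)
  | _, .all A => Nat.pair 4 A.code
  | _, .ex A => Nat.pair 5 A.code
  | _, .ball t A => Nat.pair 6 (Nat.pair t.code A.code)
  | _, .bex t A => Nat.pair 7 (Nat.pair t.code A.code)

theorem Fml.code_inj {n : ℕ} (A : Fml n) : ∀ B : Fml n, A.code = B.code → A = B := by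
  induction A with
  | mem s t => intro B h; cases B <;> simp_all [Fml.code, Nat.pair_eq_pair, Tm.code_injective.eq_iff]
  | nmem s t => intro B h; cases B <;> simp_all [Fml.code, Nat.pair_eq_pair, Tm.code_injective.eq_iff]
  | and A A' ihA ihB =>
    intro B h; cases B <;> simp [Fml.code, Nat.pair_eq_pair] at h
    rw [ihA _ h.1, ihB _ h.2]
  | or A A' ihA ihB =>
    intro B h; cases B <;> simp [Fml.code, Nat.pair_eq_pair] at h
    rw [ihA _ h.1, ihB _ h.2]
  | all A ih =>
    intro B h; cases B <;> simp [Fml.code, Nat.pair_eq_pair] at h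
    rw [ih _ h]
  | ex A ih =>
    intro B h; cases B <;> simp [Fml.code, Nat.pair_eq_pair] at h
    rw [ih _ h]
  | ball t A ih =>
    intro B h; cases B <;> simp [Fml.code, Nat.pair_eq_pair] at h
    rw [ih _ h.2, Tm.code_injective h.1]
  | bex t A ih =>
    intro B h; cases B <;> simp [Fml.code, Nat.pair_eq_pair] at h
    rw [ih _ h.2, Tm.code_injective h.1]

instance : Nonempty (Fml 0) := ⟨.mem (.free 0) (.free 0)⟩

instance : Countable (Fml 0) := ⟨⟨Fml.code, fun A B h => Fml.code_inj A B h⟩⟩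

/-- A bound on the free variables of a formula. -/
def Tm.bound {n : ℕ} : Tm n → ℕ
  | .free i => i + 1
  | .bd _ => 0

def Fml.bound : {n : ℕ} → Fml n → ℕ
  | _, .mem s t => max s.bound t.bound
  | _, .nmem s t => max s.bound t.bound
  | _, .and A B => max A.bound B.bound
  | _, .or A B => max A.bound B.bound
  | _, .all A => A.bound
  | _, .ex A => A.bound
  | _, .ball t A => max t.bound A.bound
  | _, .bex t A => max t.bound A.bound

theorem Fml.not_occurs {n a : ℕ} (A : Fml n) (h : A.bound ≤ a) : ¬ A.Occurs a := by
  have key : ∀ {n : ℕ} (t : Tm n), t.bound ≤ a → t ≠ .free a := by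
    intro n t ht hh; subst hh; simp [Tm.bound] at ht
  induction A <;> simp_all [Fml.bound, Fml.Occurs]

theorem exists_fresh (Γ : Finset (Fml 0)) : ∃ a, ∀ C ∈ Γ, ¬ C.Occurs a :=
  ⟨Γ.sup Fml.bound, fun C hC => C.not_occurs (Finset.le_sup (f := Fml.bound) hC)⟩

/-! ### Composition of substitutions. -/

theorem Tm.subst_subst {n m k : ℕ} (σ : Fin n → Tm m) (τ : Fin m → Tm k) (t : Tm n) :
    (t.subst σ).subst τ = t.subst (fun i => (σ i).subst τ) := by
  cases t <;> rfl

theorem Tm.subst_lift {n m : ℕ} (τ : Fin n → Tm m) (t : Tm n) :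
    t.lift.subst (up τ) = (t.subst τ).lift := by
  cases t <;> simp [Tm.lift, Tm.subst, up]

theorem up_comp {n m k : ℕ} (σ : Fin n → Tm m) (τ : Fin m → Tm k) :
    (fun i => (up σ i).subst (up τ)) = up (fun i => (σ i).subst τ) := by
  funext i
  refine Fin.lastCases ?_ (fun j => ?_) i
  · simp [up, Tm.subst]
  · have h : (up σ j.castSucc).subst (up τ) = ((σ j).subst τ).lift := by
      rw [← Tm.subst_lift]; simp [up]
    rw [h]; simp [up]

theorem Fml.subst_subst {n : ℕ} (A : Fml n) : ∀ {m k : ℕ} (σ : Fin n → Tm m) (τ : Fin m → Tm k),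
    (A.subst σ).subst τ = A.subst (fun i => (σ i).subst τ) := by
  induction A <;> intros <;> simp_all [Fml.subst, Tm.subst_subst, up_comp]

/-- This is the quantifier step of the truth lemma: instantiating the body of a quantifier by a free
variable amounts to extending the assignment `σ`. -/
theorem Fml.subst_app {n : ℕ} (A : Fml (n + 1)) (σ : Fin n → ℕ) (a : ℕ) :
    (A.subst (up fun i => .free (σ i))).app (.free a : Tm 0) =
      A.subst (fun i => .free (Fin.snoc (α := fun _ => ℕ) σ a i)) := by
  rw [Fml.app, Fml.subst_subst]
  congr 1
  funext i
  refine Fin.lastCases ?_ (fun j => ?_) i <;> simp [up, Tm.subst, Tm.lift]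

theorem Fml.subst_neg {n : ℕ} (A : Fml n) : ∀ {m : ℕ} (σ : Fin n → Tm m),
    A.neg.subst σ = (A.subst σ).neg := by
  induction A <;> intros <;> simp_all [Fml.subst, Fml.neg]

/-! ### Maximal underivable sets with witnesses. -/

/-- A maximal set of formulas whose finite subsets extend to underivable sequents, with witnesses for universal
formulas. -/
structure Refuting (R : Set (Fml 0)) : Prop where
  consistent : ∀ Δ : Finset (Fml 0), ↑Δ ⊆ R → ∃ Γ, Δ ⊆ Γ ∧ ¬ Derivable Γ
  complete : ∀ A : Fml 0, A ∈ R ∨ A.neg ∈ R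
  all_wit : ∀ F : Fml 1, Fml.all F ∈ R → ∃ a, F.app (.free a : Tm 0) ∈ R
  ball_wit : ∀ (b : ℕ) (F : Fml 1), Fml.ball (.free b) F ∈ R →
    ∃ a, (.free a ∈ₖ .free b ⇒ₖ F.app (.free a : Tm 0)) ∈ R

/-- `Δ` extends `Γ`, decides `A`, and contains a witness if `A` is a universal formula in `Δ`. -/
def Extends (A : Fml 0) (Γ Δ : Finset (Fml 0)) : Prop :=
  Γ ⊆ Δ ∧ ¬ Derivable Δ ∧ (A ∈ Δ ∨ A.neg ∈ Δ) ∧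
  (∀ F : Fml 1, A = Fml.all F → A ∈ Δ → ∃ a, F.app (.free a : Tm 0) ∈ Δ) ∧
  (∀ (b : ℕ) (F : Fml 1), A = Fml.ball (.free b) F → A ∈ Δ →
    ∃ a, (.free a ∈ₖ .free b ⇒ₖ F.app (.free a : Tm 0)) ∈ Δ)

/-- By cut, `A` or its negation can be added without making the sequent derivable. If `A` itself is
added and is universal, its instance at a fresh variable can be added as well, because the
eigenvariable rule would otherwise derive `A`. -/
theorem exists_extends (A : Fml 0) (Γ : Finset (Fml 0)) (hΓ : ¬ Derivable Γ) :
    ∃ Δ, Extends A Γ Δ := by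
  by_cases hA : Derivable (insert A Γ)
  · have hn : ¬ Derivable (insert A.neg Γ) := fun h => hΓ (.cut Γ A hA h)
    refine ⟨insert A.neg Γ, Finset.subset_insert _ _, hn, .inr (Finset.mem_insert_self _ _), ?_, ?_⟩
    -- The witness conditions are vacuous here: a sequent containing both `A` and its negation is a
    -- logical axiom.
    all_goals
      intros
      exfalso
      apply hn
      have := Derivable.logical (insert A.neg Γ) A
      simp_all
  · obtain ⟨a, ha⟩ := exists_fresh (insert A Γ)
    by_cases h1 : ∃ F : Fml 1, A = Fml.all F
    · obtain ⟨F, rfl⟩ := h1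
      -- The universal formula stays in the sequent; the rule is applied with a context that already
      -- contains it, and the duplicate collapses because sequents are sets.
      refine ⟨insert (F.app (.free a)) (insert (Fml.all F) Γ),
        (Finset.subset_insert _ _).trans (Finset.subset_insert _ _), fun h => hA ?_, ?_, ?_, ?_⟩
      · have := Derivable.all_intro (insert (Fml.all F) Γ) a F (by simpa using ha) h
        simpa using this
      · simp
      · rintro F' h -
        cases h
        exact ⟨a, by simp⟩
      · rintro b F' h -
        cases h
    · by_cases h2 : ∃ (b : ℕ) (F : Fml 1), A = Fml.ball (.free b) F
      · obtain ⟨b, F, rfl⟩ := h2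
        refine ⟨insert (.free a ∈ₖ .free b ⇒ₖ F.app (.free a)) (insert (Fml.ball (.free b) F) Γ),
          (Finset.subset_insert _ _).trans (Finset.subset_insert _ _), fun h => hA ?_, ?_, ?_, ?_⟩
        · have := Derivable.ball_intro (insert (Fml.ball (.free b) F) Γ) a b F (by simpa using ha) h
          simpa using this
        · simp
        · rintro F' h -
          cases h
        · rintro b F' h -
          cases h
          exact ⟨a, by simp⟩
      · refine ⟨insert A Γ, Finset.subset_insert _ _, hA, .inl (Finset.mem_insert_self _ _), ?_, ?_⟩
        · intro F h
          exact absurd ⟨F, h⟩ h1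
        · intro b F h
          exact absurd ⟨b, F, h⟩ h2

/-- The formulas are enumerated and treated one after another by `exists_extends`; the union of the
stages is the required set. -/
theorem exists_refuting (Γ : Finset (Fml 0)) (hΓ : ¬ Derivable Γ) :
    ∃ R : Set (Fml 0), Refuting R ∧ ↑Γ ⊆ R := by
  obtain ⟨f, hf⟩ := exists_surjective_nat (Fml 0)
  choose! g hg using exists_extends
  let s : ℕ → Finset (Fml 0) := fun k => Nat.rec Γ (fun k Δ => g (f k) Δ) k
  have s_succ : ∀ k, s (k + 1) = g (f k) (s k) := fun k => rfl
  have hs : ∀ k, ¬ Derivable (s k) := by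
    intro k
    induction k with
    | zero => exact hΓ
    | succ k ih => rw [s_succ]; exact (hg (f k) (s k) ih).2.1
  have hext : ∀ k, Extends (f k) (s k) (s (k + 1)) := fun k => hg (f k) (s k) (hs k)
  have mono : Monotone s := monotone_nat_of_le_succ fun k => (hext k).1
  have key : ∀ Δ : Finset (Fml 0), ↑Δ ⊆ {A | ∃ k, A ∈ s k} → ∃ k, Δ ⊆ s k := by
    intro Δ
    induction Δ using Finset.induction_on with
    | empty => intro _; exact ⟨0, by simp⟩
    | insert A Δ _ ih =>
      intro h
      obtain ⟨k, hk⟩ := ih (fun x hx => h (by simp at hx ⊢; exact .inr hx))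
      obtain ⟨l, hl⟩ := h (show A ∈ _ by simp)
      refine ⟨max k l, Finset.insert_subset (mono (le_max_right k l) hl)
        (hk.trans (mono (le_max_left k l)))⟩
  have dis : ∀ A k, A ∈ s k → A.neg ∈ s k → False := by
    intro A k h h'
    apply hs k
    have := Derivable.logical (s k) A
    rwa [Finset.insert_eq_of_mem h', Finset.insert_eq_of_mem h] at this
  -- A formula that occurs at any stage is already chosen at its own turn, since its negation would
  -- otherwise meet it at a later stage. So the witness conditions, which are granted only at that
  -- turn, apply to it.
  have sel : ∀ k, (∃ l, f k ∈ s l) → f k ∈ s (k + 1) := by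
    rintro k ⟨l, hl⟩
    refine (hext k).2.2.1.resolve_right fun h => ?_
    exact dis _ (max l (k + 1)) (mono (le_max_left _ _) hl) (mono (le_max_right _ _) h)
  refine ⟨{A | ∃ k, A ∈ s k}, ⟨?_, ?_, ?_, ?_⟩, fun A hA => ⟨0, hA⟩⟩
  · intro Δ hΔ
    obtain ⟨k, hk⟩ := key Δ hΔ
    exact ⟨s k, hk, hs k⟩
  · intro A
    obtain ⟨k, rfl⟩ := hf A
    exact (hext k).2.2.1.imp (fun h => ⟨k + 1, h⟩) (fun h => ⟨k + 1, h⟩)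
  · intro F hF
    obtain ⟨k, hk⟩ := hf (Fml.all F)
    obtain ⟨a, ha⟩ := (hext k).2.2.2.1 F hk (sel k (by rw [hk]; exact hF))
    exact ⟨a, k + 1, ha⟩
  · intro b F hF
    obtain ⟨k, hk⟩ := hf (Fml.ball (.free b) F)
    obtain ⟨a, ha⟩ := (hext k).2.2.2.2 b F hk (sel k (by rw [hk]; exact hF))
    exact ⟨a, k + 1, ha⟩

/-! ### Truth conditions, where `A ∉ R` is read as "`A` is true". -/

namespace Refuting

variable {R : Set (Fml 0)}

theorem underivable (hR : Refuting R) {A : Fml 0} (hA : A ∈ R) :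
    ∃ Γ, ¬ Derivable (insert A Γ) := by
  obtain ⟨Γ, h, h'⟩ := hR.consistent {A} (by simpa using hA)
  exact ⟨Γ, by rwa [Finset.insert_eq_of_mem (by simpa using h)]⟩

theorem valid (hR : Refuting R) {A : Fml 0} (h : ∀ Γ, Derivable (insert A Γ)) : A ∉ R := fun hA =>
  let ⟨Γ, hΓ⟩ := hR.underivable hA
  hΓ (h Γ)

theorem neg_mem_iff (hR : Refuting R) (A : Fml 0) : A.neg ∈ R ↔ A ∉ R := by
  refine ⟨fun h h' => ?_, fun h => (hR.complete A).resolve_left h⟩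
  obtain ⟨Γ, hs, hd⟩ := hR.consistent {A, A.neg} (by
    intro x hx
    simp at hx
    rcases hx with rfl | rfl <;> assumption)
  apply hd
  have h1 : A ∈ Γ := hs (by simp)
  have h2 : A.neg ∈ Γ := hs (by simp)
  have := Derivable.logical Γ A
  rwa [Finset.insert_eq_of_mem h2, Finset.insert_eq_of_mem h1] at this

/-- If `A ∈ R` and `B, C ∉ R`, then some underivable sequent `Γ` contains `A` while `Γ, B` and `Γ, C`
are derivable. -/
theorem sequent (hR : Refuting R) {A B C : Fml 0} (hA : A ∈ R) (hB : B ∉ R) (hC : C ∉ R) :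
    ∃ Γ, insert A Γ = Γ ∧ ¬ Derivable Γ ∧ Derivable (insert B Γ) ∧ Derivable (insert C Γ) := by
  obtain ⟨Γ, hs, hd⟩ := hR.consistent {A, B.neg, C.neg} (by
    intro x hx
    simp at hx
    rcases hx with rfl | rfl | rfl
    · exact hA
    · exact (hR.neg_mem_iff _).2 hB
    · exact (hR.neg_mem_iff _).2 hC)
  refine ⟨Γ, Finset.insert_eq_of_mem (hs (by simp)), hd, ?_, ?_⟩
  · have := Derivable.logical Γ B
    rwa [Finset.insert_eq_of_mem (hs (by simp) : B.neg ∈ Γ)] at this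
  · have := Derivable.logical Γ C
    rwa [Finset.insert_eq_of_mem (hs (by simp) : C.neg ∈ Γ)] at this

theorem notMem_of_rule (hR : Refuting R) {A B : Fml 0} (hB : B ∉ R)
    (h : ∀ Γ, Derivable (insert B Γ) → Derivable (insert A Γ)) : A ∉ R := by
  intro hA
  obtain ⟨Γ, h1, h2, h3, -⟩ := hR.sequent hA hB hB
  exact h2 (h1 ▸ h Γ h3)

theorem and_intro (hR : Refuting R) {A B : Fml 0} (hA : A ∉ R) (hB : B ∉ R) : A ⋏ B ∉ R := by
  intro h
  obtain ⟨Γ, h1, h2, h3, h4⟩ := hR.sequent h hA hB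
  exact h2 (h1 ▸ Derivable.and_intro Γ A B h3 h4)

theorem or_intro (hR : Refuting R) {A B : Fml 0} (h : A ∉ R ∨ B ∉ R) : A ⋎ B ∉ R :=
  h.elim (fun h => hR.notMem_of_rule h fun Γ => .or_left Γ A B)
    (fun h => hR.notMem_of_rule h fun Γ => .or_right Γ A B)

/-- The direction from right to left is the rule of the calculus. The inversion passes to the
negation, which lies in `R`, and refutes it by the rule for the dual connective; the quantifiers are
treated in the same way. -/
theorem and_iff (hR : Refuting R) (A B : Fml 0) : A ⋏ B ∉ R ↔ A ∉ R ∧ B ∉ R := by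
  refine ⟨fun h => ?_, fun h => hR.and_intro h.1 h.2⟩
  rw [← hR.neg_mem_iff, Fml.neg] at h
  constructor
  · exact fun hA => hR.or_intro (.inl fun h' => (hR.neg_mem_iff A).1 h' hA) h
  · exact fun hB => hR.or_intro (.inr fun h' => (hR.neg_mem_iff B).1 h' hB) h

theorem or_iff (hR : Refuting R) (A B : Fml 0) : A ⋎ B ∉ R ↔ A ∉ R ∨ B ∉ R := by
  refine ⟨fun h => ?_, hR.or_intro⟩
  by_contra! hc
  rw [← hR.neg_mem_iff, Fml.neg] at h
  exact hR.and_intro (fun h' => (hR.neg_mem_iff A).1 h' hc.1)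
    (fun h' => (hR.neg_mem_iff B).1 h' hc.2) h

theorem nmem_iff (hR : Refuting R) (s t : Tm 0) : Fml.nmem s t ∉ R ↔ ¬ s ∈ₖ t ∉ R := by
  have := hR.neg_mem_iff (s ∈ₖ t)
  rw [Fml.neg] at this
  tauto

theorem app_neg (hR : Refuting R) (F : Fml 1) (t : Tm 0) : F.neg.app t ∈ R ↔ F.app t ∉ R := by
  rw [Fml.app, Fml.subst_neg]
  exact hR.neg_mem_iff _

theorem ex_iff (hR : Refuting R) (F : Fml 1) :
    Fml.ex F ∉ R ↔ ∃ a, F.app (.free a : Tm 0) ∉ R := by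
  refine ⟨fun h => ?_, fun ⟨a, h⟩ => hR.notMem_of_rule h fun Γ => .ex_intro Γ a F⟩
  rw [← hR.neg_mem_iff, Fml.neg] at h
  obtain ⟨a, ha⟩ := hR.all_wit _ h
  exact ⟨a, (hR.app_neg _ _).1 ha⟩

theorem all_iff (hR : Refuting R) (F : Fml 1) :
    Fml.all F ∉ R ↔ ∀ a, F.app (.free a : Tm 0) ∉ R := by
  refine ⟨fun h a ha => ?_, fun h h' => ?_⟩
  · rw [← hR.neg_mem_iff, Fml.neg] at h
    exact (hR.ex_iff _).2 ⟨a, fun h' => (hR.app_neg _ _).1 h' ha⟩ h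
  · obtain ⟨a, ha⟩ := hR.all_wit _ h'
    exact h a ha

theorem ball_of_forall (hR : Refuting R) (b : ℕ) (F : Fml 1)
    (h : ∀ a, (.free a : Tm 0) ∈ₖ .free b ∉ R → F.app (.free a : Tm 0) ∉ R) :
    Fml.ball (.free b) F ∉ R := by
  intro h'
  obtain ⟨a, ha⟩ := hR.ball_wit _ _ h'
  refine (hR.or_iff _ _).2 ?_ ha
  by_cases hm : (.free a : Tm 0) ∈ₖ .free b ∉ R
  · exact .inr (h a hm)
  · exact .inl ((hR.nmem_iff _ _).2 hm)

theorem bex_iff (hR : Refuting R) (b : ℕ) (F : Fml 1) :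
    Fml.bex (.free b) F ∉ R ↔
      ∃ a, (.free a : Tm 0) ∈ₖ .free b ∉ R ∧ F.app (.free a : Tm 0) ∉ R := by
  constructor
  · intro h
    by_contra! hc
    rw [← hR.neg_mem_iff, Fml.neg] at h
    refine hR.ball_of_forall _ _ (fun a ha h' => ?_) h
    exact (hR.app_neg _ _).1 h' (hc a ha)
  · rintro ⟨a, h1, h2⟩
    exact hR.notMem_of_rule (hR.and_intro h1 h2) fun Γ => .bex_intro Γ a b F

theorem ball_iff (hR : Refuting R) (b : ℕ) (F : Fml 1) :
    Fml.ball (.free b) F ∉ R ↔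
      ∀ a, (.free a : Tm 0) ∈ₖ .free b ∉ R → F.app (.free a : Tm 0) ∉ R := by
  refine ⟨fun h a hm ha => ?_, hR.ball_of_forall b F⟩
  rw [← hR.neg_mem_iff, Fml.neg] at h
  exact (hR.bex_iff _ _).2 ⟨a, hm, fun h' => (hR.app_neg _ _).1 h' ha⟩ h

end Refuting

/-! ### The term model and the truth lemma. -/

/-- Free variables are identified if they have the same elements. -/
def extSetoid (R : Set (Fml 0)) : Setoid ℕ where
  r a b := ∀ c, (.free c : Tm 0) ∈ₖ .free a ∉ R ↔ (.free c : Tm 0) ∈ₖ .free b ∉ R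
  iseqv := ⟨fun _ _ => Iff.rfl, fun h c => (h c).symm, fun h h' c => (h c).trans (h' c)⟩

theorem Fml.eq_app_iff {R : Set (Fml 0)} (hR : Refuting R) (a b : ℕ) :
    ((.free a : Tm 0) =ₖ .free b) ∉ R ↔ extSetoid R a b := by
  rw [Fml.eq, hR.and_iff]
  simp only [Tm.lift, hR.ball_iff]
  exact ⟨fun h c => ⟨h.1 c, h.2 c⟩, fun h => ⟨fun c => (h c).1, fun c => (h c).2⟩⟩

/-- Replacing the set on the right of `∈` is built into `extSetoid`. Replacing the element on the
left needs the extensionality axiom, here for the formula `x ∈ c`. -/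
theorem mem_congr {R : Set (Fml 0)} (hR : Refuting R) {a b c : ℕ} (h : extSetoid R a b)
    (h' : (.free a : Tm 0) ∈ₖ .free c ∉ R) : (.free b : Tm 0) ∈ₖ .free c ∉ R := by
  have := hR.valid fun Γ => Derivable.extensionality Γ a b (v 0 ∈ₖ .free c)
  rw [Fml.imp, hR.or_iff] at this
  refine this.resolve_left fun h1 => ?_
  exact h1 ((hR.neg_mem_iff _).2 (hR.and_intro ((Fml.eq_app_iff hR a b).2 h) h'))

/-- The term model. -/
def TermModel (R : Set (Fml 0)) : Type := Quotient (extSetoid R)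

def TermModel.mk (R : Set (Fml 0)) (a : ℕ) : TermModel R := Quotient.mk (extSetoid R) a

/-- The first argument of `mem` is the containing set. Quantifying over representatives postpones
the question of independence, which `TermModel.mk_mem` settles. -/
instance (R : Set (Fml 0)) : Membership (TermModel R) (TermModel R) where
  mem x y := ∃ a b, x = TermModel.mk R b ∧ y = TermModel.mk R a ∧ (.free a : Tm 0) ∈ₖ .free b ∉ R

theorem TermModel.mk_mem {R : Set (Fml 0)} (hR : Refuting R) (a b : ℕ) :
    TermModel.mk R a ∈ TermModel.mk R b ↔ (.free a : Tm 0) ∈ₖ .free b ∉ R := by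
  constructor
  · rintro ⟨a', b', hb, ha, h⟩
    exact ((Quotient.exact hb) a).2 (mem_congr hR ((extSetoid R).symm (Quotient.exact ha)) h)
  · exact fun h => ⟨a, b, rfl, rfl, h⟩

/-- The truth lemma is proved for open formulas. Every element of the model is the class of a free
variable, so quantifiers over the model become quantifiers over names, and these are evaluated by
the truth conditions for `R`. -/
theorem TermModel.truth {R : Set (Fml 0)} (hR : Refuting R) {n : ℕ} (A : Fml n) :
    ∀ σ : Fin n → ℕ, A.eval (TermModel.mk R) (fun i => TermModel.mk R (σ i)) ↔
      A.subst (fun i => (.free (σ i) : Tm 0)) ∉ R := by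
  have tm : ∀ {n : ℕ} (t : Tm n) (σ : Fin n → ℕ), ∃ a, t.subst (fun i => (.free (σ i) : Tm 0)) =
      .free a ∧ t.eval (TermModel.mk R) (fun i => TermModel.mk R (σ i)) = TermModel.mk R a := by
    intro n t σ
    cases t with
    | free i => exact ⟨i, rfl, rfl⟩
    | bd j => exact ⟨σ j, rfl, rfl⟩
  have snoc : ∀ {n : ℕ} (σ : Fin n → ℕ) (a : ℕ),
      (Fin.snoc (α := fun _ => TermModel R) (fun i => TermModel.mk R (σ i)) (TermModel.mk R a)) =
        fun i => TermModel.mk R (Fin.snoc (α := fun _ => ℕ) σ a i) := by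
    intro n σ a
    funext i
    refine Fin.lastCases ?_ (fun j => ?_) i <;> simp
  have surj : ∀ {P : TermModel R → Prop}, (∀ x, P x) ↔ ∀ a, P (TermModel.mk R a) := fun {P} =>
    ⟨fun h a => h _, fun h x => Quotient.inductionOn x h⟩
  have surj' : ∀ {P : TermModel R → Prop}, (∃ x, P x) ↔ ∃ a, P (TermModel.mk R a) := fun {P} =>
    ⟨fun ⟨x, h⟩ => by obtain ⟨a, rfl⟩ := Quotient.exists_rep x; exact ⟨a, h⟩, fun ⟨a, h⟩ => ⟨_, h⟩⟩
  induction A with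
  | mem s t =>
    intro σ
    obtain ⟨a, ha, ha'⟩ := tm s σ
    obtain ⟨b, hb, hb'⟩ := tm t σ
    rw [Fml.eval, Fml.subst, ha, ha', hb, hb', TermModel.mk_mem hR]
  | nmem s t =>
    intro σ
    obtain ⟨a, ha, ha'⟩ := tm s σ
    obtain ⟨b, hb, hb'⟩ := tm t σ
    rw [Fml.eval, Fml.subst, ha, ha', hb, hb', TermModel.mk_mem hR, hR.nmem_iff]
  | and A B ihA ihB => intro σ; rw [Fml.eval, Fml.subst, hR.and_iff, ihA, ihB]
  | or A B ihA ihB => intro σ; rw [Fml.eval, Fml.subst, hR.or_iff, ihA, ihB]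
  | all A ih => intro σ; simp only [Fml.eval, Fml.subst, hR.all_iff, surj, snoc, ih, Fml.subst_app]
  | ex A ih => intro σ; simp only [Fml.eval, Fml.subst, hR.ex_iff, surj', snoc, ih, Fml.subst_app]
  | ball t A ih =>
    intro σ
    obtain ⟨a, ha, ha'⟩ := tm t σ
    simp only [Fml.eval, Fml.subst, ha, ha', hR.ball_iff, surj, snoc, ih, Fml.subst_app,
      TermModel.mk_mem hR]
  | bex t A ih =>
    intro σ
    obtain ⟨a, ha, ha'⟩ := tm t σ
    simp only [Fml.eval, Fml.subst, ha, ha', hR.bex_iff, surj', snoc, ih, Fml.subst_app,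
      TermModel.mk_mem hR]

theorem Fml.subst_bd {n : ℕ} (A : Fml n) : A.subst Tm.bd = A := by
  have tm : ∀ {n : ℕ} (t : Tm n), t.subst Tm.bd = t := fun t => by cases t <;> rfl
  have hup : ∀ n : ℕ, up (Tm.bd : Fin n → Tm n) = Tm.bd := by
    intro n
    funext i
    refine Fin.lastCases ?_ (fun j => ?_) i <;> simp [up, Tm.lift]
  induction A <;> simp_all [Fml.subst]

theorem TermModel.truth_closed {R : Set (Fml 0)} (hR : Refuting R) (A : Fml 0)
    (e : Fin 0 → TermModel R) : A.eval (TermModel.mk R) e ↔ A ∉ R := by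
  have := TermModel.truth hR A Fin.elim0
  rwa [Subsingleton.elim (fun i => (.free (Fin.elim0 i) : Tm 0)) Tm.bd, Fml.subst_bd,
    Subsingleton.elim (fun i => TermModel.mk R (Fin.elim0 i)) e] at this

theorem TermModel.exists_mk {R : Set (Fml 0)} (x : TermModel R) : ∃ a, TermModel.mk R a = x :=
  Quotient.exists_rep x

theorem TermModel.eval_of_valid {R : Set (Fml 0)} (hR : Refuting R) {A : Fml 0}
    (h : ∀ Γ, Derivable (insert A Γ)) : A.eval (TermModel.mk R) Fin.elim0 :=
  (TermModel.truth_closed hR A _).2 (hR.valid h)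

/-- The term model is a model of `KP`. -/
@[reducible] def TermModel.kpModel {R : Set (Fml 0)} (hR : Refuting R) : KPModel (TermModel R) where
  ρ := TermModel.mk R
  surj := TermModel.exists_mk
  ext := by
    intro x y h
    obtain ⟨a, rfl⟩ := x.exists_mk
    obtain ⟨b, rfl⟩ := y.exists_mk
    refine Quotient.sound fun c => ?_
    simpa [TermModel.mk_mem hR] using h (TermModel.mk R c)
  pair := by
    intro x y
    obtain ⟨a, rfl⟩ := x.exists_mk
    obtain ⟨b, rfl⟩ := y.exists_mk
    exact TermModel.eval_of_valid hR fun Γ => Derivable.pair Γ a b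
  union := by
    intro x
    obtain ⟨a, rfl⟩ := x.exists_mk
    exact TermModel.eval_of_valid hR fun Γ => Derivable.union Γ a
  sep := by
    intro A hA x
    obtain ⟨a, rfl⟩ := x.exists_mk
    obtain ⟨u, h1, h2⟩ := TermModel.eval_of_valid hR fun Γ => Derivable.separation Γ a A hA
    refine ⟨u, fun x => ⟨fun h => ?_, fun h => ?_⟩⟩
    · have := h1 x h
      simp only [Fml.eval, Fml.eval_app] at this
      exact this
    · have := h2 x h.1
      simp only [Fml.eval_imp, Fml.eval_app] at this
      exact this h.2
  ind := by
    intro A h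
    have := TermModel.eval_of_valid hR fun Γ => Derivable.setInduction Γ A
    simp only [Fml.eval_imp, Fml.eval, Fml.eval_app] at this
    intro x
    have h' := this (fun x h1 => h x h1) x
    have hs : Fin.snoc (α := fun _ => TermModel R) Fin.elim0 x = fun _ : Fin 1 => x := by
      funext i
      fin_cases i
      rfl
    rwa [hs] at h'
  inf := by
    obtain ⟨x, ⟨y, hy, -⟩, h⟩ := TermModel.eval_of_valid hR fun Γ => Derivable.infinity Γ
    exact ⟨x, ⟨y, hy⟩, h⟩
  coll := by
    intro G hG x h
    obtain ⟨a, rfl⟩ := x.exists_mk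
    have := TermModel.eval_of_valid hR fun Γ => Derivable.collection Γ a G hG
    simp only [Fml.eval_imp, Fml.eval, Fml.eval_subst] at this
    have e2 : ∀ x y : TermModel R,
        Fin.snoc (α := fun _ => TermModel R) (Fin.snoc (α := fun _ => TermModel R) Fin.elim0 x) y =
          (![x, y] : Fin 2 → _) := by
      intro x y
      funext i
      fin_cases i <;> rfl
    obtain ⟨u, hu⟩ := this fun x hx => (h x hx).imp fun y hy => by rwa [e2]
    refine ⟨u, fun x hx => ?_⟩
    obtain ⟨y, hy, hG⟩ := hu x hx
    refine ⟨y, hy, ?_⟩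
    convert hG using 1
    funext i
    fin_cases i <;> rfl

/-- Completeness: a formula that holds in all models of `KP` is derivable. -/
theorem KPProves_of_eval (A : Fml 0)
    (h : ∀ (M : Type) [KPModel M], A.eval (KPModel.ρ (M := M)) Fin.elim0) : KPProves A := by
  by_contra hA
  obtain ⟨R, hR, hs⟩ := exists_refuting _ hA
  let _ := TermModel.kpModel hR
  exact (TermModel.truth_closed hR A Fin.elim0).1 (h (TermModel R)) (hs (by simp))

end KPSet

namespace KPSet

/-! ## Definable predicates -/

/-- The type `X` consists of tuples of elements of `M`. -/
class Ctx (M : Type) (X : Type) where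
  size : ℕ
  get : X → Fin size → M

instance (M : Type) : Ctx M Unit := ⟨0, fun _ => Fin.elim0⟩

/-- The new component is appended at the end, in accordance with the numbering of bound variables
from the outside in. The body of a quantifier over a predicate on `X` is thus a formula about `X ×
M`. -/
instance (M X : Type) [Ctx M X] : Ctx M (X × M) :=
  ⟨Ctx.size M X + 1, fun p => Fin.snoc (α := fun _ => M) (Ctx.get p.1) p.2⟩

section Classes

variable (M : Type) [KPModel M] {X Y : Type} [Ctx M X] [Ctx M Y]

/-- The components of `f x` are components of `x` or constants. -/
class Proj (f : X → Y) : Prop where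
  out : ∃ σ : Fin (Ctx.size M Y) → Tm (Ctx.size M X), ∀ x i,
    Ctx.get (M := M) (f x) i = (σ i).eval KPModel.ρ (Ctx.get x)

/-- `f x` is a component of `x` or a constant. -/
class IsVar (f : X → M) : Prop where
  out : ∃ t : Tm (Ctx.size M X), ∀ x, f x = t.eval KPModel.ρ (Ctx.get x)

/-- Predicates given by a `Δ₀`-formula with parameters. -/
class D0 (P : X → Prop) : Prop where
  out : ∃ A : Fml (Ctx.size M X), A.IsDelta0 ∧ ∀ x, P x ↔ A.eval KPModel.ρ (Ctx.get x)

/-- Predicates given by a formula with parameters. -/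
class Def (P : X → Prop) : Prop where
  out : ∃ A : Fml (Ctx.size M X), ∀ x, P x ↔ A.eval KPModel.ρ (Ctx.get x)

/-- Functions with a definable graph. -/
class DefFun (f : X → M) : Prop where
  out : Def M (fun p : X × M => p.2 = f p.1)

end Classes

theorem Fml.IsDelta0.subst {n : ℕ} {A : Fml n} (h : A.IsDelta0) :
    ∀ {m : ℕ} (σ : Fin n → Tm m), (A.subst σ).IsDelta0 := by
  induction A <;> intros <;> simp_all [Fml.subst, Fml.IsDelta0]

theorem Fml.IsDelta0.neg {n : ℕ} {A : Fml n} (h : A.IsDelta0) : A.neg.IsDelta0 := by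
  induction A <;> simp_all [Fml.neg, Fml.IsDelta0]

section Instances

variable {M : Type} [KPModel M] {X Y : Type} [Ctx M X] [Ctx M Y]

instance Proj.id : Proj M (fun x : X => x) := ⟨⟨Tm.bd, fun _ _ => rfl⟩⟩

instance Proj.unit : Proj M (fun _ : X => ()) := ⟨⟨Fin.elim0, fun _ i => i.elim0⟩⟩

instance Proj.fst (f : X → Y × M) [h : Proj M f] : Proj M (fun x => (f x).1) := by
  obtain ⟨σ, hσ⟩ := h.out
  refine ⟨⟨fun i => σ i.castSucc, fun x i => ?_⟩⟩
  rw [← hσ x i.castSucc]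
  exact (Fin.snoc_castSucc (α := fun _ => M) _ _ _).symm

instance IsVar.snd (f : X → Y × M) [h : Proj M f] : IsVar M (fun x => (f x).2) := by
  obtain ⟨σ, hσ⟩ := h.out
  refine ⟨⟨σ (Fin.last _), fun x => ?_⟩⟩
  rw [← hσ x (Fin.last _)]
  exact (Fin.snoc_last (α := fun _ => M) _ _).symm

/-- Parameters cost nothing: every element of the model is the value of a free variable. -/
instance (priority := low) IsVar.const (c : M) : IsVar M (fun _ : X => c) := by
  obtain ⟨i, rfl⟩ := KPModel.surj c
  exact ⟨⟨.free i, fun _ => rfl⟩⟩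

theorem Proj.mk' (f : X → Y) (g : X → M) [hf : Proj M f] [hg : IsVar M g] :
    Proj M (fun x => (f x, g x)) := by
  obtain ⟨σ, hσ⟩ := hf.out
  obtain ⟨t, ht⟩ := hg.out
  refine ⟨⟨Fin.snoc (α := fun _ => Tm _) σ t, fun x i => ?_⟩⟩
  refine Fin.lastCases ?_ (fun j => ?_) i
  · rw [Fin.snoc_last, ← ht]
    exact Fin.snoc_last (α := fun _ => M) _ _
  · rw [Fin.snoc_castSucc, ← hσ]
    exact Fin.snoc_castSucc (α := fun _ => M) _ _ _

theorem D0.comp {P : Y → Prop} (hP : D0 M P) (f : X → Y) [hf : Proj M f] :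
    D0 M (fun x => P (f x)) := by
  obtain ⟨A, hA, h⟩ := hP.out
  obtain ⟨σ, hσ⟩ := hf.out
  refine ⟨⟨A.subst σ, hA.subst σ, fun x => ?_⟩⟩
  rw [h, Fml.eval_subst]
  exact iff_of_eq (congrArg _ (funext fun i => hσ x i))

theorem Def.comp {P : Y → Prop} (hP : Def M P) (f : X → Y) [hf : Proj M f] :
    Def M (fun x => P (f x)) := by
  obtain ⟨A, h⟩ := hP.out
  obtain ⟨σ, hσ⟩ := hf.out
  refine ⟨⟨A.subst σ, fun x => ?_⟩⟩
  rw [h, Fml.eval_subst]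
  exact iff_of_eq (congrArg _ (funext fun i => hσ x i))

theorem D0.congr {P Q : X → Prop} (hP : D0 M P) (h : ∀ x, Q x ↔ P x) : D0 M Q :=
  (funext fun x => propext (h x) : Q = P) ▸ hP

theorem Def.congr {P Q : X → Prop} (hP : Def M P) (h : ∀ x, Q x ↔ P x) : Def M Q :=
  (funext fun x => propext (h x) : Q = P) ▸ hP

theorem D0.def {P : X → Prop} (h : D0 M P) : Def M P :=
  let ⟨A, _, h⟩ := h.out
  ⟨⟨A, h⟩⟩

/-! Unary, binary and ternary relations applied to variables -/

theorem D0.comp₁ {R : M → Prop} (h : D0 M (fun p : Unit × M => R p.2)) (f : X → M) [IsVar M f] :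
    D0 M (fun x => R (f x)) :=
  have : Proj M (fun x : X => ((), f x)) := Proj.mk' (fun _ => ()) f
  h.comp (fun x : X => ((), f x))

theorem D0.comp₂ {R : M → M → Prop} (h : D0 M (fun p : (Unit × M) × M => R p.1.2 p.2))
    (f g : X → M) [IsVar M f] [IsVar M g] : D0 M (fun x => R (f x) (g x)) :=
  have : Proj M (fun x : X => ((), f x)) := Proj.mk' (fun _ => ()) f
  have : Proj M (fun x : X => (((), f x), g x)) := Proj.mk' (fun x => ((), f x)) g
  h.comp (fun x : X => (((), f x), g x))

theorem D0.comp₃ {R : M → M → M → Prop}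
    (h : D0 M (fun p : ((Unit × M) × M) × M => R p.1.1.2 p.1.2 p.2))
    (f g k : X → M) [IsVar M f] [IsVar M g] [IsVar M k] : D0 M (fun x => R (f x) (g x) (k x)) :=
  have : Proj M (fun x : X => ((), f x)) := Proj.mk' (fun _ => ()) f
  have : Proj M (fun x : X => (((), f x), g x)) := Proj.mk' (fun x => ((), f x)) g
  have : Proj M (fun x : X => ((((), f x), g x), k x)) := Proj.mk' (fun x => (((), f x), g x)) k
  h.comp (fun x : X => ((((), f x), g x), k x))

/-! Atomic formulas and connectives -/

instance D0.mem (f g : X → M) [hf : IsVar M f] [hg : IsVar M g] : D0 M (fun x => f x ∈ g x) := by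
  obtain ⟨s, hs⟩ := hf.out
  obtain ⟨t, ht⟩ := hg.out
  exact ⟨⟨.mem s t, trivial, fun x => by rw [Fml.eval, hs, ht]⟩⟩

instance D0.eq (f g : X → M) [hf : IsVar M f] [hg : IsVar M g] : D0 M (fun x => f x = g x) := by
  obtain ⟨s, hs⟩ := hf.out
  obtain ⟨t, ht⟩ := hg.out
  exact ⟨⟨.eq s t, ⟨trivial, trivial⟩, fun x => by rw [Fml.eval_eq, hs, ht]⟩⟩

instance D0.and (P Q : X → Prop) [hP : D0 M P] [hQ : D0 M Q] : D0 M (fun x => P x ∧ Q x) := by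
  obtain ⟨A, hA, hA'⟩ := hP.out
  obtain ⟨B, hB, hB'⟩ := hQ.out
  exact ⟨⟨.and A B, ⟨hA, hB⟩, fun x => by rw [Fml.eval, hA', hB']⟩⟩

instance D0.or (P Q : X → Prop) [hP : D0 M P] [hQ : D0 M Q] : D0 M (fun x => P x ∨ Q x) := by
  obtain ⟨A, hA, hA'⟩ := hP.out
  obtain ⟨B, hB, hB'⟩ := hQ.out
  exact ⟨⟨.or A B, ⟨hA, hB⟩, fun x => by rw [Fml.eval, hA', hB']⟩⟩

instance D0.not (P : X → Prop) [hP : D0 M P] : D0 M (fun x => ¬ P x) := by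
  obtain ⟨A, hA, hA'⟩ := hP.out
  exact ⟨⟨A.neg, hA.neg, fun x => by rw [Fml.eval_neg, hA']⟩⟩

instance D0.imp (P Q : X → Prop) [hP : D0 M P] [hQ : D0 M Q] : D0 M (fun x => P x → Q x) :=
  (inferInstance : D0 M (fun x => ¬ P x ∨ Q x)).congr fun x => by tauto

instance D0.iff (P Q : X → Prop) [hP : D0 M P] [hQ : D0 M Q] : D0 M (fun x => P x ↔ Q x) :=
  (inferInstance : D0 M (fun x => (P x → Q x) ∧ (Q x → P x))).congr fun x => by tauto

instance D0.ball (f : X → M) (P : X → M → Prop) [hf : IsVar M f]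
    [hP : D0 M (fun p : X × M => P p.1 p.2)] : D0 M (fun x => ∀ y, y ∈ f x → P x y) := by
  obtain ⟨t, ht⟩ := hf.out
  obtain ⟨A, hA, hA'⟩ := hP.out
  exact ⟨⟨.ball t A, hA, fun x => by
    rw [Fml.eval, ht]
    exact forall_congr' fun y => imp_congr Iff.rfl (hA' (x, y))⟩⟩

instance D0.bex (f : X → M) (P : X → M → Prop) [hf : IsVar M f]
    [hP : D0 M (fun p : X × M => P p.1 p.2)] : D0 M (fun x => ∃ y, y ∈ f x ∧ P x y) := by
  obtain ⟨t, ht⟩ := hf.out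
  obtain ⟨A, hA, hA'⟩ := hP.out
  exact ⟨⟨.bex t A, hA, fun x => by
    rw [Fml.eval, ht]
    exact exists_congr fun y => and_congr Iff.rfl (hA' (x, y))⟩⟩

instance Def.and (P Q : X → Prop) [hP : Def M P] [hQ : Def M Q] : Def M (fun x => P x ∧ Q x) := by
  obtain ⟨A, hA'⟩ := hP.out
  obtain ⟨B, hB'⟩ := hQ.out
  exact ⟨⟨.and A B, fun x => by rw [Fml.eval, hA', hB']⟩⟩

instance Def.or (P Q : X → Prop) [hP : Def M P] [hQ : Def M Q] : Def M (fun x => P x ∨ Q x) := by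
  obtain ⟨A, hA'⟩ := hP.out
  obtain ⟨B, hB'⟩ := hQ.out
  exact ⟨⟨.or A B, fun x => by rw [Fml.eval, hA', hB']⟩⟩

instance Def.not (P : X → Prop) [hP : Def M P] : Def M (fun x => ¬ P x) := by
  obtain ⟨A, hA'⟩ := hP.out
  exact ⟨⟨A.neg, fun x => by rw [Fml.eval_neg, hA']⟩⟩

instance Def.imp (P Q : X → Prop) [hP : Def M P] [hQ : Def M Q] : Def M (fun x => P x → Q x) :=
  (inferInstance : Def M (fun x => ¬ P x ∨ Q x)).congr fun x => by tauto

instance Def.all (P : X → M → Prop) [hP : Def M (fun p : X × M => P p.1 p.2)] :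
    Def M (fun x => ∀ y, P x y) := by
  obtain ⟨A, hA'⟩ := hP.out
  exact ⟨⟨.all A, fun x => by
    rw [Fml.eval]
    exact forall_congr' fun y => hA' (x, y)⟩⟩

instance Def.ex (P : X → M → Prop) [hP : Def M (fun p : X × M => P p.1 p.2)] :
    Def M (fun x => ∃ y, P x y) := by
  obtain ⟨A, hA'⟩ := hP.out
  exact ⟨⟨.ex A, fun x => by
    rw [Fml.eval]
    exact exists_congr fun y => hA' (x, y)⟩⟩

/-! Substitution of definable functions -/

instance (priority := low) IsVar.defFun (f : X → M) [h : IsVar M f] : DefFun M f := by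
  obtain ⟨t, ht⟩ := h.out
  have : IsVar M (fun p : X × M => f p.1) := by
    obtain ⟨σ, hσ⟩ := (inferInstance : Proj M (fun p : X × M => p.1)).out
    refine ⟨⟨t.subst σ, fun p => ?_⟩⟩
    rw [ht, Tm.eval_subst]
    exact congrFun (congrArg _ (funext fun i => hσ p i)) t
  exact ⟨(D0.eq (fun p : X × M => p.2) (fun p : X × M => f p.1)).def⟩

theorem DefFun.comp {f : Y → M} (hf : DefFun M f) (g : X → Y) [hg : Proj M g] :
    DefFun M (fun x => f (g x)) := by
  have : Proj M (fun p : X × M => g p.1) := by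
    obtain ⟨σ, hσ⟩ := (inferInstance : Proj M (fun p : X × M => p.1)).out
    obtain ⟨τ, hτ⟩ := hg.out
    refine ⟨⟨fun i => (τ i).subst σ, fun p i => ?_⟩⟩
    rw [hτ, Tm.eval_subst]
    exact congrFun (congrArg _ (funext fun i => hσ p i)) _
  have : Proj M (fun p : X × M => (g p.1, p.2)) := Proj.mk' (fun p : X × M => g p.1) (fun p => p.2)
  exact ⟨hf.out.comp (fun p : X × M => (g p.1, p.2))⟩

/-- The value of the function is introduced by an unbounded quantifier, which is why substitution of
definable functions is available for `Def` and not for `D0`. -/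
theorem Def.comp_fun {P : X × M → Prop} (hP : Def M P) (f : X → M) [hf : DefFun M f] :
    Def M (fun x => P (x, f x)) :=
  have := hf.out
  have : Def M (fun p : X × M => P (p.1, p.2)) := hP
  (inferInstance : Def M (fun x => ∃ y, y = f x ∧ P (x, y))).congr fun x => by simp

theorem Def.comp₁ {R : M → Prop} (h : Def M (fun p : Unit × M => R p.2)) (f : X → M) [DefFun M f] :
    Def M (fun x => R (f x)) := by
  have : Proj M (fun p : X × M => ((), p.2)) := Proj.mk' (fun _ => ()) (fun p : X × M => p.2)
  exact (h.comp (fun p : X × M => ((), p.2))).comp_fun f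

theorem Def.comp₂ {R : M → M → Prop} (h : Def M (fun p : (Unit × M) × M => R p.1.2 p.2))
    (f g : X → M) [hf : DefFun M f] [hg : DefFun M g] : Def M (fun x => R (f x) (g x)) := by
  have := hg.comp (fun p : X × M => p.1)
  have : Proj M (fun p : (X × M) × M => ((), p.1.2)) :=
    Proj.mk' (fun _ => ()) (fun p : (X × M) × M => p.1.2)
  have : Proj M (fun p : (X × M) × M => (((), p.1.2), p.2)) :=
    Proj.mk' (fun p : (X × M) × M => ((), p.1.2)) (fun p : (X × M) × M => p.2)
  exact ((h.comp (fun p : (X × M) × M => (((), p.1.2), p.2))).comp_fun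
    (fun p : X × M => g p.1)).comp_fun f

theorem Def.comp₃ {R : M → M → M → Prop}
    (h : Def M (fun p : ((Unit × M) × M) × M => R p.1.1.2 p.1.2 p.2))
    (f g k : X → M) [hf : DefFun M f] [hg : DefFun M g] [hk : DefFun M k] :
    Def M (fun x => R (f x) (g x) (k x)) := by
  have := hg.comp (fun p : X × M => p.1)
  have := hk.comp (fun p : (X × M) × M => p.1.1)
  have : Proj M (fun p : ((X × M) × M) × M => ((), p.1.1.2)) :=
    Proj.mk' (fun _ => ()) (fun p : ((X × M) × M) × M => p.1.1.2)
  have : Proj M (fun p : ((X × M) × M) × M => (((), p.1.1.2), p.1.2)) :=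
    Proj.mk' (fun p : ((X × M) × M) × M => ((), p.1.1.2)) (fun p : ((X × M) × M) × M => p.1.2)
  have : Proj M (fun p : ((X × M) × M) × M => ((((), p.1.1.2), p.1.2), p.2)) :=
    Proj.mk' (fun p : ((X × M) × M) × M => (((), p.1.1.2), p.1.2))
      (fun p : ((X × M) × M) × M => p.2)
  exact (((h.comp (fun p : ((X × M) × M) × M => ((((), p.1.1.2), p.1.2), p.2))).comp_fun
    (fun p : (X × M) × M => k p.1.1)).comp_fun (fun p : X × M => g p.1)).comp_fun f

theorem DefFun.comp₁ {F : M → M} (h : Def M (fun p : (Unit × M) × M => p.2 = F p.1.2))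
    (f : X → M) [hf : DefFun M f] : DefFun M (fun x => F (f x)) := by
  have := hf.comp (fun p : X × M => p.1)
  exact ⟨Def.comp₂ (R := fun a c => c = F a) h (fun p : X × M => f p.1) (fun p => p.2)⟩

theorem DefFun.comp₂ {F : M → M → M}
    (h : Def M (fun p : ((Unit × M) × M) × M => p.2 = F p.1.1.2 p.1.2))
    (f g : X → M) [hf : DefFun M f] [hg : DefFun M g] : DefFun M (fun x => F (f x) (g x)) := by
  have := hf.comp (fun p : X × M => p.1)
  have := hg.comp (fun p : X × M => p.1)
  exact ⟨Def.comp₃ (R := fun a b c => c = F a b) h (fun p : X × M => f p.1) (fun p => g p.1)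
    (fun p => p.2)⟩

instance Def.mem (f g : X → M) [hf : DefFun M f] [hg : DefFun M g] : Def M (fun x => f x ∈ g x) :=
  Def.comp₂ (R := fun a b => a ∈ b) (D0.mem _ _).def f g

instance Def.eq (f g : X → M) [hf : DefFun M f] [hg : DefFun M g] : Def M (fun x => f x = g x) :=
  Def.comp₂ (R := fun a b => a = b) (D0.eq _ _).def f g

/-! The axioms for definable predicates -/

theorem get_one {M : Type} (x : M) : (Ctx.get ((), x) : Fin _ → M) = fun _ : Fin 1 => x := by
  funext i
  fin_cases i
  rfl

theorem set_induction {P : M → Prop} [h : Def M (fun p : Unit × M => P p.2)]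
    (H : ∀ x, (∀ y ∈ x, P y) → P x) (x : M) : P x := by
  obtain ⟨A, hA⟩ := h.out
  have hA' : ∀ x, P x ↔ A.eval KPModel.ρ (fun _ : Fin 1 => x) := fun x => by
    rw [← get_one]
    exact hA ((), x)
  simp only [hA'] at H ⊢
  exact KPModel.ind A H x

theorem exists_sep (P : M → Prop) [h : D0 M (fun p : Unit × M => P p.2)] (a : M) :
    ∃ u : M, ∀ x, x ∈ u ↔ x ∈ a ∧ P x := by
  obtain ⟨A, h0, hA⟩ := h.out
  have hA' : ∀ x, P x ↔ A.eval KPModel.ρ (fun _ : Fin 1 => x) := fun x => by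
    rw [← get_one]
    exact hA ((), x)
  simp only [hA']
  exact KPModel.sep A h0 a

theorem exists_coll (R : M → M → Prop) [h : D0 M (fun p : (Unit × M) × M => R p.1.2 p.2)] (a : M)
    (H : ∀ x ∈ a, ∃ y, R x y) : ∃ u : M, ∀ x ∈ a, ∃ y ∈ u, R x y := by
  obtain ⟨A, h0, hA⟩ := h.out
  have hA' : ∀ x y, R x y ↔ A.eval KPModel.ρ ![x, y] := fun x y => by
    rw [hA (((), x), y)]
    refine iff_of_eq (congrArg _ (funext fun i => ?_))
    fin_cases i <;> rfl
  simp only [hA'] at H ⊢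
  exact KPModel.coll A h0 a H

end Instances

end KPSet

namespace KPSet

/-! ## Set theory in a model of `KP` -/

section SetTheory

variable {M : Type} [KPModel M] {X Y : Type} [Ctx M X] [Ctx M Y]

theorem notMem_self (x : M) : x ∉ x := by
  refine set_induction (P := fun x => x ∉ x) (fun x h hx => h x hx hx) x

theorem mem_asymm {x y : M} (h : x ∈ y) : y ∉ x := by
  refine set_induction (P := fun x : M => ∀ y : M, x ∈ y → y ∉ x) (fun x h y hxy hyx => ?_) x y h
  exact h y hyx x hyx hxy

theorem exists_empty : ∃ u : M, ∀ x : M, x ∉ u := by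
  obtain ⟨a, -⟩ := KPModel.inf (M := M)
  obtain ⟨u, hu⟩ := exists_sep (fun x : M => ¬ x = x) a
  exact ⟨u, fun x hx => ((hu x).1 hx).2 rfl⟩

theorem exists_upair (a b : M) : ∃ u : M, ∀ x, x ∈ u ↔ x = a ∨ x = b := by
  obtain ⟨w, ha, hb⟩ := KPModel.pair a b
  obtain ⟨u, hu⟩ := exists_sep (fun x : M => x = a ∨ x = b) w
  refine ⟨u, fun x => (hu x).trans ⟨fun h => h.2, fun h => ⟨?_, h⟩⟩⟩
  rcases h with rfl | rfl <;> assumption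

theorem exists_sUnion (a : M) : ∃ u : M, ∀ x, x ∈ u ↔ ∃ y ∈ a, x ∈ y := by
  obtain ⟨w, hw⟩ := KPModel.union a
  obtain ⟨u, hu⟩ := exists_sep (fun x : M => ∃ y ∈ a, x ∈ y) w
  exact ⟨u, fun x => (hu x).trans ⟨fun h => h.2, fun h => ⟨(let ⟨y, hy, hx⟩ := h; hw y hy x hx), h⟩⟩⟩

theorem exists_union (a b : M) : ∃ u : M, ∀ x, x ∈ u ↔ x ∈ a ∨ x ∈ b := by
  obtain ⟨p, hp⟩ := exists_upair a b
  obtain ⟨u, hu⟩ := exists_sUnion p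
  exact ⟨u, fun x => by simp [hu, hp]⟩

variable (M) in
noncomputable def emp : M := (exists_empty (M := M)).choose
noncomputable def upair (a b : M) : M := (exists_upair a b).choose
noncomputable def succ (a : M) : M := (exists_union a (upair a a)).choose
noncomputable def pr (a b : M) : M := upair (upair a a) (upair a b)

@[simp] theorem notMem_emp (x : M) : x ∉ emp M := (exists_empty (M := M)).choose_spec x
@[simp] theorem mem_upair {a b x : M} : x ∈ upair a b ↔ x = a ∨ x = b :=
  (exists_upair a b).choose_spec x
@[simp] theorem mem_succ {a x : M} : x ∈ succ a ↔ x ∈ a ∨ x = a :=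
  ((exists_union a (upair a a)).choose_spec x).trans (by simp)

theorem upair_inj {a b c d : M} (h : upair a b = upair c d) : (a = c ∧ b = d) ∨ (a = d ∧ b = c) := by
  have h1 : ∀ x, x = a ∨ x = b ↔ x = c ∨ x = d := fun x => by
    rw [← mem_upair, ← mem_upair, h]
  have ha := (h1 a).1 (.inl rfl)
  have hb := (h1 b).1 (.inr rfl)
  have hc := (h1 c).2 (.inl rfl)
  have hd := (h1 d).2 (.inr rfl)
  grind

@[simp] theorem pr_inj {a b c d : M} : pr a b = pr c d ↔ a = c ∧ b = d := by
  refine ⟨fun h => ?_, by rintro ⟨rfl, rfl⟩; rfl⟩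
  rcases upair_inj h with ⟨h1, h2⟩ | ⟨h1, h2⟩
  · have := upair_inj h1
    have := upair_inj h2
    grind
  · have := upair_inj h1
    have := upair_inj h2
    grind

variable (M) in
noncomputable def num : ℕ → M
  | 0 => emp M
  | k + 1 => succ (num k)

theorem num_mem {i j : ℕ} (h : i < j) : num M i ∈ num M j := by
  induction j, h using Nat.le_induction with
  | base => simp [num]
  | succ k _ ih => simp [num, ih]

@[simp] theorem num_inj {i j : ℕ} : num M i = num M j ↔ i = j := by
  refine ⟨fun h => ?_, fun h => h ▸ rfl⟩
  rcases lt_trichotomy i j with hl | hl | hl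
  · have := num_mem (M := M) hl
    rw [h] at this
    exact absurd this (notMem_self _)
  · exact hl
  · have := num_mem (M := M) hl
    rw [h] at this
    exact absurd this (notMem_self _)

noncomputable def code (k : ℕ) (x : M) : M := pr (num M k) x

@[simp] theorem code_inj {i j : ℕ} {x y : M} : code i x = code j y ↔ i = j ∧ x = y := by
  simp [code]

/-! ### Definability of the basic operations -/

instance D0.eq_upair (f g h : X → M) [IsVar M f] [IsVar M g] [IsVar M h] :
    D0 M (fun x => f x = upair (g x) (h x)) :=
  D0.comp₃ (R := fun a b c => a = upair b c)
    ((inferInstance : D0 M (fun p : ((Unit × M) × M) × M => p.1.2 ∈ p.1.1.2 ∧ p.2 ∈ p.1.1.2 ∧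
      ∀ z ∈ p.1.1.2, z = p.1.2 ∨ z = p.2)).congr fun p => ⟨fun h => by simp [h], fun h =>
        KPModel.ext fun z => by
          rw [mem_upair]
          refine ⟨h.2.2 z, ?_⟩
          rintro (rfl | rfl)
          exacts [h.1, h.2.1]⟩) f g h

/-- Both components of a pair lie in one of its elements. Hence quantifiers over components of a
pair are bounded, on which the Δ₀-definitions for pairs and codes rest. -/
theorem mem_mem_pr (a b : M) : ∃ u ∈ pr a b, a ∈ u ∧ b ∈ u := ⟨upair a b, by simp [pr], by simp⟩

instance D0.eq_pr (f g h : X → M) [IsVar M f] [IsVar M g] [IsVar M h] :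
    D0 M (fun x => f x = pr (g x) (h x)) :=
  D0.comp₃ (R := fun a b c => a = pr b c)
    ((inferInstance : D0 M (fun p : ((Unit × M) × M) × M => ∃ u ∈ p.1.1.2, ∃ w ∈ p.1.1.2,
      u = upair p.1.2 p.1.2 ∧ w = upair p.1.2 p.2 ∧ p.1.1.2 = upair u w)).congr
      fun p => ⟨fun h => ⟨_, by simp [h, pr], _, by simp [h, pr], rfl, rfl, h⟩, by
        rintro ⟨u, -, w, -, rfl, rfl, h⟩
        exact h⟩) f g h

instance D0.eq_code (k : ℕ) (f g : X → M) [IsVar M f] [IsVar M g] :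
    D0 M (fun x => f x = code k (g x)) :=
  D0.eq_pr f (fun _ => num M k) g

instance D0.pr_mem (f g h : X → M) [IsVar M f] [IsVar M g] [IsVar M h] :
    D0 M (fun x => pr (f x) (g x) ∈ h x) :=
  D0.comp₃ (R := fun a b c => pr a b ∈ c)
    ((inferInstance : D0 M (fun p : ((Unit × M) × M) × M => ∃ q ∈ p.2, q = pr p.1.1.2 p.1.2)).congr
      fun p => by simp) f g h

/-- Quantifiers over the components of the elements of a set of pairs are bounded. -/
instance D0.ex_pr (f : X → M) (P : X → M → M → Prop) [IsVar M f]
    [hP : D0 M (fun p : (X × M) × M => P p.1.1 p.1.2 p.2)] :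
    D0 M (fun x => ∃ y z, pr y z ∈ f x ∧ P x y z) := by
  have hσ : Proj M (fun p : ((((X × M) × M) × M) × M) => p.1.1.1.1) := inferInstance
  have h1 : Proj M (fun p : ((((X × M) × M) × M) × M) => (p.1.1.1.1, p.1.2)) := Proj.mk' _ _
  have h2 : Proj M (fun p : ((((X × M) × M) × M) × M) => ((p.1.1.1.1, p.1.2), p.2)) := Proj.mk' _ _
  have := hP.comp (fun p : ((((X × M) × M) × M) × M) => ((p.1.1.1.1, p.1.2), p.2))
  refine (inferInstance : D0 M (fun x => ∃ q ∈ f x, ∃ u ∈ q, ∃ y ∈ u, ∃ z ∈ u, q = pr y z ∧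
    P x y z)).congr fun x => ?_
  constructor
  · rintro ⟨y, z, h, hP⟩
    obtain ⟨u, hu, hy, hz⟩ := mem_mem_pr y z
    exact ⟨_, h, u, hu, y, hy, z, hz, rfl, hP⟩
  · rintro ⟨q, hq, u, hu, y, hy, z, hz, rfl, hP⟩
    exact ⟨y, z, hq, hP⟩

instance D0.all_pr (f : X → M) (P : X → M → M → Prop) [IsVar M f]
    [hP : D0 M (fun p : (X × M) × M => P p.1.1 p.1.2 p.2)] :
    D0 M (fun x => ∀ y z, pr y z ∈ f x → P x y z) :=
  (inferInstance : D0 M (fun x => ¬ ∃ y z, pr y z ∈ f x ∧ ¬ P x y z)).congr fun x => by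
    push Not
    rfl

instance D0.ex_pr_left (f g : X → M) (P : X → M → Prop) [IsVar M f]
    [IsVar M (fun p : (X × M) × M => g p.1.1)]
    [hP : D0 M (fun p : X × M => P p.1 p.2)] :
    D0 M (fun x => ∃ z, pr (g x) z ∈ f x ∧ P x z) := by
  have h2 : Proj M (fun p : (X × M) × M => (p.1.1, p.2)) := Proj.mk' _ _
  have := hP.comp (fun p : (X × M) × M => (p.1.1, p.2))
  refine (inferInstance : D0 M (fun x => ∃ y z, pr y z ∈ f x ∧ y = g x ∧ P x z)).congr fun x => ?_
  simp

instance D0.ex_pr_left' (f g : X → M) [IsVar M f] [IsVar M (fun p : (X × M) × M => g p.1.1)] :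
    D0 M (fun x => ∃ z, pr (g x) z ∈ f x) :=
  (inferInstance : D0 M (fun x => ∃ z, pr (g x) z ∈ f x ∧ z = z)).congr fun x => by simp

instance D0.all_pr_left (f g : X → M) (P : X → M → Prop) [IsVar M f]
    [IsVar M (fun p : (X × M) × M => g p.1.1)]
    [hP : D0 M (fun p : X × M => P p.1 p.2)] :
    D0 M (fun x => ∀ z, pr (g x) z ∈ f x → P x z) :=
  (inferInstance : D0 M (fun x => ¬ ∃ z, pr (g x) z ∈ f x ∧ ¬ P x z)).congr fun x => by
    push Not
    rfl

instance DefFun.pr (f g : X → M) [DefFun M f] [DefFun M g] : DefFun M (fun x => pr (f x) (g x)) :=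
  DefFun.comp₂ (D0.eq_pr _ _ _).def f g

instance DefFun.code (k : ℕ) (f : X → M) [DefFun M f] : DefFun M (fun x => code k (f x)) :=
  DefFun.comp₁ (D0.eq_code k _ _).def f

/-! ### Replacement -/

/-- Δ₀-collection bounds the values and Δ₀-separation selects them, so a Δ₀ graph is required. -/
theorem exists_image (F : M → M) [h : D0 M (fun p : (Unit × M) × M => p.2 = F p.1.2)] (a : M) :
    ∃ u : M, ∀ y, y ∈ u ↔ ∃ x ∈ a, y = F x := by
  obtain ⟨w, hw⟩ := exists_coll (fun x y => y = F x) a (fun x _ => ⟨_, rfl⟩)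
  have := fun (f g : (Unit × M) × M → M) [IsVar M f] [IsVar M g] =>
    D0.comp₂ (R := fun x y => y = F x) h f g
  obtain ⟨u, hu⟩ := exists_sep (fun y => ∃ x ∈ a, y = F x) w
  refine ⟨u, fun y => (hu y).trans ⟨fun h => h.2, fun h => ⟨?_, h⟩⟩⟩
  obtain ⟨x, hx, rfl⟩ := h
  obtain ⟨y, hy, rfl⟩ := hw x hx
  exact hy

/-- Collection is used twice: for fixed `x` it bounds the values `F x z`, and then it bounds these
bounds. -/
theorem exists_image₂ (F : M → M → M)
    [h : D0 M (fun p : ((Unit × M) × M) × M => p.2 = F p.1.1.2 p.1.2)] (a b : M) :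
    ∃ u : M, ∀ y, y ∈ u ↔ ∃ x ∈ a, ∃ z ∈ b, y = F x z := by
  have hD := fun {X : Type} [Ctx M X] (f g k : X → M) [IsVar M f] [IsVar M g] [IsVar M k] =>
    D0.comp₃ (R := fun x z y => y = F x z) h f g k
  have h1 : ∀ x ∈ a, ∃ w, ∀ z ∈ b, ∃ y ∈ w, y = F x z := fun x _ => by
    have : D0 M (fun p : (Unit × M) × M => p.2 = F x p.1.2) := hD _ _ _
    exact exists_coll (fun z y => y = F x z) b (fun z _ => ⟨_, rfl⟩)
  have : D0 M (fun p : (((Unit × M) × M) × M) × M => p.2 = F p.1.1.1.2 p.1.2) := hD _ _ _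
  obtain ⟨w, hw⟩ := exists_coll (fun x w => ∀ z ∈ b, ∃ y ∈ w, y = F x z) a h1
  obtain ⟨w', hw'⟩ := exists_sUnion w
  have : D0 M (fun p : ((Unit × M) × M) × M => p.1.1.2 = F p.1.2 p.2) := hD _ _ _
  obtain ⟨u, hu⟩ := exists_sep (fun y => ∃ x ∈ a, ∃ z ∈ b, y = F x z) w'
  refine ⟨u, fun y => (hu y).trans ⟨fun h => h.2, fun h => ⟨?_, h⟩⟩⟩
  obtain ⟨x, hx, z, hz, rfl⟩ := h
  obtain ⟨v, hv, h⟩ := hw x hx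
  obtain ⟨y, hy, rfl⟩ := h z hz
  exact (hw' _).2 ⟨v, hv, hy⟩

end SetTheory

end KPSet

namespace KPSet

section Recursion

variable {M : Type} [KPModel M] {X Y : Type} [Ctx M X] [Ctx M Y]

/-! ### Recursion along `∈` -/

/-- `f` is a set of pairs `⟨x, F x⟩` closed under the elements of `x`, where
`F x = ⋃ {H (F y) | y ∈ x}`. -/
def Attempt (H : M → M) (f : M) : Prop :=
  ∀ x v, pr x v ∈ f → (∀ y ∈ x, ∃ u, pr y u ∈ f) ∧
    (∀ w ∈ v, ∃ y ∈ x, ∃ u, pr y u ∈ f ∧ w ∈ H u) ∧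
    (∀ y ∈ x, ∀ u, pr y u ∈ f → ∀ w ∈ H u, w ∈ v)

/-- A function on the model for which `w ∈ H u` and `H u ⊆ v` are `Δ₀`. -/
class D0Fun (H : M → M) : Prop where
  mem : D0 M (fun p : (Unit × M) × M => p.1.2 ∈ H p.2)
  sub : D0 M (fun p : (Unit × M) × M => ∀ w ∈ H p.1.2, w ∈ p.2)

instance D0.mem_fun (H : M → M) [h : D0Fun H] (f g : X → M) [IsVar M f] [IsVar M g] :
    D0 M (fun x => f x ∈ H (g x)) := D0.comp₂ (R := fun a b => a ∈ H b) h.mem f g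

instance D0.fun_sub (H : M → M) [h : D0Fun H] (f g : X → M) [IsVar M f] [IsVar M g] :
    D0 M (fun x => ∀ w ∈ H (f x), w ∈ g x) :=
  D0.comp₂ (R := fun a b => ∀ w ∈ H a, w ∈ b) h.sub f g

instance D0.eq_fun (H : M → M) [h : D0Fun H] (f g : X → M) [IsVar M f] [IsVar M g] :
    D0 M (fun x => g x = H (f x)) :=
  D0.comp₂ (R := fun b a => b = H a)
    ((inferInstance : D0 M (fun p : (Unit × M) × M => (∀ w ∈ H p.2, w ∈ p.1.2) ∧
      ∀ w ∈ p.1.2, w ∈ H p.2)).congr fun p => ⟨fun h => by simp [h], fun h =>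
        KPModel.ext fun w => ⟨h.2 w, h.1 w⟩⟩) g f

instance D0.attempt (H : M → M) [h : D0Fun H] (f : X → M) [IsVar M f] :
    D0 M (fun x => Attempt H (f x)) := by
  refine D0.comp₁ (R := Attempt H) ?_ f
  unfold Attempt
  infer_instance

instance Def.attempt (H : M → M) [h : D0Fun H] (f : X → M) [DefFun M f] :
    Def M (fun x => Attempt H (f x)) :=
  Def.comp₁ (R := Attempt H) (D0.attempt H _).def f

/-- By `∈`-induction on `x`: the value at `x` is the union of the sets `H u` over the values `u` at
the elements of `x`, and these values agree by hypothesis. -/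
theorem Attempt.unique {H : M → M} [D0Fun H] (x : M) : ∀ f g v w : M, Attempt H f → Attempt H g →
    pr x v ∈ f → pr x w ∈ g → v = w := by
  have aux : ∀ {x f g v w : M}, Attempt H f → Attempt H g →
      (∀ y ∈ x, ∀ u u', pr y u ∈ f → pr y u' ∈ g → u = u') →
      pr x v ∈ f → pr x w ∈ g → ∀ z ∈ v, z ∈ w := by
    intro x f g v w hf hg h hv hw z hz
    obtain ⟨y, hy, u, hu, hzu⟩ := (hf x v hv).2.1 z hz
    obtain ⟨u', hu'⟩ := (hg x w hw).1 y hy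
    rw [h y hy u u' hu hu'] at hzu
    exact (hg x w hw).2.2 y hy u' hu' z hzu
  refine set_induction (P := fun x => ∀ f g v w : M, Attempt H f → Attempt H g →
    pr x v ∈ f → pr x w ∈ g → v = w) (fun x ih f g v w hf hg hv hw => KPModel.ext fun z => ?_) x
  exact ⟨aux hf hg (fun y hy u u' hu hu' => ih y hy f g u u' hf hg hu hu') hv hw z,
    aux hg hf (fun y hy u u' hu hu' => ih y hy g f u u' hg hf hu hu') hw hv z⟩

/-- By `∈`-induction: attempts for the elements of `x` are collected into a set, their union `g` is
again an attempt by uniqueness, and it is extended by the pair of `x` and its value. -/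
theorem exists_attempt (H : M → M) [D0Fun H] (x : M) : ∃ f v, Attempt H f ∧ pr x v ∈ f := by
  refine set_induction (P := fun x => ∃ f v : M, Attempt H f ∧ pr x v ∈ f) (fun x ih => ?_) x
  obtain ⟨Z, hZ⟩ := exists_coll (fun y f => Attempt H f ∧ ∃ v, pr y v ∈ f) x
    (fun y hy => let ⟨f, v, h, h'⟩ := ih y hy; ⟨f, h, v, h'⟩)
  -- The collecting set may contain other elements, so the attempts are separated from it before the
  -- union is formed.
  obtain ⟨Z', hZ'⟩ := exists_sep (fun f => Attempt H f) Z
  obtain ⟨g, hg⟩ := exists_sUnion Z'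
  have hg' : ∀ {y v}, pr y v ∈ g ↔ ∃ f ∈ Z, Attempt H f ∧ pr y v ∈ f := by
    intro y v
    simp [hg, hZ', and_assoc]
  have gatt : Attempt H g := by
    intro y v hv
    obtain ⟨f, hf, hfa, hfv⟩ := hg'.1 hv
    refine ⟨fun y' hy' => ?_, fun w hw => ?_, fun y' hy' u hu w hw => ?_⟩
    · obtain ⟨u, hu⟩ := (hfa y v hfv).1 y' hy'
      exact ⟨u, hg'.2 ⟨f, hf, hfa, hu⟩⟩
    · obtain ⟨y', hy', u, hu, h⟩ := (hfa y v hfv).2.1 w hw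
      exact ⟨y', hy', u, hg'.2 ⟨f, hf, hfa, hu⟩, h⟩
    · obtain ⟨f', hf', hfa', hu'⟩ := hg'.1 hu
      obtain ⟨u', hu''⟩ := (hfa y v hfv).1 y' hy'
      rw [Attempt.unique y' f' f u u' hfa' hfa hu' hu''] at hw
      exact (hfa y v hfv).2.2 y' hy' u' hu'' w hw
  have gdom : ∀ y ∈ x, ∃ u, pr y u ∈ g := fun y hy => by
    obtain ⟨f, hf, hfa, v, hv⟩ := hZ y hy
    exact ⟨v, hg'.2 ⟨f, hf, hfa, hv⟩⟩
  -- The sets `H u` are collected to have a set from which the value `v` at `x` can be separated.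
  obtain ⟨W, hW⟩ := exists_coll (fun y h => ∃ u, pr y u ∈ g ∧ h = H u) x
    (fun y hy => let ⟨u, hu⟩ := gdom y hy; ⟨H u, u, hu, rfl⟩)
  obtain ⟨W', hW'⟩ := exists_sUnion W
  obtain ⟨v, hv⟩ := exists_sep (fun w => ∃ y ∈ x, ∃ u, pr y u ∈ g ∧ w ∈ H u) W'
  have hv' : ∀ w, w ∈ v ↔ ∃ y ∈ x, ∃ u, pr y u ∈ g ∧ w ∈ H u := by
    intro w
    rw [hv]
    refine ⟨fun h => h.2, fun h => ⟨?_, h⟩⟩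
    obtain ⟨y, hy, u, hu, hw⟩ := h
    obtain ⟨_, hh, u', hu', rfl⟩ := hW y hy
    rw [Attempt.unique y g g u u' gatt gatt hu hu'] at hw
    exact (hW' w).2 ⟨_, hh, hw⟩
  obtain ⟨g', hg1⟩ := exists_union g (upair (pr x v) (pr x v))
  have hg2 : ∀ {y u}, pr y u ∈ g' ↔ pr y u ∈ g ∨ (y = x ∧ u = v) := by
    intro y u
    simp [hg1]
  -- The collected attempts may already be defined at `x`; their value there is then `v`, so adding
  -- the pair creates no conflict.
  have xg : ∀ w, pr x w ∈ g → w = v := by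
    intro w hw
    refine KPModel.ext fun z => ⟨fun hz => ?_, fun hz => ?_⟩
    · exact (hv' z).2 ((gatt x w hw).2.1 z hz)
    · obtain ⟨y, hy, u, hu, hz⟩ := (hv' z).1 hz
      exact (gatt x w hw).2.2 y hy u hu z hz
  refine ⟨g', v, fun y w hw => ?_, hg2.2 (.inr ⟨rfl, rfl⟩)⟩
  rcases hg2.1 hw with hw | ⟨rfl, rfl⟩
  · obtain ⟨h1, h2, h3⟩ := gatt y w hw
    refine ⟨fun y' hy' => (h1 y' hy').imp fun u hu => hg2.2 (.inl hu), fun z hz => ?_,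
      fun y' hy' u hu => ?_⟩
    · obtain ⟨y', hy', u, hu, hz⟩ := h2 z hz
      exact ⟨y', hy', u, hg2.2 (.inl hu), hz⟩
    · rcases hg2.1 hu with hu | ⟨rfl, rfl⟩
      · exact h3 y' hy' u hu
      · obtain ⟨u', hu'⟩ := h1 y' hy'
        rw [← xg u' hu']
        exact h3 y' hy' u' hu'
  · refine ⟨fun y' hy' => (gdom y' hy').imp fun u hu => hg2.2 (.inl hu), fun z hz => ?_,
      fun y' hy' u hu z hz => ?_⟩
    · obtain ⟨y', hy', u, hu, hz⟩ := (hv' z).1 hz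
      exact ⟨y', hy', u, hg2.2 (.inl hu), hz⟩
    · rcases hg2.1 hu with hu | ⟨rfl, rfl⟩
      · exact (hv' z).2 ⟨y', hy', u, hu, hz⟩
      · exact absurd hy' (notMem_self _)

/-- Recursion along `∈`: `F x = ⋃ {H (F y) | y ∈ x}`. -/
theorem exists_recursion (H : M → M) [D0Fun H] : ∃ F : M → M,
    Def M (fun p : (Unit × M) × M => p.2 = F p.1.2) ∧ ∀ x z, z ∈ F x ↔ ∃ y ∈ x, z ∈ H (F y) := by
  choose f F hf hF using exists_attempt H
  -- The graph of `F` says that some attempt contains the pair. This is an unbounded existential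
  -- statement, so `F` is only known to be definable.
  have key : ∀ x v, v = F x ↔ ∃ g, Attempt H g ∧ pr x v ∈ g := by
    refine fun x v => ⟨fun h => ⟨f x, hf x, h ▸ hF x⟩, fun ⟨g, hg, hv⟩ => ?_⟩
    exact Attempt.unique x g (f x) v (F x) hg (hf x) hv (hF x)
  refine ⟨F, (inferInstance : Def M (fun p : (Unit × M) × M => ∃ g : M, Attempt H g ∧
    pr p.1.2 p.2 ∈ g)).congr fun p => key _ _, fun x z => ⟨fun hz => ?_, fun ⟨y, hy, hz⟩ => ?_⟩⟩
  · obtain ⟨y, hy, u, hu, hz⟩ := (hf x x _ (hF x)).2.1 z hz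
    rw [(key y u).2 ⟨f x, hf x, hu⟩] at hz
    exact ⟨y, hy, hz⟩
  · obtain ⟨u, hu⟩ := (hf x x _ (hF x)).1 y hy
    rw [← (key y u).2 ⟨f x, hf x, hu⟩] at hz
    exact (hf x x _ (hF x)).2.2 y hy u hu z hz

/-! ### Ordinals -/

/-- Transitive sets of transitive sets. -/
def Ord (x : M) : Prop := ∀ y ∈ x, ∀ z ∈ y, z ∈ x ∧ ∀ w ∈ z, w ∈ y

instance D0.ord (f : X → M) [IsVar M f] : D0 M (fun x => Ord (f x)) := by
  refine D0.comp₁ (R := Ord) ?_ f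
  unfold Ord
  infer_instance

instance Def.ord (f : X → M) [DefFun M f] : Def M (fun x => Ord (f x)) :=
  Def.comp₁ (R := Ord) (D0.ord _).def f

theorem Ord.trans {x y z : M} (h : Ord x) (hy : y ∈ x) (hz : z ∈ y) : z ∈ x := (h y hy z hz).1

theorem Ord.mem {x y : M} (h : Ord x) (hy : y ∈ x) : Ord y := by
  intro z hz w hw
  exact ⟨(h y hy z hz).2 w hw, (h z (h.trans hy hz) w hw).2⟩

theorem Ord.trans_left {x y z w : M} (h : Ord x) (hy : y ∈ x) (hz : z ∈ y) (hw : w ∈ z) : w ∈ y :=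
  (h.mem hy).trans hz hw

theorem Ord.trichotomy (a : M) : Ord a → ∀ b, Ord b → a ∈ b ∨ a = b ∨ b ∈ a := by
  refine set_induction (P := fun a : M => Ord a → ∀ b, Ord b → a ∈ b ∨ a = b ∨ b ∈ a)
    (fun a iha ha b => ?_) a
  refine set_induction (P := fun b : M => Ord b → a ∈ b ∨ a = b ∨ b ∈ a) (fun b ihb hb => ?_) b
  by_contra! hc
  obtain ⟨h1, h2, h3⟩ := hc
  refine h2 (KPModel.ext fun c => ⟨fun hc => ?_, fun hc => ?_⟩)
  · rcases iha c hc (ha.mem hc) b hb with h | rfl | h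
    · exact h
    · exact absurd hc h3
    · exact absurd (ha.trans hc h) h3
  · rcases ihb c hc (hb.mem hc) with h | rfl | h
    · exact absurd (hb.trans hc h) h1
    · exact absurd hc h1
    · exact h

theorem ord_succ {a : M} (ha : Ord a) : Ord (succ a) := by
  intro y hy z hz
  rw [mem_succ] at hy
  rcases hy with hy | rfl
  · exact ⟨mem_succ.2 (.inl (ha.trans hy hz)), fun w => ha.trans_left hy hz⟩
  · exact ⟨mem_succ.2 (.inl hz), fun w => ha.trans hz⟩

instance : D0Fun (M := M) succ where
  mem := (inferInstance : D0 M (fun p : (Unit × M) × M => p.1.2 ∈ p.2 ∨ p.1.2 = p.2)).congr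
    fun p => by simp
  sub := (inferInstance : D0 M (fun p : (Unit × M) × M => (∀ w ∈ p.1.2, w ∈ p.2) ∧ p.1.2 ∈ p.2)).congr
    fun p => by
      simp only [mem_succ]
      exact ⟨fun h => ⟨fun w hw => h w (.inl hw), h _ (.inr rfl)⟩, fun h w hw =>
        hw.elim (h.1 w) (fun hw => hw ▸ h.2)⟩

variable (M) in
-- The recursion with `succ` produces the rank function. The set from the axiom of infinity has
-- above each of its elements another one, so its rank is a nonzero limit ordinal.
theorem exists_limit : ∃ l : M, (∃ m, m ∈ l) ∧ Ord l ∧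
    ∀ m ∈ l, ∀ n ∈ l, ∃ k ∈ l, m ∈ k ∧ n ∈ k := by
  obtain ⟨F, hF, h⟩ := exists_recursion (M := M) succ
  simp only [mem_succ] at h
  have hFd : ∀ {X : Type} [Ctx M X] (f : X → M) [DefFun M f], DefFun M (fun x => F (f x)) :=
    fun f => DefFun.comp₁ hF f
  have hord : ∀ x, Ord (F x) := by
    refine set_induction (P := fun x => Ord (F x)) (fun x ih => ?_)
    intro y hy z hz
    obtain ⟨u, hu, hy⟩ := (h x y).1 hy
    have hz' : z ∈ F u := by
      rcases hy with hy | rfl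
      · exact (ih u hu).trans hy hz
      · exact hz
    refine ⟨(h x z).2 ⟨u, hu, .inl hz'⟩, fun w hw => ?_⟩
    rcases hy with hy | rfl
    · exact (ih u hu).trans_left hy hz hw
    · exact (ih u hu).trans hz hw
  obtain ⟨x, ⟨y, hy⟩, hx⟩ := KPModel.inf (M := M)
  have key : ∀ m ∈ F x, ∀ n ∈ F x, ∃ y ∈ x, (m ∈ F y ∨ m = F y) ∧ (n ∈ F y ∨ n = F y) := by
    intro m hm n hn
    obtain ⟨u, hu, hm⟩ := (h x m).1 hm
    obtain ⟨v, hv, hn⟩ := (h x n).1 hn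
    rcases Ord.trichotomy _ (hord u) _ (hord v) with huv | huv | huv
    · refine ⟨v, hv, .inl ?_, hn⟩
      rcases hm with hm | rfl
      · exact (hord v).trans huv hm
      · exact huv
    · exact ⟨v, hv, huv ▸ hm, hn⟩
    · refine ⟨u, hu, hm, .inl ?_⟩
      rcases hn with hn | rfl
      · exact (hord u).trans huv hn
      · exact huv
  refine ⟨F x, ⟨F y, (h x _).2 ⟨y, hy, .inr rfl⟩⟩, hord x, ?_⟩
  intro m hm n hn
  obtain ⟨y, hy, hm, hn⟩ := key m hm n hn
  obtain ⟨z, hz, hyz⟩ := hx y hy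
  have e : ∀ {m}, m ∈ F y ∨ m = F y → m ∈ F z := fun hm => (h z _).2 ⟨y, hyz, hm⟩
  exact ⟨F z, (h x _).2 ⟨z, hz, .inr rfl⟩, e hm, e hn⟩

/-! ### Fixed points -/

/-- A monotone operator for which membership of an element in a value depends on at most two elements
of the argument has a fixed point. -/
theorem exists_fixedPoint (H : M → M) [D0Fun H]
    (mono : ∀ u v x : M, (∀ z ∈ u, z ∈ v) → x ∈ H u → x ∈ H v)
    (fin : ∀ u x : M, x ∈ H u → (∀ v, x ∈ H v) ∨ ∃ p ∈ u, ∃ q ∈ u, ∀ v, p ∈ v → q ∈ v → x ∈ H v) :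
    ∃ u : M, ∀ x, x ∈ u ↔ x ∈ H u := by
  obtain ⟨F, -, hF⟩ := exists_recursion H
  obtain ⟨l, ⟨m, hm⟩, hord, hl⟩ := exists_limit M
  -- The operator is iterated up to a limit `l`. Elements `p` and `q` that appear by the stages `i`
  -- and `j` are both present at any stage `k` above `i` and `j`, so whatever depends on them alone
  -- enters the union before `l`.
  refine ⟨F l, fun x => ⟨fun hx => ?_, fun hx => ?_⟩⟩
  · obtain ⟨n, hn, hx⟩ := (hF l x).1 hx
    refine mono _ _ x (fun z hz => ?_) hx
    obtain ⟨k, hk, hz⟩ := (hF n z).1 hz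
    exact (hF l z).2 ⟨k, hord.trans hn hk, hz⟩
  · rcases fin _ _ hx with h | ⟨p, hp, q, hq, h⟩
    · exact (hF l x).2 ⟨m, hm, h _⟩
    · obtain ⟨i, hi, hp⟩ := (hF l p).1 hp
      obtain ⟨j, hj, hq⟩ := (hF l q).1 hq
      obtain ⟨k, hk, hik, hjk⟩ := hl i hi j hj
      exact (hF l x).2 ⟨k, hk, h _ ((hF k p).2 ⟨i, hik, hp⟩) ((hF k q).2 ⟨j, hjk, hq⟩)⟩

/-- Cutting the predicate down to `A` makes its extension a set by Δ₀-separation, so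
`exists_fixedPoint` applies to the operator `u ↦ {x ∈ A | Φ u x}`. -/
theorem exists_fixedPoint_sep (A : M) (Φ : M → M → Prop)
    [hD : D0 M (fun p : (Unit × M) × M => Φ p.1.2 p.2)]
    (mono : ∀ u v x : M, (∀ z ∈ u, z ∈ v) → Φ u x → Φ v x)
    (fin : ∀ u x : M, x ∈ A → Φ u x →
      (∀ v, Φ v x) ∨ ∃ p ∈ u, ∃ q ∈ u, ∀ v, p ∈ v → q ∈ v → Φ v x) :
    ∃ u : M, (∀ x ∈ u, x ∈ A) ∧ ∀ x ∈ A, x ∈ u ↔ Φ u x := by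
  have hD' := fun {X : Type} [Ctx M X] (f g : X → M) [IsVar M f] [IsVar M g] =>
    D0.comp₂ (R := Φ) hD f g
  have : ∀ u, D0 M (fun p : Unit × M => Φ u p.2) := fun u => hD' _ _
  choose H hH using fun u => exists_sep (fun x => Φ u x) A
  have h1 : D0 M (fun p : (Unit × M) × M => Φ p.2 p.1.2) := hD' _ _
  have h2 : D0 M (fun p : ((Unit × M) × M) × M => Φ p.1.1.2 p.2) := hD' _ _
  have : D0Fun H := by
    constructor
    · simp only [hH]
      infer_instance
    · simp only [hH, and_imp]
      infer_instance
  obtain ⟨u, hu⟩ := exists_fixedPoint H (fun u v x h hx => by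
    rw [hH] at hx ⊢
    exact ⟨hx.1, mono u v x h hx.2⟩) (fun u x hx => by
    simp only [hH] at hx ⊢
    rcases fin u x hx.1 hx.2 with h | ⟨p, hp, q, hq, h⟩
    · exact .inl fun v => ⟨hx.1, h v⟩
    · exact .inr ⟨p, hp, q, hq, fun v hp hq => ⟨hx.1, h v hp hq⟩⟩)
  refine ⟨u, fun x hx => ((hH u x).1 ((hu x).1 hx)).1, fun x hx => ?_⟩
  rw [hu, hH]
  exact and_iff_right hx

end Recursion

end KPSet

namespace KPSet

section Terms

variable {M : Type} [KPModel M] {X Y : Type} [Ctx M X] [Ctx M Y]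

/-! ## The notation system inside a model -/

variable (M) in
noncomputable def tZero : M := code 0 (emp M)
variable (M) in
noncomputable def tOmega : M := code 1 (emp M)
noncomputable def tGamma (x : M) : M := code 2 x
noncomputable def tPlus (a b : M) : M := code 3 (pr a b)
noncomputable def tPhi (a b : M) : M := code 4 (pr a b)
noncomputable def tPsi (a : M) : M := code 5 a

def Tag (k : ℕ) (s : M) : Prop := ∃ x, s = code k x
def SC (s : M) : Prop := Tag 1 s ∨ Tag 2 s ∨ Tag 5 s
def AP (s : M) : Prop := SC s ∨ Tag 4 s

/-- `⟨a, b⟩ ∈ L` or `a = b`. -/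
def Le (L a b : M) : Prop := pr a b ∈ L ∨ a = b

/-- This and the neighbouring predicates copy the object-language formulas clause by clause, in the
same order; the evaluation lemmas below end with `rfl` for this reason. -/
def LtC (S L a b : M) : Prop :=
  (Tag 0 a ∧ ¬ Tag 0 b) ∨ (Tag 2 a ∧ Tag 1 b) ∨ (Tag 2 a ∧ Tag 5 b) ∨ (Tag 5 a ∧ Tag 1 b) ∨
  (∃ u ∈ a, ∃ x ∈ u, a = tGamma x ∧ ∃ w ∈ b, ∃ y ∈ w, b = tGamma y ∧ x ∈ y) ∨
  (∃ c ∈ S, ∃ d ∈ S, a = tPlus c d ∧ AP b ∧ pr c b ∈ L) ∨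
  (∃ c ∈ S, ∃ d ∈ S, b = tPlus c d ∧ AP a ∧ Le L a c) ∨
  (∃ c ∈ S, ∃ d ∈ S, a = tPlus c d ∧ ∃ e ∈ S, ∃ f ∈ S, b = tPlus e f ∧
    (pr c e ∈ L ∨ (c = e ∧ pr d f ∈ L))) ∨
  (∃ c ∈ S, ∃ d ∈ S, a = tPhi c d ∧ SC b ∧ pr c b ∈ L ∧ pr d b ∈ L) ∨
  (∃ c ∈ S, ∃ d ∈ S, b = tPhi c d ∧ SC a ∧ (Le L a c ∨ Le L a d)) ∨
  (∃ c ∈ S, ∃ d ∈ S, a = tPhi c d ∧ ∃ e ∈ S, ∃ f ∈ S, b = tPhi e f ∧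
    ((pr c e ∈ L ∧ pr d b ∈ L) ∨ (c = e ∧ pr d f ∈ L) ∨ (pr e c ∈ L ∧ pr a f ∈ L))) ∨
  (∃ c ∈ S, a = tPsi c ∧ ∃ d ∈ S, b = tPsi d ∧ pr c d ∈ L)

def KC (S K x a : M) : Prop :=
  (∃ c ∈ S, ∃ d ∈ S, (a = tPlus c d ∨ a = tPhi c d) ∧ (pr x c ∈ K ∨ pr x d ∈ K)) ∨
  (∃ c ∈ S, a = tPsi c ∧ (x = c ∨ pr x c ∈ K))

def PlusNF (S L a b : M) : Prop :=
  AP a ∧ ((AP b ∧ Le L b a) ∨ ∃ c ∈ S, ∃ d ∈ S, b = tPlus c d ∧ Le L c a)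

def PhiNF (S L a b : M) : Prop :=
  ∃ o ∈ S, o = tOmega M ∧ ((pr a o ∈ L ∧ pr b o ∈ L ∧
    ((Tag 0 b ∧ ¬ SC a) ∨ (SC b ∧ Le L b a) ∨ Tag 3 b ∨
      ∃ c ∈ S, ∃ d ∈ S, b = tPhi c d ∧ Le L c a)) ∨ (Tag 0 a ∧ pr o b ∈ L))

def PsiNF (S L K a : M) : Prop := ∀ x ∈ S, pr x a ∈ K → pr x a ∈ L

def Generated (θ S L K s : M) : Prop :=
  s = tZero M ∨ s = tOmega M ∨ (∃ x ∈ θ, s = tGamma x) ∨ s = tGamma θ ∨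
  (∃ a ∈ S, ∃ b ∈ S, (PlusNF S L a b ∧ s = tPlus a b) ∨ (PhiNF S L a b ∧ s = tPhi a b)) ∨
  (∃ a ∈ S, PsiNF S L K a ∧ s = tPsi a)

def Closed (θ S L K : M) : Prop :=
  (∃ s ∈ S, s = tZero M) ∧ (∃ s ∈ S, s = tOmega M) ∧ (∀ x ∈ θ, ∃ s ∈ S, s = tGamma x) ∧
  (∃ s ∈ S, s = tGamma θ) ∧
  (∀ a ∈ S, ∀ b ∈ S, (PlusNF S L a b → ∃ s ∈ S, s = tPlus a b) ∧
    (PhiNF S L a b → ∃ s ∈ S, s = tPhi a b)) ∧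
  (∀ a ∈ S, PsiNF S L K a → ∃ s ∈ S, s = tPsi a)

/-- `S` is `T(θ)`, with order `L` and `K` the relation `x ∈ Ka`. -/
def Sys (θ S L K : M) : Prop :=
  (∀ s ∈ S, Generated θ S L K s) ∧ Closed θ S L K ∧
  (∀ a ∈ S, ∀ b ∈ S, pr a b ∈ L ↔ LtC S L a b) ∧ (∀ a ∈ S, ∀ b ∈ S, pr a b ∈ K ↔ KC S K a b)

/-- `f` is an order preserving function from the ordinal `α` to `S`. -/
def OrderEmb (S L α f : M) : Prop :=
  Ord α ∧ (∀ p ∈ f, ∃ x ∈ α, ∃ y ∈ S, p = pr x y) ∧ (∀ x ∈ α, ∃ y ∈ S, pr x y ∈ f) ∧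
  (∀ x ∈ α, ∀ y ∈ S, ∀ z ∈ S, pr x y ∈ f ∧ pr x z ∈ f → y = z) ∧
  (∀ x ∈ α, ∀ y ∈ α, ∀ z ∈ S, ∀ w ∈ S, x ∈ y ∧ pr x z ∈ f ∧ pr y w ∈ f → pr z w ∈ L)

def InitSegLe (S L p : M) : Prop :=
  ∃ α f : M, OrderEmb S L α f ∧ ∀ b ∈ S, (∃ x ∈ α, pr x b ∈ f) ↔ Le L b p

def InitSegLt (S L p : M) : Prop :=
  ∃ α f : M, OrderEmb S L α f ∧ ∀ b ∈ S, (∃ x ∈ α, pr x b ∈ f) ↔ pr b p ∈ L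

def Acc (S L p : M) : Prop := p ∈ S ∧ (∃ o ∈ S, o = tOmega M ∧ pr p o ∈ L) ∧ InitSegLe S L p

/-! ### The meaning of the formulas -/

section Eval

variable {ρ : ℕ → M} {n : ℕ} (e : Fin n → M)

theorem eval_isOrd (x : Tm n) : (isOrd x).eval ρ e ↔ Ord (x.eval ρ e) := by
  rw [isOrd, Fml.eval_subst]; simp only [Fml.eval]; rfl

theorem eval_isUPair (u a b : Tm n) :
    (isUPair u a b).eval ρ e ↔ u.eval ρ e = upair (a.eval ρ e) (b.eval ρ e) := by
  rw [isUPair, Fml.eval_subst]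
  simp only [Fml.eval, Fml.eval_eq]
  constructor
  · intro h
    refine KPModel.ext fun z => ?_
    rw [mem_upair]
    refine ⟨h.2.2 z, ?_⟩
    rintro (rfl | rfl)
    exacts [h.1, h.2.1]
  · intro h
    change a.eval ρ e ∈ u.eval ρ e ∧ b.eval ρ e ∈ u.eval ρ e ∧
      ∀ z ∈ u.eval ρ e, z = a.eval ρ e ∨ z = b.eval ρ e
    rw [h]
    simp

theorem eval_isPair (p a b : Tm n) :
    (isPair p a b).eval ρ e ↔ p.eval ρ e = pr (a.eval ρ e) (b.eval ρ e) := by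
  rw [isPair, Fml.eval_subst]
  simp only [Fml.eval, eval_isUPair]
  constructor
  · rintro ⟨u, -, w, -, hu, hw, h⟩
    change u = upair (a.eval ρ e) (a.eval ρ e) at hu
    change w = upair (a.eval ρ e) (b.eval ρ e) at hw
    subst hu hw
    exact h
  · intro h
    refine ⟨upair (a.eval ρ e) (a.eval ρ e), ?_, upair (a.eval ρ e) (b.eval ρ e), ?_, rfl, rfl, h⟩
    · change _ ∈ p.eval ρ e
      rw [h]
      exact mem_upair.2 (.inl rfl)
    · change _ ∈ p.eval ρ e
      rw [h]
      exact mem_upair.2 (.inr rfl)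

theorem eval_rel (r a b : Tm n) :
    (rel r a b).eval ρ e ↔ pr (a.eval ρ e) (b.eval ρ e) ∈ r.eval ρ e := by
  rw [rel, Fml.eval_subst]
  simp only [Fml.eval, eval_isPair]
  constructor
  · rintro ⟨q, hq, h⟩
    change q = pr (a.eval ρ e) (b.eval ρ e) at h
    subst h
    exact hq
  · exact fun h => ⟨_, h, rfl⟩

theorem eval_relEq (r a b : Tm n) :
    (relEq r a b).eval ρ e ↔ Le (r.eval ρ e) (a.eval ρ e) (b.eval ρ e) := by
  rw [relEq]
  simp only [Fml.eval, eval_rel, Fml.eval_eq]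
  rfl

theorem eval_isNum (k : ℕ) : ∀ {n : ℕ} (e : Fin n → M) (x : Tm n),
    (isNum k x).eval ρ e ↔ x.eval ρ e = num M k := by
  induction k with
  | zero =>
    intro n e x
    rw [isNum, Fml.eval_subst]
    simp only [Fml.eval]
    constructor
    · exact fun h => KPModel.ext fun z => ⟨fun hz => absurd hz (h z hz), fun hz =>
        absurd hz (notMem_emp z)⟩
    · intro h z hz
      change z ∈ x.eval ρ e at hz
      rw [h] at hz
      exact absurd hz (notMem_emp z)
  | succ k ih =>
    intro n e x
    rw [isNum, Fml.eval_subst]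
    simp only [Fml.eval, ih, Fml.eval_eq]
    constructor
    · rintro ⟨z, hz, hzk, h1, h2⟩
      change z = num M k at hzk
      subst hzk
      refine KPModel.ext fun w => ?_
      rw [num, mem_succ]
      refine ⟨h1 w, ?_⟩
      rintro (h | rfl)
      exacts [h2 w h, hz]
    · intro h
      change ∃ z ∈ x.eval ρ e, z = num M k ∧ (∀ w ∈ x.eval ρ e, w ∈ z ∨ w = z) ∧
        ∀ w ∈ z, w ∈ x.eval ρ e
      rw [h, num]
      refine ⟨_, by simp, rfl, fun w hw => by simpa using hw, fun w hw => by simp [hw]⟩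

theorem eval_isCode (k : ℕ) (s x : Tm n) :
    (isCode k s x).eval ρ e ↔ s.eval ρ e = code k (x.eval ρ e) := by
  rw [isCode, Fml.eval_subst]
  simp only [Fml.eval, eval_isNum, eval_isPair]
  constructor
  · rintro ⟨u, -, w, -, hw, h⟩
    change w = num M k at hw
    subst hw
    exact h
  · intro h
    obtain ⟨u, hu, hk, -⟩ := mem_mem_pr (num M k) (x.eval ρ e)
    refine ⟨u, ?_, num M k, hk, rfl, h⟩
    change u ∈ s.eval ρ e
    rw [h]
    exact hu

theorem mem_mem_code (k : ℕ) (x : M) : ∃ u ∈ code k x, x ∈ u :=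
  let ⟨u, hu, _, hx⟩ := mem_mem_pr (num M k) x
  ⟨u, hu, hx⟩

theorem eval_hasTag (k : ℕ) (s : Tm n) : (hasTag k s).eval ρ e ↔ Tag k (s.eval ρ e) := by
  rw [hasTag, Fml.eval_subst]
  simp only [Fml.eval, eval_isCode]
  constructor
  · rintro ⟨u, -, x, -, h⟩
    exact ⟨x, h⟩
  · rintro ⟨x, h⟩
    obtain ⟨u, hu, hx⟩ := mem_mem_code k x
    refine ⟨u, ?_, x, hx, h⟩
    change u ∈ s.eval ρ e
    rwa [h]

theorem eval_isConst (k : ℕ) (s : Tm n) :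
    (isConst k s).eval ρ e ↔ s.eval ρ e = code k (emp M) := by
  rw [isConst, Fml.eval_subst]
  simp only [Fml.eval, eval_isCode, eval_isNum]
  constructor
  · rintro ⟨u, -, x, -, hx, h⟩
    change x = emp M at hx
    subst hx
    exact h
  · intro h
    obtain ⟨u, hu, hx⟩ := mem_mem_code k (emp M)
    refine ⟨u, ?_, emp M, hx, rfl, h⟩
    change u ∈ s.eval ρ e
    rwa [h]

theorem eval_isBin (k : ℕ) (s a b : Tm n) :
    (isBin k s a b).eval ρ e ↔ s.eval ρ e = code k (pr (a.eval ρ e) (b.eval ρ e)) := by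
  rw [isBin, Fml.eval_subst]
  simp only [Fml.eval, eval_isCode, eval_isPair]
  constructor
  · rintro ⟨u, -, x, -, hx, h⟩
    change x = pr (a.eval ρ e) (b.eval ρ e) at hx
    subst hx
    exact h
  · intro h
    obtain ⟨u, hu, hx⟩ := mem_mem_code k (pr (a.eval ρ e) (b.eval ρ e))
    refine ⟨u, ?_, _, hx, rfl, h⟩
    change u ∈ s.eval ρ e
    rwa [h]

theorem eval_isZero (s : Tm n) : (isZero s).eval ρ e ↔ s.eval ρ e = tZero M := eval_isConst e 0 s
theorem eval_isOmega (s : Tm n) : (isOmega s).eval ρ e ↔ s.eval ρ e = tOmega M := eval_isConst e 1 s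
theorem eval_isGamma (s x : Tm n) :
    (isGamma s x).eval ρ e ↔ s.eval ρ e = tGamma (x.eval ρ e) := eval_isCode e 2 s x
theorem eval_isPlus (s a b : Tm n) :
    (isPlus s a b).eval ρ e ↔ s.eval ρ e = tPlus (a.eval ρ e) (b.eval ρ e) := eval_isBin e 3 s a b
theorem eval_isPhi (s a b : Tm n) :
    (isPhi s a b).eval ρ e ↔ s.eval ρ e = tPhi (a.eval ρ e) (b.eval ρ e) := eval_isBin e 4 s a b
theorem eval_isPsi (s a : Tm n) :
    (isPsi s a).eval ρ e ↔ s.eval ρ e = tPsi (a.eval ρ e) := eval_isCode e 5 s a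

theorem eval_strCrit (s : Tm n) : (strCrit s).eval ρ e ↔ SC (s.eval ρ e) := by
  simp only [strCrit, Fml.eval, eval_hasTag, SC]

theorem eval_addPrin (s : Tm n) : (addPrin s).eval ρ e ↔ AP (s.eval ρ e) := by
  simp only [addPrin, Fml.eval, eval_hasTag, eval_strCrit, AP]

theorem eval_ltClause (S L a b : Tm n) : (ltClause S L a b).eval ρ e ↔
    LtC (S.eval ρ e) (L.eval ρ e) (a.eval ρ e) (b.eval ρ e) := by
  rw [ltClause, Fml.eval_subst]
  simp only [Fml.eval, Fml.eval_neg, eval_hasTag, eval_isGamma, eval_isPlus, eval_isPhi, eval_isPsi,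
    eval_strCrit, eval_addPrin, eval_rel, eval_relEq, Fml.eval_eq]
  rfl

theorem eval_kClause (S K x a : Tm n) : (kClause S K x a).eval ρ e ↔
    KC (S.eval ρ e) (K.eval ρ e) (x.eval ρ e) (a.eval ρ e) := by
  rw [kClause, Fml.eval_subst]
  simp only [Fml.eval, eval_isPlus, eval_isPhi, eval_isPsi, eval_rel, Fml.eval_eq]
  rfl

theorem eval_plusNF (S L a b : Tm n) : (plusNF S L a b).eval ρ e ↔
    PlusNF (S.eval ρ e) (L.eval ρ e) (a.eval ρ e) (b.eval ρ e) := by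
  rw [plusNF, Fml.eval_subst]
  simp only [Fml.eval, eval_isPlus, eval_addPrin, eval_relEq]
  rfl

theorem eval_phiNF (S L a b : Tm n) : (phiNF S L a b).eval ρ e ↔
    PhiNF (S.eval ρ e) (L.eval ρ e) (a.eval ρ e) (b.eval ρ e) := by
  rw [phiNF, Fml.eval_subst]
  simp only [Fml.eval, Fml.eval_neg, eval_isOmega, eval_isPhi, eval_strCrit, eval_hasTag, eval_rel,
    eval_relEq]
  rfl

theorem eval_psiNF (S L K a : Tm n) : (psiNF S L K a).eval ρ e ↔
    PsiNF (S.eval ρ e) (L.eval ρ e) (K.eval ρ e) (a.eval ρ e) := by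
  rw [psiNF, Fml.eval_subst]
  simp only [Fml.eval, Fml.eval_imp, eval_rel]
  rfl

theorem eval_isSystem (θ S L K : Tm n) : (isSystem θ S L K).eval ρ e ↔
    Sys (θ.eval ρ e) (S.eval ρ e) (L.eval ρ e) (K.eval ρ e) := by
  rw [isSystem, Fml.eval_subst]
  simp only [Fml.eval, Fml.eval_iff, generated, closed, Fml.eval_subst, Fml.eval_imp, eval_isZero,
    eval_isOmega, eval_isGamma, eval_isPlus, eval_isPhi, eval_isPsi, eval_rel, eval_plusNF,
    eval_phiNF, eval_psiNF, eval_ltClause, eval_kClause]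
  rfl

theorem eval_initSegLe (S L p : Tm n) : (initSegLe S L p).eval ρ e ↔
    InitSegLe (S.eval ρ e) (L.eval ρ e) (p.eval ρ e) := by
  rw [initSegLe, Fml.eval_subst]
  simp only [Fml.eval, Fml.eval_iff, Fml.eval_imp, isOrderEmb, Fml.eval_subst, eval_isOrd, eval_rel,
    eval_relEq, eval_isPair, Fml.eval_eq]
  rfl

theorem eval_initSegLt (S L p : Tm n) : (initSegLt S L p).eval ρ e ↔
    InitSegLt (S.eval ρ e) (L.eval ρ e) (p.eval ρ e) := by
  rw [initSegLt, Fml.eval_subst]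
  simp only [Fml.eval, Fml.eval_iff, Fml.eval_imp, isOrderEmb, Fml.eval_subst, eval_isOrd, eval_rel,
    eval_isPair, Fml.eval_eq]
  rfl

theorem eval_isAcc (S L p : Tm n) : (isAcc S L p).eval ρ e ↔
    Acc (S.eval ρ e) (L.eval ρ e) (p.eval ρ e) := by
  rw [isAcc, Fml.eval_subst]
  simp only [Fml.eval, eval_initSegLe, eval_isOmega, eval_rel]
  rfl

end Eval

/-! ### The terms `e_k` and the formulas describing them. -/

variable (M) in
/-- The term `e_k`. -/
noncomputable def tE : ℕ → M
  | 0 => tPlus (tOmega M) (tPhi (tZero M) (tZero M))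
  | k + 1 => tPhi (tZero M) (tE k)

/-- One direction suffices, because the formula is only asserted of an explicit witness. The
hypotheses provide the subterms over which its quantifiers range. -/
theorem eval_isE {ρ : ℕ → M} {k : ℕ} : ∀ {n : ℕ} (e : Fin n → M) (S s : Tm n),
    tZero M ∈ S.eval ρ e → tOmega M ∈ S.eval ρ e → tPhi (tZero M) (tZero M) ∈ S.eval ρ e →
    (∀ j < k, tE M j ∈ S.eval ρ e) → s.eval ρ e = tE M k → (isE k S s).eval ρ e := by
  induction k with
  | zero =>
    intro n e S s h0 h1 h2 _ hs
    rw [isE, Fml.eval_subst]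
    simp only [Fml.eval, eval_isZero, eval_isOmega, eval_isPhi, eval_isPlus]
    exact ⟨_, h0, _, h1, _, h2, rfl, rfl, rfl, hs⟩
  | succ k ih =>
    intro n e S s h0 h1 h2 h3 hs
    rw [isE, Fml.eval_subst]
    simp only [Fml.eval, eval_isZero, eval_isPhi]
    refine ⟨_, h0, tE M k, h3 k k.lt_succ_self, rfl, ?_, hs⟩
    exact ih _ _ _ h0 h1 h2 (fun j hj => h3 j (hj.trans k.lt_succ_self)) rfl

theorem eval_isPsiE {ρ : ℕ → M} {k n : ℕ} (e : Fin n → M) (S s : Tm n)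
    (h0 : tZero M ∈ S.eval ρ e) (h1 : tOmega M ∈ S.eval ρ e)
    (h2 : tPhi (tZero M) (tZero M) ∈ S.eval ρ e) (h3 : ∀ j, tE M j ∈ S.eval ρ e)
    (h4 : tPsi (tE M k) ∈ S.eval ρ e) (hs : s.eval ρ e = tPsi (tE M k)) :
    (isPsiE k S s).eval ρ e := by
  rw [isPsiE, Fml.eval_subst]
  simp only [Fml.eval, eval_isPsi]
  refine ⟨?_, tE M k, h3 k, ?_, hs⟩
  · change s.eval ρ e ∈ S.eval ρ e
    rwa [hs]
  · exact eval_isE _ _ _ h0 h1 h2 (fun j _ => h3 j) rfl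

end Terms

end KPSet

namespace KPSet

section Existence

variable {M : Type} [KPModel M] {X Y : Type} [Ctx M X] [Ctx M Y]

@[simp] theorem tag_code {j k : ℕ} {x : M} : Tag j (code k x) ↔ j = k := by
  simp only [Tag, code_inj]
  exact ⟨fun ⟨_, h, _⟩ => h.symm, fun h => ⟨x, h.symm, rfl⟩⟩

/-! ### Definability of the clauses -/

instance D0.code_mem (k : ℕ) (f g : X → M) [IsVar M f] [IsVar M g] :
    D0 M (fun x => code k (f x) ∈ g x) := D0.pr_mem (fun _ => num M k) f g

instance D0.eq_code_pr (k : ℕ) (f g h : X → M) [IsVar M f] [IsVar M g] [IsVar M h] :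
    D0 M (fun x => f x = code k (pr (g x) (h x))) :=
  D0.comp₃ (R := fun a b c => a = code k (pr b c))
    ((inferInstance : D0 M (fun p : ((Unit × M) × M) × M => ∃ u ∈ p.1.1.2, ∃ q ∈ u,
      q = pr p.1.2 p.2 ∧ p.1.1.2 = code k q)).congr fun p => by
        constructor
        · intro h
          obtain ⟨u, hu, hq⟩ := mem_mem_code k (pr p.1.2 p.2)
          exact ⟨u, h ▸ hu, _, hq, rfl, h⟩
        · rintro ⟨u, -, q, -, rfl, h⟩
          exact h) f g h

instance D0.code_pr_mem (k : ℕ) (f g h : X → M) [IsVar M f] [IsVar M g] [IsVar M h] :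
    D0 M (fun x => code k (pr (g x) (h x)) ∈ f x) :=
  D0.comp₃ (R := fun a b c => code k (pr b c) ∈ a)
    ((inferInstance : D0 M (fun p : ((Unit × M) × M) × M => ∃ s ∈ p.1.1.2,
      s = code k (pr p.1.2 p.2))).congr fun p => by simp) f g h

instance D0.tag (k : ℕ) (f : X → M) [IsVar M f] : D0 M (fun x => Tag k (f x)) :=
  D0.comp₁ (R := Tag k)
    ((inferInstance : D0 M (fun p : Unit × M => ∃ u ∈ p.2, ∃ y ∈ u, p.2 = code k y)).congr
      fun p => by
        constructor
        · rintro ⟨x, h⟩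
          obtain ⟨u, hu, hx⟩ := mem_mem_code k x
          exact ⟨u, h ▸ hu, x, hx, h⟩
        · rintro ⟨u, -, x, -, h⟩
          exact ⟨x, h⟩) f

instance D0.sc (f : X → M) [IsVar M f] : D0 M (fun x => SC (f x)) := by
  unfold SC; infer_instance

instance D0.ap (f : X → M) [IsVar M f] : D0 M (fun x => AP (f x)) := by
  unfold AP; infer_instance

/-! ### Raw terms -/

/-- The normal form conditions are dropped, so raw terms can be generated without reference to the
order. -/
def RawC (θ u s : M) : Prop :=
  s = tZero M ∨ s = tOmega M ∨ (∃ x ∈ θ, s = tGamma x) ∨ s = tGamma θ ∨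
  (∃ a ∈ u, ∃ b ∈ u, s = tPlus a b) ∨ (∃ a ∈ u, ∃ b ∈ u, s = tPhi a b) ∨ (∃ a ∈ u, s = tPsi a)

theorem exists_rawC (θ u : M) : ∃ w : M, ∀ s, s ∈ w ↔ RawC θ u s := by
  obtain ⟨g, hg⟩ := exists_image (fun x : M => tGamma x) θ (h := D0.eq_code 2 _ _)
  obtain ⟨a, ha⟩ := exists_image₂ (fun x y : M => tPlus x y) u u (h := D0.eq_code_pr 3 _ _ _)
  obtain ⟨b, hb⟩ := exists_image₂ (fun x y : M => tPhi x y) u u (h := D0.eq_code_pr 4 _ _ _)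
  obtain ⟨c, hc⟩ := exists_image (fun x : M => tPsi x) u (h := D0.eq_code 5 _ _)
  obtain ⟨w1, h1⟩ := exists_union (upair (tZero M) (tOmega M)) g
  obtain ⟨w2, h2⟩ := exists_union w1 (upair (tGamma θ) (tGamma θ))
  obtain ⟨w3, h3⟩ := exists_union w2 a
  obtain ⟨w4, h4⟩ := exists_union w3 b
  obtain ⟨w, h⟩ := exists_union w4 c
  exact ⟨w, fun s => by simp [h, h1, h2, h3, h4, hg, ha, hb, hc, RawC, or_assoc]⟩

theorem exists_raw (θ : M) : ∃ R : M, ∀ s, s ∈ R ↔ RawC θ R s := by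
  choose H hH using exists_rawC θ
  have : D0Fun H := by
    constructor
    · simp only [hH]
      unfold RawC tGamma tPlus tPhi tPsi
      infer_instance
    · refine (inferInstance : D0 M (fun p : (Unit × M) × M => tZero M ∈ p.2 ∧ tOmega M ∈ p.2 ∧
        (∀ x ∈ θ, code 2 x ∈ p.2) ∧ tGamma θ ∈ p.2 ∧ (∀ a ∈ p.1.2, ∀ b ∈ p.1.2,
        code 3 (pr a b) ∈ p.2) ∧ (∀ a ∈ p.1.2, ∀ b ∈ p.1.2, code 4 (pr a b) ∈ p.2) ∧
        (∀ a ∈ p.1.2, code 5 a ∈ p.2))).congr fun p => ?_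
      simp only [hH, RawC]
      constructor
      · intro h
        refine ⟨h _ (by simp), h _ (by simp), fun x hx => h _ ?_, h _ (by simp),
          fun a ha b hb => h _ ?_, fun a ha b hb => h _ ?_, fun a ha => h _ ?_⟩
        · exact .inr (.inr (.inl ⟨x, hx, rfl⟩))
        · exact .inr (.inr (.inr (.inr (.inl ⟨a, ha, b, hb, rfl⟩))))
        · exact .inr (.inr (.inr (.inr (.inr (.inl ⟨a, ha, b, hb, rfl⟩)))))
        · exact .inr (.inr (.inr (.inr (.inr (.inr ⟨a, ha, rfl⟩)))))
      · rintro ⟨h1, h2, h3, h4, h5, h6, h7⟩ s (rfl | rfl | ⟨x, hx, rfl⟩ | rfl | ⟨a, ha, b, hb, rfl⟩ |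
          ⟨a, ha, b, hb, rfl⟩ | ⟨a, ha, rfl⟩)
        exacts [h1, h2, h3 x hx, h4, h5 a ha b hb, h6 a ha b hb, h7 a ha]
  obtain ⟨R, hR⟩ := exists_fixedPoint H (fun u v s h hs => by
    rw [hH] at hs ⊢
    rcases hs with hs | hs | hs | hs | ⟨a, ha, b, hb, hs⟩ | ⟨a, ha, b, hb, hs⟩ | ⟨a, ha, hs⟩
    · exact .inl hs
    · exact .inr (.inl hs)
    · exact .inr (.inr (.inl hs))
    · exact .inr (.inr (.inr (.inl hs)))
    · exact .inr (.inr (.inr (.inr (.inl ⟨a, h a ha, b, h b hb, hs⟩))))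
    · exact .inr (.inr (.inr (.inr (.inr (.inl ⟨a, h a ha, b, h b hb, hs⟩)))))
    · exact .inr (.inr (.inr (.inr (.inr (.inr ⟨a, h a ha, hs⟩)))))) (fun u s hs => by
    simp only [hH] at hs ⊢
    rcases hs with hs | hs | hs | hs | ⟨a, ha, b, hb, hs⟩ | ⟨a, ha, b, hb, hs⟩ | ⟨a, ha, hs⟩
    · exact .inl fun v => .inl hs
    · exact .inl fun v => .inr (.inl hs)
    · exact .inl fun v => .inr (.inr (.inl hs))
    · exact .inl fun v => .inr (.inr (.inr (.inl hs)))
    · exact .inr ⟨a, ha, b, hb, fun v ha hb =>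
        .inr (.inr (.inr (.inr (.inl ⟨a, ha, b, hb, hs⟩))))⟩
    · exact .inr ⟨a, ha, b, hb, fun v ha hb =>
        .inr (.inr (.inr (.inr (.inr (.inl ⟨a, ha, b, hb, hs⟩)))))⟩
    · exact .inr ⟨a, ha, a, ha, fun v ha _ =>
        .inr (.inr (.inr (.inr (.inr (.inr ⟨a, ha, hs⟩)))))⟩)
  exact ⟨R, fun s => (hR s).trans (hH R s)⟩

/-! ### The order and the relation `x ∈ Ka` on raw terms -/

theorem Le.mono {u v a b : M} (h : ∀ z ∈ u, z ∈ v) : Le u a b → Le v a b := Or.imp_left (h _)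

/-- The order being defined occurs only positively: the third clause for two terms `φ` is stated
with `e ≺ c`, not with the failure of the other cases. -/
theorem LtC.mono {R u v a b : M} (h : ∀ z ∈ u, z ∈ v) : LtC R u a b → LtC R v a b := by
  have h' : ∀ a b, pr a b ∈ u → pr a b ∈ v := fun a b => h _
  have h'' : ∀ a b, Le u a b → Le v a b := fun a b => Le.mono h
  unfold LtC
  refine Or.imp_right <| Or.imp_right <| Or.imp_right <| Or.imp_right <| Or.imp_right <|
    Or.imp ?_ <| Or.imp ?_ <| Or.imp ?_ <| Or.imp ?_ <| Or.imp ?_ <| Or.imp ?_ ?_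
  all_goals grind

/-- An instance of the order on the union of a chain depends on at most two earlier ones. -/
theorem LtC.fin {R u a b : M} (h : LtC R u a b) :
    (∀ v, LtC R v a b) ∨ ∃ p ∈ u, ∃ q ∈ u, ∀ v, p ∈ v → q ∈ v → LtC R v a b := by
  unfold LtC at h
  have le : ∀ {a b}, Le u a b → (∀ v, Le v a b) ∨ ∃ p ∈ u, ∀ v, p ∈ v → Le v a b := by
    rintro a b (h | h)
    · exact .inr ⟨_, h, fun v hv => .inl hv⟩
    · exact .inl fun v => .inr h
  rcases h with h | h | h | h | h | ⟨c, hc, d, hd, h1, h2, h⟩ | ⟨c, hc, d, hd, h1, h2, h⟩ |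
    ⟨c, hc, d, hd, h1, e, he, f, hf, h2, h⟩ | ⟨c, hc, d, hd, h1, h2, h, h'⟩ |
    ⟨c, hc, d, hd, h1, h2, h⟩ | ⟨c, hc, d, hd, h1, e, he, f, hf, h2, h⟩ |
    ⟨c, hc, h1, d, hd, h2, h⟩
  · exact .inl fun v => .inl h
  · exact .inl fun v => .inr (.inl h)
  · exact .inl fun v => .inr (.inr (.inl h))
  · exact .inl fun v => .inr (.inr (.inr (.inl h)))
  · exact .inl fun v => .inr (.inr (.inr (.inr (.inl h))))
  · refine .inr ⟨_, h, _, h, fun v hv _ => ?_⟩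
    exact .inr (.inr (.inr (.inr (.inr (.inl ⟨c, hc, d, hd, h1, h2, hv⟩)))))
  · have key : ∀ v, Le v a c → LtC R v a b := fun v hv =>
      .inr (.inr (.inr (.inr (.inr (.inr (.inl ⟨c, hc, d, hd, h1, h2, hv⟩))))))
    rcases le h with h | ⟨p, hp, h⟩
    · exact .inl fun v => key v (h v)
    · exact .inr ⟨p, hp, p, hp, fun v hv _ => key v (h v hv)⟩
  · have key : ∀ v, (pr c e ∈ v ∨ (c = e ∧ pr d f ∈ v)) → LtC R v a b := fun v hv =>
      .inr (.inr (.inr (.inr (.inr (.inr (.inr (.inl ⟨c, hc, d, hd, h1, e, he, f, hf, h2, hv⟩)))))))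
    rcases h with h | ⟨h, h'⟩
    · exact .inr ⟨_, h, _, h, fun v hv _ => key v (.inl hv)⟩
    · exact .inr ⟨_, h', _, h', fun v hv _ => key v (.inr ⟨h, hv⟩)⟩
  · refine .inr ⟨_, h, _, h', fun v hv hv' => ?_⟩
    exact .inr (.inr (.inr (.inr (.inr (.inr (.inr (.inr (.inl
      ⟨c, hc, d, hd, h1, h2, hv, hv'⟩))))))))
  · have key : ∀ v, Le v a c ∨ Le v a d → LtC R v a b := fun v hv =>
      .inr (.inr (.inr (.inr (.inr (.inr (.inr (.inr (.inr (.inl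
        ⟨c, hc, d, hd, h1, h2, hv⟩)))))))))
    rcases h with h | h
    · rcases le h with h | ⟨p, hp, h⟩
      · exact .inl fun v => key v (.inl (h v))
      · exact .inr ⟨p, hp, p, hp, fun v hv _ => key v (.inl (h v hv))⟩
    · rcases le h with h | ⟨p, hp, h⟩
      · exact .inl fun v => key v (.inr (h v))
      · exact .inr ⟨p, hp, p, hp, fun v hv _ => key v (.inr (h v hv))⟩
  · have key : ∀ v, ((pr c e ∈ v ∧ pr d b ∈ v) ∨ (c = e ∧ pr d f ∈ v) ∨ (pr e c ∈ v ∧ pr a f ∈ v)) →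
        LtC R v a b := fun v hv =>
      .inr (.inr (.inr (.inr (.inr (.inr (.inr (.inr (.inr (.inr (.inl
        ⟨c, hc, d, hd, h1, e, he, f, hf, h2, hv⟩))))))))))
    rcases h with ⟨h, h'⟩ | ⟨h, h'⟩ | ⟨h, h'⟩
    · exact .inr ⟨_, h, _, h', fun v hv hv' => key v (.inl ⟨hv, hv'⟩)⟩
    · exact .inr ⟨_, h', _, h', fun v hv _ => key v (.inr (.inl ⟨h, hv⟩))⟩
    · exact .inr ⟨_, h, _, h', fun v hv hv' => key v (.inr (.inr ⟨hv, hv'⟩))⟩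
  · refine .inr ⟨_, h, _, h, fun v hv _ => ?_⟩
    exact .inr (.inr (.inr (.inr (.inr (.inr (.inr (.inr (.inr (.inr (.inr
      ⟨c, hc, h1, d, hd, h2, hv⟩))))))))))

theorem KC.mono {R u v a b : M} (h : ∀ z ∈ u, z ∈ v) : KC R u a b → KC R v a b := by
  have h' : ∀ a b, pr a b ∈ u → pr a b ∈ v := fun a b => h _
  unfold KC
  refine Or.imp ?_ ?_
  all_goals grind

theorem KC.fin {R u x a : M} (h : KC R u x a) :
    (∀ v, KC R v x a) ∨ ∃ p ∈ u, ∃ q ∈ u, ∀ v, p ∈ v → q ∈ v → KC R v x a := by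
  rcases h with ⟨c, hc, d, hd, h1, h | h⟩ | ⟨c, hc, h1, h | h⟩
  · exact .inr ⟨_, h, _, h, fun v hv _ => .inl ⟨c, hc, d, hd, h1, .inl hv⟩⟩
  · exact .inr ⟨_, h, _, h, fun v hv _ => .inl ⟨c, hc, d, hd, h1, .inr hv⟩⟩
  · exact .inl fun v => .inr ⟨c, hc, h1, .inl h⟩
  · exact .inr ⟨_, h, _, h, fun v hv _ => .inr ⟨c, hc, h1, .inr hv⟩⟩

/-- With sums and terms `φ` in separate clauses, each clause starts from one equation for `a` and
can be moved between the raw terms and the system. -/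
theorem KC_iff (S K x a : M) : KC S K x a ↔
    (∃ c ∈ S, ∃ d ∈ S, a = tPlus c d ∧ (pr x c ∈ K ∨ pr x d ∈ K)) ∨
    (∃ c ∈ S, ∃ d ∈ S, a = tPhi c d ∧ (pr x c ∈ K ∨ pr x d ∈ K)) ∨
    (∃ c ∈ S, a = tPsi c ∧ (x = c ∨ pr x c ∈ K)) := by
  unfold KC
  grind

/-- Fixed points of operators on relations. -/
theorem exists_fixedPoint_rel (R : M) (Φ : M → M → M → Prop)
    (hD : D0 M (fun p : ((Unit × M) × M) × M => Φ p.1.1.2 p.1.2 p.2))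
    (mono : ∀ u v a b : M, (∀ z ∈ u, z ∈ v) → Φ u a b → Φ v a b)
    (fin : ∀ u a b : M, Φ u a b →
      (∀ v, Φ v a b) ∨ ∃ p ∈ u, ∃ q ∈ u, ∀ v, p ∈ v → q ∈ v → Φ v a b) :
    ∃ L : M, ∀ a ∈ R, ∀ b ∈ R, pr a b ∈ L ↔ Φ L a b := by
  obtain ⟨A, hA⟩ := exists_image₂ (fun x y : M => pr x y) R R
  have : D0 M (fun p : ((((Unit × M) × M) × M) × M) => Φ p.1.1.1.2 p.1.2 p.2) := D0.comp₃ hD _ _ _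
  obtain ⟨L, -, hL⟩ := exists_fixedPoint_sep A
    (fun u p => ∃ a ∈ R, ∃ b ∈ R, p = pr a b ∧ Φ u a b)
    (fun u v p h => by
      rintro ⟨a, ha, b, hb, rfl, h'⟩
      exact ⟨a, ha, b, hb, rfl, mono u v a b h h'⟩)
    (fun u p _ => by
      rintro ⟨a, ha, b, hb, rfl, h'⟩
      rcases fin u a b h' with h | ⟨p, hp, q, hq, h⟩
      · exact .inl fun v => ⟨a, ha, b, hb, rfl, h v⟩
      · exact .inr ⟨p, hp, q, hq, fun v hp hq => ⟨a, ha, b, hb, rfl, h v hp hq⟩⟩)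
  refine ⟨L, fun a ha b hb => ?_⟩
  rw [hL _ ((hA _).2 ⟨a, ha, b, hb, rfl⟩)]
  constructor
  · rintro ⟨a', ha', b', hb', h, h'⟩
    obtain ⟨rfl, rfl⟩ := pr_inj.1 h
    exact h'
  · exact fun h => ⟨a, ha, b, hb, rfl, h⟩

set_option synthInstance.maxHeartbeats 400000 in
set_option synthInstance.maxSize 4096 in
-- Any fixed point of the monotone finitary clauses will do; minimality plays no role, since later
-- arguments use only the equivalences and induction on components.
theorem exists_ltC (R : M) : ∃ L : M, ∀ a ∈ R, ∀ b ∈ R, pr a b ∈ L ↔ LtC R L a b := by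
  refine exists_fixedPoint_rel R (LtC R) ?_ (fun u v a b => LtC.mono) (fun u a b => LtC.fin)
  unfold LtC Le tGamma tPlus tPhi tPsi
  infer_instance

set_option synthInstance.maxHeartbeats 400000 in
set_option synthInstance.maxSize 4096 in
theorem exists_KC (R : M) : ∃ K : M, ∀ a ∈ R, ∀ b ∈ R, pr a b ∈ K ↔ KC R K a b := by
  refine exists_fixedPoint_rel R (KC R) ?_ (fun u v a b => KC.mono) (fun u a b => KC.fin)
  unfold KC tPlus tPhi tPsi
  infer_instance

/-! ### Induction on terms -/

/-- The set-theoretic induction hypothesis is strengthened so that it reaches elements of elements,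
as is needed for coded components. -/
theorem set_induction₂ {P : M → Prop} [h : Def M (fun p : Unit × M => P p.2)]
    (H : ∀ x, (∀ u ∈ x, ∀ v ∈ u, P v) → P x) (x : M) : P x := by
  have hD := fun {X : Type} [Ctx M X] (f : X → M) [DefFun M f] => Def.comp₁ (R := P) h f
  have := set_induction (P := fun x => P x ∧ ∀ u ∈ x, P u) (fun x ih =>
    ⟨H x fun u hu => (ih u hu).2, fun u hu => (ih u hu).1⟩) x
  exact this.1

/-- `y` is an immediate component of the term `x`. -/
def Sub (y x : M) : Prop :=
  (∃ b, x = tPlus y b ∨ x = tPlus b y ∨ x = tPhi y b ∨ x = tPhi b y) ∨ x = tPsi y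

theorem Sub.mem {y x : M} (h_sub : Sub y x) :
    ∃ u ∈ x, ∃ v ∈ u, v = y ∨ ∃ w ∈ v, y ∈ w := by
  have key : ∀ k (a b : M), (y = a ∨ y = b) → x = code k (pr a b) →
      ∃ u ∈ x, ∃ v ∈ u, v = y ∨ ∃ w ∈ v, y ∈ w := by
    intro k a b h hx
    subst hx
    clear h_sub
    obtain ⟨u, hu, hv⟩ := mem_mem_code k (pr a b)
    obtain ⟨w, hw, ha, hb⟩ := mem_mem_pr a b
    exact ⟨u, hu, _, hv, .inr ⟨w, hw, by rcases h with rfl | rfl <;> assumption⟩⟩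
  rcases h_sub with ⟨b, h | h | h | h⟩ | h
  · exact key 3 y b (.inl rfl) h
  · exact key 3 b y (.inr rfl) h
  · exact key 4 y b (.inl rfl) h
  · exact key 4 b y (.inr rfl) h
  · subst h
    obtain ⟨u, hu, hv⟩ := mem_mem_code 5 y
    exact ⟨u, hu, y, hv, .inl rfl⟩

/-- A component of a sum or of a term `φ` lies four levels below the code, and the argument of `ψ`
lies two levels below. Hence the two-level induction is applied to a statement that itself covers
two further levels. -/
theorem sub_induction {P : M → Prop} [h : Def M (fun p : Unit × M => P p.2)]
    (H : ∀ x, (∀ y, Sub y x → P y) → P x) (x : M) : P x := by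
  have hD := fun {X : Type} [Ctx M X] (f : X → M) [DefFun M f] => Def.comp₁ (R := P) h f
  have := set_induction₂ (P := fun x => P x ∧ ∀ u ∈ x, ∀ v ∈ u, P v) (fun x ih =>
    ⟨H x fun y hy => ?_, fun u hu v hv => (ih u hu v hv).1⟩) x
  · exact this.1
  · obtain ⟨u, hu, v, hv, rfl | ⟨w, hw, hy⟩⟩ := hy.mem
    · exact (ih u hu v hv).1
    · exact (ih u hu v hv).2 w hw y hy

theorem sub_plus_left (a b : M) : Sub a (tPlus a b) := .inl ⟨b, .inl rfl⟩
theorem sub_plus_right (a b : M) : Sub b (tPlus a b) := .inl ⟨a, .inr (.inl rfl)⟩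
theorem sub_phi_left (a b : M) : Sub a (tPhi a b) := .inl ⟨b, .inr (.inr (.inl rfl))⟩
theorem sub_phi_right (a b : M) : Sub b (tPhi a b) := .inl ⟨a, .inr (.inr (.inr rfl))⟩
theorem sub_psi (a : M) : Sub a (tPsi a) := .inr rfl

/-! ### The system -/

set_option synthInstance.maxHeartbeats 400000 in
set_option synthInstance.maxSize 4096 in
instance D0.plusNF (S L : M) (f g : X → M) [IsVar M f] [IsVar M g] :
    D0 M (fun x => PlusNF S L (f x) (g x)) := by
  refine D0.comp₂ (R := fun a b => PlusNF S L a b) ?_ f g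
  unfold PlusNF Le tPlus
  infer_instance

set_option synthInstance.maxHeartbeats 400000 in
set_option synthInstance.maxSize 4096 in
instance D0.phiNF (S L : M) (f g : X → M) [IsVar M f] [IsVar M g] :
    D0 M (fun x => PhiNF S L (f x) (g x)) := by
  refine D0.comp₂ (R := fun a b => PhiNF S L a b) ?_ f g
  unfold PhiNF Le tPhi
  infer_instance

instance D0.psiNF (S L K : M) (f : X → M) [IsVar M f] :
    D0 M (fun x => PsiNF S L K (f x)) := by
  refine D0.comp₁ (R := fun a => PsiNF S L K a) ?_ f
  unfold PsiNF
  infer_instance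

/-- `Generated`, except that the normal form conditions refer to the raw terms. -/
def GenRaw (θ R L K u s : M) : Prop :=
  s = tZero M ∨ s = tOmega M ∨ (∃ x ∈ θ, s = tGamma x) ∨ s = tGamma θ ∨
  (∃ a ∈ u, ∃ b ∈ u, (PlusNF R L a b ∧ s = tPlus a b) ∨ (PhiNF R L a b ∧ s = tPhi a b)) ∨
  (∃ a ∈ u, PsiNF R L K a ∧ s = tPsi a)

set_option synthInstance.maxHeartbeats 400000 in
set_option synthInstance.maxSize 4096 in
theorem exists_genRaw (θ R L K : M) :
    ∃ S : M, (∀ s ∈ S, s ∈ R) ∧ ∀ s ∈ R, s ∈ S ↔ GenRaw θ R L K S s := by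
  have : D0 M (fun p : (Unit × M) × M => GenRaw θ R L K p.1.2 p.2) := by
    unfold GenRaw tGamma tPlus tPhi tPsi
    infer_instance
  refine exists_fixedPoint_sep R (GenRaw θ R L K) (fun u v s h hs => ?_) (fun u s _ hs => ?_)
  · rcases hs with hs | hs | hs | hs | ⟨a, ha, b, hb, hs⟩ | ⟨a, ha, hs⟩
    · exact .inl hs
    · exact .inr (.inl hs)
    · exact .inr (.inr (.inl hs))
    · exact .inr (.inr (.inr (.inl hs)))
    · exact .inr (.inr (.inr (.inr (.inl ⟨a, h a ha, b, h b hb, hs⟩))))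
    · exact .inr (.inr (.inr (.inr (.inr ⟨a, h a ha, hs⟩))))
  · rcases hs with hs | hs | hs | hs | ⟨a, ha, b, hb, hs⟩ | ⟨a, ha, hs⟩
    · exact .inl fun v => .inl hs
    · exact .inl fun v => .inr (.inl hs)
    · exact .inl fun v => .inr (.inr (.inl hs))
    · exact .inl fun v => .inr (.inr (.inr (.inl hs)))
    · exact .inr ⟨a, ha, b, hb, fun v ha hb => .inr (.inr (.inr (.inr (.inl ⟨a, ha, b, hb, hs⟩))))⟩
    · exact .inr ⟨a, ha, a, ha, fun v ha _ => .inr (.inr (.inr (.inr (.inr ⟨a, ha, hs⟩))))⟩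

/-- The simultaneous definition is untangled by constructing the order and `K` on all raw terms
first; the normal form conditions are then fixed, and `S` is generated inside the raw terms. As `S`
contains the components of its members, quantifiers over raw components can be replaced by
quantifiers over `S`. -/
theorem exists_sys (θ : M) : ∃ S L K : M, Sys θ S L K := by
  obtain ⟨R, hR⟩ := exists_raw θ
  obtain ⟨L, hL⟩ := exists_ltC R
  obtain ⟨K, hK⟩ := exists_KC R
  obtain ⟨S, hSR, hS⟩ := exists_genRaw θ R L K
  have plusS : ∀ {a b}, tPlus a b ∈ S → a ∈ S ∧ b ∈ S := by
    intro a b h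
    have := (hS _ (hSR _ h)).1 h
    simp [GenRaw, tPlus, tZero, tOmega, tGamma, tPhi, tPsi] at this
    grind
  have phiS : ∀ {a b}, tPhi a b ∈ S → a ∈ S ∧ b ∈ S := by
    intro a b h
    have := (hS _ (hSR _ h)).1 h
    simp [GenRaw, tPlus, tZero, tOmega, tGamma, tPhi, tPsi] at this
    grind
  have psiS : ∀ {a}, tPsi a ∈ S → a ∈ S := by
    intro a h
    have := (hS _ (hSR _ h)).1 h
    simp [GenRaw, tPlus, tZero, tOmega, tGamma, tPhi, tPsi] at this
    grind
  have bplus : ∀ {s} (_ : s ∈ S) (Q : M → M → Prop),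
      (∃ c ∈ R, ∃ d ∈ R, s = tPlus c d ∧ Q c d) ↔ ∃ c ∈ S, ∃ d ∈ S, s = tPlus c d ∧ Q c d := by
    refine fun hs Q => ⟨?_, fun ⟨c, hc, d, hd, h⟩ => ⟨c, hSR c hc, d, hSR d hd, h⟩⟩
    rintro ⟨c, -, d, -, rfl, h⟩
    exact ⟨c, (plusS hs).1, d, (plusS hs).2, rfl, h⟩
  have bphi : ∀ {s} (_ : s ∈ S) (Q : M → M → Prop),
      (∃ c ∈ R, ∃ d ∈ R, s = tPhi c d ∧ Q c d) ↔ ∃ c ∈ S, ∃ d ∈ S, s = tPhi c d ∧ Q c d := by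
    refine fun hs Q => ⟨?_, fun ⟨c, hc, d, hd, h⟩ => ⟨c, hSR c hc, d, hSR d hd, h⟩⟩
    rintro ⟨c, -, d, -, rfl, h⟩
    exact ⟨c, (phiS hs).1, d, (phiS hs).2, rfl, h⟩
  have bpsi : ∀ {s} (_ : s ∈ S) (Q : M → Prop),
      (∃ c ∈ R, s = tPsi c ∧ Q c) ↔ ∃ c ∈ S, s = tPsi c ∧ Q c := by
    refine fun hs Q => ⟨?_, fun ⟨c, hc, h⟩ => ⟨c, hSR c hc, h⟩⟩
    rintro ⟨c, -, rfl, h⟩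
    exact ⟨c, psiS hs, rfl, h⟩
  have eLt : ∀ a ∈ S, ∀ b ∈ S, LtC R L a b ↔ LtC S L a b := by
    intro a ha b hb
    simp only [LtC, bplus ha, bplus hb, bphi ha, bphi hb, bpsi ha, bpsi hb]
  have eK : ∀ x, ∀ a ∈ S, KC R K x a ↔ KC S K x a := by
    intro x a ha
    rw [KC_iff, KC_iff, bplus ha, bphi ha, bpsi ha]
  have hO : tOmega M ∈ S := (hS _ ((hR _).2 (.inr (.inl rfl)))).2 (.inr (.inl rfl))
  have ePlus : ∀ a, ∀ b ∈ S, PlusNF R L a b ↔ PlusNF S L a b := by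
    intro a b hb
    simp only [PlusNF, bplus hb]
  have ePhi : ∀ a, ∀ b ∈ S, PhiNF R L a b ↔ PhiNF S L a b := by
    intro a b hb
    simp only [PhiNF, bphi hb]
    constructor
    · rintro ⟨_, -, rfl, h⟩
      exact ⟨_, hO, rfl, h⟩
    · rintro ⟨_, -, rfl, h⟩
      exact ⟨_, hSR _ hO, rfl, h⟩
  -- The condition on `ψ a` quantifies over all arguments of `ψ` in `a`, not just immediate
  -- components, so these too must be shown to lie in `S`.
  have Ksub : ∀ a, a ∈ S → ∀ x ∈ R, pr x a ∈ K → x ∈ S := by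
    refine sub_induction (P := fun a => a ∈ S → ∀ x ∈ R, pr x a ∈ K → x ∈ S)
      (fun a ih ha x hx h => ?_)
    rcases (eK x a ha).1 ((hK x hx a (hSR a ha)).1 h) with
      ⟨c, hc, d, hd, h1, h | h⟩ | ⟨c, hc, h1, rfl | h⟩
    · exact ih c (by rcases h1 with rfl | rfl; exacts [sub_plus_left _ _, sub_phi_left _ _]) hc x hx h
    · exact ih d (by rcases h1 with rfl | rfl; exacts [sub_plus_right _ _, sub_phi_right _ _])
        hd x hx h
    · exact hc
    · exact ih c (h1 ▸ sub_psi c) hc x hx h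
  have ePsi : ∀ a ∈ S, PsiNF R L K a ↔ PsiNF S L K a := fun a ha =>
    ⟨fun h x hx => h x (hSR x hx), fun h x hx hxa => h x (Ksub a ha x hx hxa) hxa⟩
  have eGen : ∀ s, GenRaw θ R L K S s ↔ Generated θ S L K s := by
    intro s
    have e1 : ∀ {P Q : M → M → Prop}, (∀ a, ∀ b ∈ S, P a b ↔ Q a b) →
        ((∃ a ∈ S, ∃ b ∈ S, P a b) ↔ ∃ a ∈ S, ∃ b ∈ S, Q a b) := by
      intro P Q h
      exact exists_congr fun a => and_congr_right fun _ => exists_congr fun b =>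
        and_congr_right fun hb => h a b hb
    unfold GenRaw Generated
    rw [e1 (Q := fun a b => (PlusNF S L a b ∧ s = tPlus a b) ∨ (PhiNF S L a b ∧ s = tPhi a b))
      (fun a b hb => by rw [ePlus a b hb, ePhi a b hb])]
    have : (∃ a ∈ S, PsiNF R L K a ∧ s = tPsi a) ↔ ∃ a ∈ S, PsiNF S L K a ∧ s = tPsi a :=
      exists_congr fun a => and_congr_right fun ha => by rw [ePsi a ha]
    rw [this]
  have mem : ∀ s, RawC θ R s → GenRaw θ R L K S s → s ∈ S := fun s h h' =>
    (hS s ((hR s).2 h)).2 h'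
  refine ⟨S, L, K, fun s hs => (eGen s).1 ((hS s (hSR s hs)).1 hs), ⟨?_, ?_, ?_, ?_, ?_, ?_⟩, ?_, ?_⟩
  · exact ⟨_, mem _ (.inl rfl) (.inl rfl), rfl⟩
  · exact ⟨_, hO, rfl⟩
  · exact fun x hx => ⟨_, mem _ (.inr (.inr (.inl ⟨x, hx, rfl⟩))) (.inr (.inr (.inl ⟨x, hx, rfl⟩))), rfl⟩
  · exact ⟨_, mem _ (.inr (.inr (.inr (.inl rfl)))) (.inr (.inr (.inr (.inl rfl)))), rfl⟩
  · intro a ha b hb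
    rw [← ePlus a b hb, ← ePhi a b hb]
    refine ⟨fun h => ⟨_, mem _ ?_ ?_, rfl⟩, fun h => ⟨_, mem _ ?_ ?_, rfl⟩⟩
    · exact .inr (.inr (.inr (.inr (.inl ⟨a, hSR a ha, b, hSR b hb, rfl⟩))))
    · exact .inr (.inr (.inr (.inr (.inl ⟨a, ha, b, hb, .inl ⟨h, rfl⟩⟩))))
    · exact .inr (.inr (.inr (.inr (.inr (.inl ⟨a, hSR a ha, b, hSR b hb, rfl⟩)))))
    · exact .inr (.inr (.inr (.inr (.inl ⟨a, ha, b, hb, .inr ⟨h, rfl⟩⟩))))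
  · intro a ha h
    rw [← ePsi a ha] at h
    refine ⟨_, mem _ ?_ ?_, rfl⟩
    · exact .inr (.inr (.inr (.inr (.inr (.inr ⟨a, hSR a ha, rfl⟩)))))
    · exact .inr (.inr (.inr (.inr (.inr ⟨a, ha, h, rfl⟩))))
  · exact fun a ha b hb => (hL a (hSR a ha) b (hSR b hb)).trans (eLt a ha b hb)
  · exact fun a ha b hb => (hK a (hSR a ha) b (hSR b hb)).trans (eK a b hb)

end Existence

end KPSet

namespace KPSet

section Order

variable {M : Type} [KPModel M] {θ S L K : M}

/-! ### The clauses of the order for the various kinds of terms -/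

@[simp] theorem tag_zero {k : ℕ} : Tag k (tZero M) ↔ k = 0 := tag_code
@[simp] theorem tag_omega {k : ℕ} : Tag k (tOmega M) ↔ k = 1 := tag_code
@[simp] theorem tag_gamma {k : ℕ} {x : M} : Tag k (tGamma x) ↔ k = 2 := tag_code
@[simp] theorem tag_plus {k : ℕ} {a b : M} : Tag k (tPlus a b) ↔ k = 3 := tag_code
@[simp] theorem tag_phi {k : ℕ} {a b : M} : Tag k (tPhi a b) ↔ k = 4 := tag_code
@[simp] theorem tag_psi {k : ℕ} {a : M} : Tag k (tPsi a) ↔ k = 5 := tag_code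

@[simp] theorem tGamma_inj {x y : M} : tGamma x = tGamma y ↔ x = y := by simp [tGamma]
@[simp] theorem tPsi_inj {x y : M} : tPsi x = tPsi y ↔ x = y := by simp [tPsi]
@[simp] theorem tPlus_inj {a b c d : M} : tPlus a b = tPlus c d ↔ a = c ∧ b = d := by simp [tPlus]
@[simp] theorem tPhi_inj {a b c d : M} : tPhi a b = tPhi c d ↔ a = c ∧ b = d := by simp [tPhi]

theorem ne_of_tag {s t : M} (k : ℕ) (h : Tag k s) (h' : ¬ Tag k t) : s ≠ t := fun e => h' (e ▸ h)

@[simp] theorem plus_ne_phi {a b c d : M} : tPlus a b ≠ tPhi c d := ne_of_tag 3 (by simp) (by simp)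
@[simp] theorem phi_ne_plus {a b c d : M} : tPhi a b ≠ tPlus c d := ne_of_tag 4 (by simp) (by simp)
@[simp] theorem plus_ne_psi {a b c : M} : tPlus a b ≠ tPsi c := ne_of_tag 3 (by simp) (by simp)
@[simp] theorem phi_ne_psi {a b c : M} : tPhi a b ≠ tPsi c := ne_of_tag 4 (by simp) (by simp)
@[simp] theorem psi_ne_plus {a b c : M} : tPsi c ≠ tPlus a b := ne_of_tag 5 (by simp) (by simp)
@[simp] theorem psi_ne_phi {a b c : M} : tPsi c ≠ tPhi a b := ne_of_tag 5 (by simp) (by simp)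
@[simp] theorem plus_ne_gamma {a b c : M} : tPlus a b ≠ tGamma c := ne_of_tag 3 (by simp) (by simp)
@[simp] theorem phi_ne_gamma {a b c : M} : tPhi a b ≠ tGamma c := ne_of_tag 4 (by simp) (by simp)
@[simp] theorem gamma_ne_plus {a b c : M} : tGamma c ≠ tPlus a b := ne_of_tag 2 (by simp) (by simp)
@[simp] theorem gamma_ne_phi {a b c : M} : tGamma c ≠ tPhi a b := ne_of_tag 2 (by simp) (by simp)
@[simp] theorem psi_ne_gamma {a c : M} : tPsi a ≠ tGamma c := ne_of_tag 5 (by simp) (by simp)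
@[simp] theorem gamma_ne_psi {a c : M} : tGamma a ≠ tPsi c := ne_of_tag 2 (by simp) (by simp)
@[simp] theorem zero_ne_plus {a b : M} : tZero M ≠ tPlus a b := ne_of_tag 0 (by simp) (by simp)
@[simp] theorem zero_ne_phi {a b : M} : tZero M ≠ tPhi a b := ne_of_tag 0 (by simp) (by simp)
@[simp] theorem zero_ne_psi {a : M} : tZero M ≠ tPsi a := ne_of_tag 0 (by simp) (by simp)
@[simp] theorem zero_ne_gamma {a : M} : tZero M ≠ tGamma a := ne_of_tag 0 (by simp) (by simp)
@[simp] theorem omega_ne_plus {a b : M} : tOmega M ≠ tPlus a b := ne_of_tag 1 (by simp) (by simp)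
@[simp] theorem omega_ne_phi {a b : M} : tOmega M ≠ tPhi a b := ne_of_tag 1 (by simp) (by simp)
@[simp] theorem omega_ne_psi {a : M} : tOmega M ≠ tPsi a := ne_of_tag 1 (by simp) (by simp)
@[simp] theorem omega_ne_gamma {a : M} : tOmega M ≠ tGamma a := ne_of_tag 1 (by simp) (by simp)

@[simp] theorem sc_zero : ¬ SC (tZero M) := by simp [SC]
@[simp] theorem sc_omega : SC (tOmega M) := by simp [SC]
@[simp] theorem sc_gamma {x : M} : SC (tGamma x) := by simp [SC]
@[simp] theorem sc_plus {a b : M} : ¬ SC (tPlus a b) := by simp [SC]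
@[simp] theorem sc_phi {a b : M} : ¬ SC (tPhi a b) := by simp [SC]
@[simp] theorem sc_psi {a : M} : SC (tPsi a) := by simp [SC]
@[simp] theorem ap_zero : ¬ AP (tZero M) := by simp [AP]
@[simp] theorem ap_plus {a b : M} : ¬ AP (tPlus a b) := by simp [AP]
@[simp] theorem ap_phi {a b : M} : AP (tPhi a b) := by simp [AP]
theorem SC.ap {s : M} (h : SC s) : AP s := .inl h
@[simp] theorem ap_omega : AP (tOmega M) := sc_omega.ap
@[simp] theorem ap_gamma {x : M} : AP (tGamma x) := sc_gamma.ap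
@[simp] theorem ap_psi {a : M} : AP (tPsi a) := sc_psi.ap

theorem SC.ne_plus {s a b : M} (h : SC s) : s ≠ tPlus a b := fun e => sc_plus (e ▸ h)
theorem SC.ne_phi {s a b : M} (h : SC s) : s ≠ tPhi a b := fun e => sc_phi (e ▸ h)
theorem AP.ne_plus {s a b : M} (h : AP s) : s ≠ tPlus a b := fun e => ap_plus (e ▸ h)

theorem AP.not_tag {s : M} (h : AP s) : ¬ Tag 0 s := by
  rcases h with (⟨x, rfl⟩ | ⟨x, rfl⟩ | ⟨x, rfl⟩) | ⟨x, rfl⟩ <;> simp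

/-- The clause for `Γ_ξ ≺ Γ_η`. -/
theorem gammaClause_iff {a b : M} :
    (∃ u ∈ a, ∃ x ∈ u, a = tGamma x ∧ ∃ w ∈ b, ∃ y ∈ w, b = tGamma y ∧ x ∈ y) ↔
      ∃ x y, a = tGamma x ∧ b = tGamma y ∧ x ∈ y := by
  constructor
  · rintro ⟨u, -, x, -, ha, w, -, y, -, hb, h⟩
    exact ⟨x, y, ha, hb, h⟩
  · rintro ⟨x, y, rfl, rfl, h⟩
    obtain ⟨u, hu, hx⟩ := mem_mem_code 2 x
    obtain ⟨w, hw, hy⟩ := mem_mem_code 2 y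
    exact ⟨u, hu, x, hx, rfl, w, hw, y, hy, rfl, h⟩

namespace Sys

theorem cases (hs : Sys θ S L K) {s : M} (h : s ∈ S) : s = tZero M ∨ s = tOmega M ∨
    (∃ x, (x ∈ θ ∨ x = θ) ∧ s = tGamma x) ∨
    (∃ a b, a ∈ S ∧ b ∈ S ∧ PlusNF S L a b ∧ s = tPlus a b) ∨
    (∃ a b, a ∈ S ∧ b ∈ S ∧ PhiNF S L a b ∧ s = tPhi a b) ∨
    (∃ a, a ∈ S ∧ PsiNF S L K a ∧ s = tPsi a) := by
  rcases hs.1 s h with h | h | ⟨x, hx, h⟩ | h | ⟨a, ha, b, hb, h | h⟩ | ⟨a, ha, h⟩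
  · exact .inl h
  · exact .inr (.inl h)
  · exact .inr (.inr (.inl ⟨x, .inl hx, h⟩))
  · exact .inr (.inr (.inl ⟨θ, .inr rfl, h⟩))
  · exact .inr (.inr (.inr (.inl ⟨a, b, ha, hb, h.1, h.2⟩)))
  · exact .inr (.inr (.inr (.inr (.inl ⟨a, b, ha, hb, h.1, h.2⟩))))
  · exact .inr (.inr (.inr (.inr (.inr ⟨a, ha, h⟩))))

theorem plus_mem (hs : Sys θ S L K) {a b : M} :
    tPlus a b ∈ S ↔ a ∈ S ∧ b ∈ S ∧ PlusNF S L a b := by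
  constructor
  · intro h
    rcases hs.cases h with h | h | ⟨x, hx, h⟩ | ⟨c, d, hc, hd, hn, h⟩ | ⟨c, d, hc, hd, hn, h⟩ |
      ⟨c, hc, hn, h⟩
    · exact absurd h.symm zero_ne_plus
    · exact absurd h.symm omega_ne_plus
    · exact absurd h plus_ne_gamma
    · obtain ⟨rfl, rfl⟩ := tPlus_inj.1 h
      exact ⟨hc, hd, hn⟩
    · exact absurd h plus_ne_phi
    · exact absurd h plus_ne_psi
  · rintro ⟨ha, hb, h⟩
    obtain ⟨s, hs, rfl⟩ := (hs.2.1.2.2.2.2.1 a ha b hb).1 h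
    exact hs

theorem phi_mem (hs : Sys θ S L K) {a b : M} :
    tPhi a b ∈ S ↔ a ∈ S ∧ b ∈ S ∧ PhiNF S L a b := by
  constructor
  · intro h
    rcases hs.cases h with h | h | ⟨x, hx, h⟩ | ⟨c, d, hc, hd, hn, h⟩ | ⟨c, d, hc, hd, hn, h⟩ |
      ⟨c, hc, hn, h⟩
    · exact absurd h.symm zero_ne_phi
    · exact absurd h.symm omega_ne_phi
    · exact absurd h phi_ne_gamma
    · exact absurd h phi_ne_plus
    · obtain ⟨rfl, rfl⟩ := tPhi_inj.1 h
      exact ⟨hc, hd, hn⟩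
    · exact absurd h phi_ne_psi
  · rintro ⟨ha, hb, h⟩
    obtain ⟨s, hs, rfl⟩ := (hs.2.1.2.2.2.2.1 a ha b hb).2 h
    exact hs

theorem psi_mem (hs : Sys θ S L K) {a : M} : tPsi a ∈ S ↔ a ∈ S ∧ PsiNF S L K a := by
  constructor
  · intro h
    rcases hs.cases h with h | h | ⟨x, hx, h⟩ | ⟨c, d, hc, hd, hn, h⟩ | ⟨c, d, hc, hd, hn, h⟩ |
      ⟨c, hc, hn, h⟩
    · exact absurd h.symm zero_ne_psi
    · exact absurd h.symm omega_ne_psi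
    · exact absurd h psi_ne_gamma
    · exact absurd h psi_ne_plus
    · exact absurd h psi_ne_phi
    · obtain rfl := tPsi_inj.1 h
      exact ⟨hc, hn⟩
  · rintro ⟨ha, h⟩
    obtain ⟨s, hs, rfl⟩ := hs.2.1.2.2.2.2.2 a ha h
    exact hs

theorem zero_mem (hs : Sys θ S L K) : tZero M ∈ S := by
  obtain ⟨s, hs, rfl⟩ := hs.2.1.1
  exact hs

theorem omega_mem (hs : Sys θ S L K) : tOmega M ∈ S := by
  obtain ⟨s, hs, rfl⟩ := hs.2.1.2.1
  exact hs

theorem lt_iff (hs : Sys θ S L K) {a b : M} (ha : a ∈ S) (hb : b ∈ S) :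
    pr a b ∈ L ↔ LtC S L a b := hs.2.2.1 a ha b hb

theorem not_lt_zero (hs : Sys θ S L K) {a : M} (ha : a ∈ S) : pr a (tZero M) ∉ L := by
  rw [hs.lt_iff ha hs.zero_mem, LtC, gammaClause_iff]
  simp

theorem zero_lt (hs : Sys θ S L K) {a : M} (ha : a ∈ S) (h : ¬ Tag 0 a) : pr (tZero M) a ∈ L := by
  rw [hs.lt_iff hs.zero_mem ha, LtC]
  exact .inl ⟨by simp, h⟩

theorem eq_zero (hs : Sys θ S L K) {a : M} (ha : a ∈ S) (h : Tag 0 a) : a = tZero M := by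
  rcases hs.cases ha with h' | h' | ⟨y, hy, h'⟩ | ⟨c, d, hc, hd, hn, h'⟩ | ⟨c, d, hc, hd, hn, h'⟩ |
    ⟨c, hc, hn, h'⟩
  · exact h'
  all_goals simp [h'] at h

theorem plus_lt (hs : Sys θ S L K) {b c d : M} (h : tPlus c d ∈ S) (hb : b ∈ S) (hA : AP b) :
    pr (tPlus c d) b ∈ L ↔ pr c b ∈ L := by
  obtain ⟨hc, hd, -⟩ := hs.plus_mem.1 h
  rw [hs.lt_iff h hb, LtC, gammaClause_iff]
  have : ∀ e f, b ≠ tPlus e f := fun e f => hA.ne_plus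
  simp [this, hA, hc, hd]

theorem lt_plus (hs : Sys θ S L K) {a c d : M} (h : tPlus c d ∈ S) (ha : a ∈ S) (hA : AP a) :
    pr a (tPlus c d) ∈ L ↔ Le L a c := by
  obtain ⟨hc, hd, -⟩ := hs.plus_mem.1 h
  rw [hs.lt_iff ha h, LtC, gammaClause_iff]
  have : ∀ e f, a ≠ tPlus e f := fun e f => hA.ne_plus
  simp [this, hA, hA.not_tag, hc, hd]

theorem plus_lt_plus (hs : Sys θ S L K) {a b c d : M} (h : tPlus a b ∈ S) (h' : tPlus c d ∈ S) :
    pr (tPlus a b) (tPlus c d) ∈ L ↔ pr a c ∈ L ∨ (a = c ∧ pr b d ∈ L) := by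
  obtain ⟨ha, hb, -⟩ := hs.plus_mem.1 h
  obtain ⟨hc, hd, -⟩ := hs.plus_mem.1 h'
  rw [hs.lt_iff h h', LtC, gammaClause_iff]
  simp [ha, hb, hc, hd]

theorem phi_lt (hs : Sys θ S L K) {b c d : M} (h : tPhi c d ∈ S) (hb : b ∈ S) (hA : SC b) :
    pr (tPhi c d) b ∈ L ↔ pr c b ∈ L ∧ pr d b ∈ L := by
  obtain ⟨hc, hd, -⟩ := hs.phi_mem.1 h
  rw [hs.lt_iff h hb, LtC, gammaClause_iff]
  have h1 : ∀ e f, b ≠ tPlus e f := fun e f => hA.ne_plus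
  have h2 : ∀ e f, b ≠ tPhi e f := fun e f => hA.ne_phi
  simp [h1, h2, hA, hc, hd]

theorem lt_phi (hs : Sys θ S L K) {a c d : M} (h : tPhi c d ∈ S) (ha : a ∈ S) (hA : SC a) :
    pr a (tPhi c d) ∈ L ↔ Le L a c ∨ Le L a d := by
  obtain ⟨hc, hd, -⟩ := hs.phi_mem.1 h
  rw [hs.lt_iff ha h, LtC, gammaClause_iff]
  have h1 : ∀ e f, a ≠ tPlus e f := fun e f => hA.ne_plus
  have h2 : ∀ e f, a ≠ tPhi e f := fun e f => hA.ne_phi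
  simp [h1, h2, hA, hA.ap.not_tag, hc, hd]

theorem phi_lt_phi (hs : Sys θ S L K) {a b c d : M} (h : tPhi a b ∈ S) (h' : tPhi c d ∈ S) :
    pr (tPhi a b) (tPhi c d) ∈ L ↔ (pr a c ∈ L ∧ pr b (tPhi c d) ∈ L) ∨ (a = c ∧ pr b d ∈ L) ∨
      (pr c a ∈ L ∧ pr (tPhi a b) d ∈ L) := by
  obtain ⟨ha, hb, -⟩ := hs.phi_mem.1 h
  obtain ⟨hc, hd, -⟩ := hs.phi_mem.1 h'
  rw [hs.lt_iff h h', LtC, gammaClause_iff]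
  simp [ha, hb, hc, hd]

theorem psi_lt_psi (hs : Sys θ S L K) {a b : M} (h : tPsi a ∈ S) (h' : tPsi b ∈ S) :
    pr (tPsi a) (tPsi b) ∈ L ↔ pr a b ∈ L := by
  obtain ⟨ha, -⟩ := hs.psi_mem.1 h
  obtain ⟨hb, -⟩ := hs.psi_mem.1 h'
  rw [hs.lt_iff h h', LtC, gammaClause_iff]
  simp [ha, hb]

theorem gamma_lt_gamma (hs : Sys θ S L K) {x y : M} (h : tGamma x ∈ S) (h' : tGamma y ∈ S) :
    pr (tGamma x) (tGamma y) ∈ L ↔ x ∈ y := by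
  rw [hs.lt_iff h h', LtC, gammaClause_iff]
  simp

theorem gamma_lt_psi (hs : Sys θ S L K) {x a : M} (h : tGamma x ∈ S) (h' : tPsi a ∈ S) :
    pr (tGamma x) (tPsi a) ∈ L := by
  rw [hs.lt_iff h h', LtC]
  simp

theorem gamma_lt_omega (hs : Sys θ S L K) {x : M} (h : tGamma x ∈ S) :
    pr (tGamma x) (tOmega M) ∈ L := by
  rw [hs.lt_iff h hs.omega_mem, LtC]
  simp

theorem psi_lt_omega (hs : Sys θ S L K) {a : M} (h : tPsi a ∈ S) : pr (tPsi a) (tOmega M) ∈ L := by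
  rw [hs.lt_iff h hs.omega_mem, LtC]
  simp

theorem not_omega_lt (hs : Sys θ S L K) {b : M} (hb : b ∈ S) (h : SC b) : pr (tOmega M) b ∉ L := by
  rw [hs.lt_iff hs.omega_mem hb, LtC, gammaClause_iff]
  have h1 : ∀ e f, b ≠ tPlus e f := fun e f => h.ne_plus
  have h2 : ∀ e f, b ≠ tPhi e f := fun e f => h.ne_phi
  simp [h1, h2]

theorem not_psi_lt_gamma (hs : Sys θ S L K) {a x : M} (h : tPsi a ∈ S) (h' : tGamma x ∈ S) :
    pr (tPsi a) (tGamma x) ∉ L := by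
  rw [hs.lt_iff h h', LtC, gammaClause_iff]
  simp

/-- A term is `0`, strongly critical, a sum or of the form `φ a b`. -/
theorem cases_kind (hs : Sys θ S L K) {s : M} (h : s ∈ S) : s = tZero M ∨ SC s ∨
    (∃ a b, a ∈ S ∧ b ∈ S ∧ s = tPlus a b) ∨ (∃ a b, a ∈ S ∧ b ∈ S ∧ s = tPhi a b) := by
  rcases hs.cases h with rfl | rfl | ⟨x, -, rfl⟩ | ⟨a, b, ha, hb, -, rfl⟩ | ⟨a, b, ha, hb, -, rfl⟩ |
    ⟨a, ha, -, rfl⟩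
  · exact .inl rfl
  · exact .inr (.inl sc_omega)
  · exact .inr (.inl sc_gamma)
  · exact .inr (.inr (.inl ⟨a, b, ha, hb, rfl⟩))
  · exact .inr (.inr (.inr ⟨a, b, ha, hb, rfl⟩))
  · exact .inr (.inl sc_psi)

theorem cases_sc (hs : Sys θ S L K) {s : M} (h : s ∈ S) (hA : SC s) : s = tOmega M ∨
    (∃ x, (x ∈ θ ∨ x = θ) ∧ s = tGamma x) ∨ (∃ a, a ∈ S ∧ PsiNF S L K a ∧ s = tPsi a) := by
  rcases hs.cases h with rfl | h | h | ⟨a, b, ha, hb, -, rfl⟩ | ⟨a, b, ha, hb, -, rfl⟩ | h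
  · exact absurd hA sc_zero
  · exact .inl h
  · exact .inr (.inl h)
  · exact absurd hA sc_plus
  · exact absurd hA sc_phi
  · exact .inr (.inr h)

theorem tag_zero_or_ap_or_plus (hs : Sys θ S L K) {s : M} (h : s ∈ S) : s = tZero M ∨ AP s ∨
    (∃ a b, a ∈ S ∧ b ∈ S ∧ s = tPlus a b) := by
  rcases hs.cases_kind h with h | h | h | ⟨a, b, -, -, rfl⟩
  · exact .inl h
  · exact .inr (.inl h.ap)
  · exact .inr (.inr h)
  · exact .inr (.inl ap_phi)

/-! ### The order is linear -/

/-- Nested induction on two terms. -/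
theorem induction₂ {P : M → M → Prop} (h : Def M (fun p : (Unit × M) × M => P p.1.2 p.2))
    (H : ∀ a ∈ S, ∀ b ∈ S, (∀ a' ∈ S, Sub a' a → ∀ b ∈ S, P a' b) →
      (∀ b' ∈ S, Sub b' b → P a b') → P a b) : ∀ a ∈ S, ∀ b ∈ S, P a b := by
  have hD := fun {X : Type} [Ctx M X] (f g : X → M) [DefFun M f] [DefFun M g] =>
    Def.comp₂ (R := P) h f g
  refine fun a => sub_induction (P := fun a => a ∈ S → ∀ b ∈ S, P a b) (fun a iha ha b => ?_) a
  refine sub_induction (P := fun b => b ∈ S → P a b) (fun b ihb hb => ?_) b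
  exact H a ha b hb (fun a' h1 h2 => iha a' h2 h1) (fun b' h1 h2 => ihb b' h2 h1)

theorem induction₃ {P : M → M → M → Prop}
    (h : Def M (fun p : ((Unit × M) × M) × M => P p.1.1.2 p.1.2 p.2))
    (H : ∀ a ∈ S, ∀ b ∈ S, ∀ c ∈ S, (∀ a' ∈ S, Sub a' a → ∀ b ∈ S, ∀ c ∈ S, P a' b c) →
      (∀ b' ∈ S, Sub b' b → ∀ c ∈ S, P a b' c) → (∀ c' ∈ S, Sub c' c → P a b c') → P a b c) :
    ∀ a ∈ S, ∀ b ∈ S, ∀ c ∈ S, P a b c := by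
  have hD := fun {X : Type} [Ctx M X] (f g k : X → M) [DefFun M f] [DefFun M g] [DefFun M k] =>
    Def.comp₃ (R := P) h f g k
  refine fun a => sub_induction (P := fun a => a ∈ S → ∀ b ∈ S, ∀ c ∈ S, P a b c)
    (fun a iha ha => ?_) a
  refine fun b => sub_induction (P := fun b => b ∈ S → ∀ c ∈ S, P a b c) (fun b ihb hb => ?_) b
  refine fun c => sub_induction (P := fun c => c ∈ S → P a b c) (fun c ihc hc => ?_) c
  exact H a ha b hb c hc (fun a' h1 h2 => iha a' h2 h1) (fun b' h1 h2 => ihb b' h2 h1)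
    (fun c' h1 h2 => ihc c' h2 h1)

/-- Nested induction on the two terms. Each pair of opposite inequalities reduces, by the clauses,
to opposite inequalities in which a component replaces one of the terms. -/
theorem asymm (hs : Sys θ S L K) {a b : M} (ha : a ∈ S) (hb : b ∈ S) (h : pr a b ∈ L) :
    pr b a ∉ L := by
  refine not_and.1 (induction₂ (S := S) (P := fun a b => ¬ (pr a b ∈ L ∧ pr b a ∈ L))
    inferInstance (fun a ha b hb iha ihb => ?_) a ha b hb) h
  rintro ⟨h1, h2⟩
  rcases hs.cases_kind ha with rfl | hA | ⟨c, d, hc, hd, rfl⟩ | ⟨c, d, hc, hd, rfl⟩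
  · exact hs.not_lt_zero hb h2
  · rcases hs.cases_kind hb with rfl | hB | ⟨e, f, he, hf, rfl⟩ | ⟨e, f, he, hf, rfl⟩
    · exact hs.not_lt_zero ha h1
    · rcases hs.cases_sc ha hA with rfl | ⟨x, hx, rfl⟩ | ⟨c, hc, -, rfl⟩
      · exact hs.not_omega_lt hb hB h1
      · rcases hs.cases_sc hb hB with rfl | ⟨y, hy, rfl⟩ | ⟨d, hd, -, rfl⟩
        · exact hs.not_omega_lt ha hA h2
        · rw [hs.gamma_lt_gamma ha hb] at h1
          rw [hs.gamma_lt_gamma hb ha] at h2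
          exact mem_asymm h1 h2
        · exact hs.not_psi_lt_gamma hb ha h2
      · rcases hs.cases_sc hb hB with rfl | ⟨y, hy, rfl⟩ | ⟨d, hd, -, rfl⟩
        · exact hs.not_omega_lt ha hA h2
        · exact hs.not_psi_lt_gamma ha hb h1
        · rw [hs.psi_lt_psi ha hb] at h1
          rw [hs.psi_lt_psi hb ha] at h2
          exact iha c hc (sub_psi c) d hd ⟨h1, h2⟩
    · rw [hs.lt_plus hb ha hA.ap] at h1
      rw [hs.plus_lt hb ha hA.ap] at h2
      have := ihb e he (sub_plus_left e f)
      rcases h1 with h1 | rfl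
      · exact this ⟨h1, h2⟩
      · exact this ⟨h2, h2⟩
    · rw [hs.lt_phi hb ha hA] at h1
      rw [hs.phi_lt hb ha hA] at h2
      have := ihb e he (sub_phi_left e f)
      have := ihb f hf (sub_phi_right e f)
      clear iha ihb
      unfold Le at h1
      grind
  · rcases hs.tag_zero_or_ap_or_plus hb with rfl | hB | ⟨e, f, he, hf, rfl⟩
    · exact hs.not_lt_zero ha h1
    · rw [hs.plus_lt ha hb hB] at h1
      rw [hs.lt_plus ha hb hB] at h2
      have := iha c hc (sub_plus_left c d) b hb
      rcases h2 with h2 | rfl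
      · exact this ⟨h1, h2⟩
      · exact this ⟨h1, h1⟩
    · rw [hs.plus_lt_plus ha hb] at h1
      rw [hs.plus_lt_plus hb ha] at h2
      have := iha c hc (sub_plus_left c d) e he
      have := iha d hd (sub_plus_right c d) f hf
      clear iha ihb
      grind
  · rcases hs.cases_kind hb with rfl | hB | ⟨e, f, he, hf, rfl⟩ | ⟨e, f, he, hf, rfl⟩
    · exact hs.not_lt_zero ha h1
    · rw [hs.lt_phi ha hb hB] at h2
      rw [hs.phi_lt ha hb hB] at h1
      have := iha c hc (sub_phi_left c d) b hb
      have := iha d hd (sub_phi_right c d) b hb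
      clear iha ihb
      unfold Le at h2
      grind
    · rw [hs.lt_plus hb ha ap_phi] at h1
      rw [hs.plus_lt hb ha ap_phi] at h2
      have := ihb e he (sub_plus_left e f)
      rcases h1 with h1 | rfl
      · exact this ⟨h1, h2⟩
      · exact this ⟨h2, h2⟩
    · rw [hs.phi_lt_phi ha hb] at h1
      rw [hs.phi_lt_phi hb ha] at h2
      have := iha c hc (sub_phi_left c d) e he
      have := iha d hd (sub_phi_right c d) f hf
      have := iha d hd (sub_phi_right c d) _ hb
      have := ihb f hf (sub_phi_right e f)
      clear iha ihb
      grind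

theorem irrefl (hs : Sys θ S L K) {a : M} (ha : a ∈ S) : pr a a ∉ L := fun h => hs.asymm ha ha h h

/-- The normal form condition for `φ c (φ e f)`. -/
theorem le_of_phi_phi (hs : Sys θ S L K) {c e f : M} (h : tPhi c (tPhi e f) ∈ S) : Le L e c := by
  obtain ⟨hc, hd, o, -, rfl, h⟩ := hs.phi_mem.1 h
  obtain ⟨he, hf, o, -, rfl, h'⟩ := hs.phi_mem.1 hd
  rcases h with ⟨-, -, h⟩ | ⟨hz, hlt⟩
  · rcases h with h | h | h | ⟨e', -, f', -, h, hle⟩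
    · simp at h
    · simp at h
    · simp at h
    · obtain ⟨rfl, rfl⟩ := tPhi_inj.1 h
      exact hle
  -- Here `c = 0` and `Ω ≺ φ e f`. The latter excludes the case `e, f ≺ Ω`, so `e = 0` as well.
  · rw [hs.lt_phi hd hs.omega_mem sc_omega] at hlt
    rcases h' with ⟨h1, h2, -⟩ | ⟨h1, -⟩
    · rcases hlt with (h | rfl) | (h | rfl)
      · exact absurd h (hs.asymm he hs.omega_mem h1)
      · exact absurd h1 (hs.irrefl he)
      · exact absurd h (hs.asymm hf hs.omega_mem h2)
      · exact absurd h2 (hs.irrefl hf)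
    · exact .inr ((hs.eq_zero he h1).trans (hs.eq_zero hc hz).symm)

theorem total (hs : Sys θ S L K) (hθ : Ord θ) {a b : M} (ha : a ∈ S) (hb : b ∈ S) :
    pr a b ∈ L ∨ a = b ∨ pr b a ∈ L := by
  refine induction₂ (S := S) (P := fun a b => pr a b ∈ L ∨ a = b ∨ pr b a ∈ L)
    inferInstance (fun a ha b hb iha ihb => ?_) a ha b hb
  rcases hs.cases_kind ha with rfl | hA | ⟨c, d, hc, hd, rfl⟩ | ⟨c, d, hc, hd, rfl⟩
  · by_cases h : Tag 0 b
    · exact .inr (.inl (hs.eq_zero hb h).symm)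
    · exact .inl (hs.zero_lt hb h)
  · rcases hs.cases_kind hb with rfl | hB | ⟨e, f, he, hf, rfl⟩ | ⟨e, f, he, hf, rfl⟩
    · exact .inr (.inr (hs.zero_lt ha hA.ap.not_tag))
    · rcases hs.cases_sc ha hA with rfl | ⟨x, hx, rfl⟩ | ⟨c, hc, -, rfl⟩
      · rcases hs.cases_sc hb hB with rfl | ⟨y, hy, rfl⟩ | ⟨d, hd, -, rfl⟩
        · exact .inr (.inl rfl)
        · exact .inr (.inr (hs.gamma_lt_omega hb))
        · exact .inr (.inr (hs.psi_lt_omega hb))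
      · rcases hs.cases_sc hb hB with rfl | ⟨y, hy, rfl⟩ | ⟨d, hd, -, rfl⟩
        · exact .inl (hs.gamma_lt_omega ha)
        · rw [hs.gamma_lt_gamma ha hb, hs.gamma_lt_gamma hb ha, tGamma_inj]
          have ord : ∀ z, (z ∈ θ ∨ z = θ) → Ord z := by
            rintro z (hz | rfl)
            exacts [hθ.mem hz, hθ]
          exact Ord.trichotomy x (ord x hx) y (ord y hy)
        · exact .inl (hs.gamma_lt_psi ha hb)
      · rcases hs.cases_sc hb hB with rfl | ⟨y, hy, rfl⟩ | ⟨d, hd, -, rfl⟩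
        · exact .inl (hs.psi_lt_omega ha)
        · exact .inr (.inr (hs.gamma_lt_psi hb ha))
        · rw [hs.psi_lt_psi ha hb, hs.psi_lt_psi hb ha, tPsi_inj]
          exact iha c hc (sub_psi c) d hd
    · rw [hs.lt_plus hb ha hA.ap, hs.plus_lt hb ha hA.ap]
      rcases ihb e he (sub_plus_left e f) with h | h | h
      exacts [.inl (.inl h), .inl (.inr h), .inr (.inr h)]
    · rw [hs.lt_phi hb ha hA, hs.phi_lt hb ha hA]
      have := ihb e he (sub_phi_left e f)
      have := ihb f hf (sub_phi_right e f)
      clear iha ihb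
      unfold Le
      grind
  · rcases hs.tag_zero_or_ap_or_plus hb with rfl | hB | ⟨e, f, he, hf, rfl⟩
    · exact .inr (.inr (hs.zero_lt ha (by simp)))
    · rw [hs.plus_lt ha hb hB, hs.lt_plus ha hb hB]
      rcases iha c hc (sub_plus_left c d) b hb with h | h | h
      exacts [.inl h, .inr (.inr (.inr h.symm)), .inr (.inr (.inl h))]
    · rw [hs.plus_lt_plus ha hb, hs.plus_lt_plus hb ha, tPlus_inj]
      have := iha c hc (sub_plus_left c d) e he
      have := iha d hd (sub_plus_right c d) f hf
      clear iha ihb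
      grind
  · rcases hs.cases_kind hb with rfl | hB | ⟨e, f, he, hf, rfl⟩ | ⟨e, f, he, hf, rfl⟩
    · exact .inr (.inr (hs.zero_lt ha (by simp)))
    · rw [hs.lt_phi ha hb hB, hs.phi_lt ha hb hB]
      have := iha c hc (sub_phi_left c d) b hb
      have := iha d hd (sub_phi_right c d) b hb
      clear iha ihb
      unfold Le
      grind
    · rw [hs.lt_plus hb ha ap_phi, hs.plus_lt hb ha ap_phi]
      rcases ihb e he (sub_plus_left e f) with h | h | h
      exacts [.inl (.inl h), .inl (.inr h), .inr (.inr h)]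
    · rw [hs.phi_lt_phi ha hb, hs.phi_lt_phi hb ha, tPhi_inj]
      rcases iha c hc (sub_phi_left c d) e he with h | rfl | h
      · rcases iha d hd (sub_phi_right c d) _ hb with h' | rfl | h'
        · exact .inl (.inl ⟨h, h'⟩)
        -- If `c ≺ e` and `d = φ e f`, no clause compares `φ c d` with `d`; the normal form
        -- condition `e ≼ c` rules the case out.
        · rcases hs.le_of_phi_phi ha with h' | rfl
          · exact absurd h' (hs.asymm hc he h)
          · exact absurd h (hs.irrefl hc)
        · exact .inr (.inr (.inr (.inr ⟨h, h'⟩)))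
      · rcases iha d hd (sub_phi_right c d) f hf with h' | rfl | h'
        · exact .inl (.inr (.inl ⟨rfl, h'⟩))
        · exact .inr (.inl ⟨rfl, rfl⟩)
        · exact .inr (.inr (.inr (.inl ⟨rfl, h'⟩)))
      · rcases ihb f hf (sub_phi_right e f) with h' | rfl | h'
        · exact .inl (.inr (.inr ⟨h, h'⟩))
        · rcases hs.le_of_phi_phi hb with h' | rfl
          · exact absurd h' (hs.asymm he hc h)
          · exact absurd h (hs.irrefl hc)
        · exact .inr (.inr (.inl ⟨h, h'⟩))

end Sys

end Order

end KPSet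

namespace KPSet

section Order

variable {M : Type} [KPModel M] {θ S L K : M}

/-! ### Transitivity of the order and its consequences. -/

namespace Sys

theorem cases_ap (hs : Sys θ S L K) {s : M} (h : s ∈ S) (hA : AP s) :
    SC s ∨ ∃ a b, a ∈ S ∧ b ∈ S ∧ s = tPhi a b := by
  rcases hs.cases_kind h with rfl | h | ⟨a, b, ha, hb, rfl⟩ | h
  · exact absurd hA ap_zero
  · exact .inl h
  · exact absurd hA ap_plus
  · exact .inr h

theorem sc_trans (hs : Sys θ S L K) (hθ : Ord θ) {a b c : M} (ha : a ∈ S) (hb : b ∈ S) (hc : c ∈ S)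
    (hA : SC a) (hB : SC b) (hC : SC c)
    (ih : ∀ x y z, a = tPsi x → b = tPsi y → c = tPsi z → pr x y ∈ L → pr y z ∈ L → pr x z ∈ L)
    (h1 : pr a b ∈ L) (h2 : pr b c ∈ L) : pr a c ∈ L := by
  rcases hs.cases_sc ha hA with rfl | ⟨x, hx, rfl⟩ | ⟨x, hx, -, rfl⟩
  · exact absurd h1 (hs.not_omega_lt hb hB)
  · rcases hs.cases_sc hc hC with rfl | ⟨z, hz, rfl⟩ | ⟨z, hz, -, rfl⟩
    · exact hs.gamma_lt_omega ha
    · rcases hs.cases_sc hb hB with rfl | ⟨y, hy, rfl⟩ | ⟨y, hy, -, rfl⟩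
      · exact absurd h2 (hs.not_omega_lt hc hC)
      · rw [hs.gamma_lt_gamma ha hb] at h1
        rw [hs.gamma_lt_gamma hb hc] at h2
        rw [hs.gamma_lt_gamma ha hc]
        have : Ord z := by
          rcases hz with hz | rfl
          exacts [hθ.mem hz, hθ]
        exact this.trans h2 h1
      · exact absurd h2 (hs.not_psi_lt_gamma hb hc)
    · exact hs.gamma_lt_psi ha hc
  · rcases hs.cases_sc hc hC with rfl | ⟨z, hz, rfl⟩ | ⟨z, hz, -, rfl⟩
    · exact hs.psi_lt_omega ha
    · rcases hs.cases_sc hb hB with rfl | ⟨y, hy, rfl⟩ | ⟨y, hy, -, rfl⟩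
      · exact absurd h2 (hs.not_omega_lt hc hC)
      · exact absurd h1 (hs.not_psi_lt_gamma ha hb)
      · exact absurd h2 (hs.not_psi_lt_gamma hb hc)
    · rcases hs.cases_sc hb hB with rfl | ⟨y, hy, rfl⟩ | ⟨y, hy, -, rfl⟩
      · exact absurd h2 (hs.not_omega_lt hc hC)
      · exact absurd h1 (hs.not_psi_lt_gamma ha hb)
      · rw [hs.psi_lt_psi ha hb] at h1
        rw [hs.psi_lt_psi hb hc] at h2
        rw [hs.psi_lt_psi ha hc]
        exact ih x y z rfl rfl rfl h1 h2

/-- Nested induction on all three terms. For two outer terms of the form `φ`, linearity is used to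
compare their first arguments, which selects the clause to be proved. -/
theorem trans (hs : Sys θ S L K) (hθ : Ord θ) {a b c : M} (ha : a ∈ S) (hb : b ∈ S) (hc : c ∈ S)
    (h : pr a b ∈ L) (h' : pr b c ∈ L) : pr a c ∈ L := by
  refine induction₃ (S := S) (P := fun a b c => pr a b ∈ L → pr b c ∈ L → pr a c ∈ L)
    inferInstance (fun a ha b hb c hc iha ihb ihc h1 h2 => ?_) a ha b hb c hc h h'
  rcases hs.tag_zero_or_ap_or_plus hb with rfl | hB | ⟨b₁, b₂, hb₁, hb₂, rfl⟩
  · exact absurd h1 (hs.not_lt_zero ha)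
  · rcases hs.tag_zero_or_ap_or_plus hc with rfl | hC | ⟨c₁, c₂, hc₁, hc₂, rfl⟩
    · exact absurd h2 (hs.not_lt_zero hb)
    · rcases hs.tag_zero_or_ap_or_plus ha with rfl | hA | ⟨a₁, a₂, ha₁, ha₂, rfl⟩
      · exact hs.zero_lt hc hC.not_tag
      · rcases hs.cases_ap ha hA with hA | ⟨a₁, a₂, ha₁, ha₂, rfl⟩
        · rcases hs.cases_ap hb hB with hB | ⟨b₁, b₂, hb₁, hb₂, rfl⟩
          · rcases hs.cases_ap hc hC with hC | ⟨c₁, c₂, hc₁, hc₂, rfl⟩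
            · refine hs.sc_trans hθ ha hb hc hA hB hC ?_ h1 h2
              rintro x y z rfl rfl rfl
              exact iha x (hs.psi_mem.1 ha).1 (sub_psi x) y (hs.psi_mem.1 hb).1 z (hs.psi_mem.1 hc).1
            · rw [hs.lt_phi hc hb hB] at h2
              rw [hs.lt_phi hc ha hA]
              have := ihc c₁ hc₁ (sub_phi_left _ _) h1
              have := ihc c₂ hc₂ (sub_phi_right _ _) h1
              clear iha ihb ihc
              unfold Le at *
              grind
          · rw [hs.lt_phi hb ha hA] at h1
            rcases hs.cases_ap hc hC with hC | ⟨c₁, c₂, hc₁, hc₂, rfl⟩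
            · rw [hs.phi_lt hb hc hC] at h2
              have := ihb b₁ hb₁ (sub_phi_left _ _) c hc
              have := ihb b₂ hb₂ (sub_phi_right _ _) c hc
              clear iha ihb ihc
              unfold Le at *
              grind
            · have h1' := h1
              rw [← hs.lt_phi hb ha hA] at h1'
              rw [hs.phi_lt_phi hb hc] at h2
              have e1 := ihb b₁ hb₁ (sub_phi_left _ _) c₁ hc₁
              have e2 := ihb b₂ hb₂ (sub_phi_right _ _) _ hc
              have e3 := ihb b₂ hb₂ (sub_phi_right _ _) c₂ hc₂
              have e4 := ihc c₂ hc₂ (sub_phi_right _ _) h1'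
              have e5 := hs.lt_phi hc ha hA
              clear iha ihb ihc
              unfold Le at *
              grind
        · rcases hs.cases_ap hb hB with hB | ⟨b₁, b₂, hb₁, hb₂, rfl⟩
          · rw [hs.phi_lt ha hb hB] at h1
            rcases hs.cases_ap hc hC with hC | ⟨c₁, c₂, hc₁, hc₂, rfl⟩
            · rw [hs.phi_lt ha hc hC]
              exact ⟨iha a₁ ha₁ (sub_phi_left _ _) b hb c hc h1.1 h2,
                iha a₂ ha₂ (sub_phi_right _ _) b hb c hc h1.2 h2⟩
            · have h1' := h1
              have h2' := h2
              rw [← hs.phi_lt ha hb hB] at h1'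
              rw [hs.lt_phi hc hb hB] at h2
              rw [hs.phi_lt_phi ha hc]
              have e1 := iha a₁ ha₁ (sub_phi_left _ _) b hb c₁ hc₁ h1.1
              have e2 := iha a₂ ha₂ (sub_phi_right _ _) b hb _ hc h1.2 h2'
              have e3 := iha a₂ ha₂ (sub_phi_right _ _) b hb c₂ hc₂ h1.2
              have e4 := ihc c₂ hc₂ (sub_phi_right _ _) h1'
              have e5 := hs.total hθ ha₁ hc₁
              clear iha ihb ihc
              unfold Le at *
              grind
          · rcases hs.cases_ap hc hC with hC | ⟨c₁, c₂, hc₁, hc₂, rfl⟩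
            · have h2' := h2
              rw [hs.phi_lt_phi ha hb] at h1
              rw [hs.phi_lt hb hc hC] at h2
              rw [hs.phi_lt ha hc hC]
              have e1 := iha a₁ ha₁ (sub_phi_left _ _) b₁ hb₁ c hc
              have e2 := iha a₂ ha₂ (sub_phi_right _ _) _ hb c hc
              have e3 := iha a₂ ha₂ (sub_phi_right _ _) b₂ hb₂ c hc
              have e4 := ihb b₂ hb₂ (sub_phi_right _ _) c hc
              have e5 := hs.phi_lt ha hc hC
              clear iha ihb ihc
              grind
            · have h1' := h1
              have h2' := h2
              rw [hs.phi_lt_phi ha hb] at h1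
              rw [hs.phi_lt_phi hb hc] at h2
              rw [hs.phi_lt_phi ha hc]
              have e1 := iha a₁ ha₁ (sub_phi_left _ _) b₁ hb₁ c₁ hc₁
              have e2 := iha a₂ ha₂ (sub_phi_right _ _) _ hb _ hc
              have e3 := iha a₂ ha₂ (sub_phi_right _ _) b₂ hb₂ c₂ hc₂
              have e4 := iha a₂ ha₂ (sub_phi_right _ _) _ hb c₂ hc₂
              have e5 := iha a₂ ha₂ (sub_phi_right _ _) b₂ hb₂ _ hc
              have e6 := ihb b₂ hb₂ (sub_phi_right _ _) c₂ hc₂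
              have e7 := ihb b₂ hb₂ (sub_phi_right _ _) _ hc
              have e8 := ihc c₂ hc₂ (sub_phi_right _ _) h1'
              have e9 := hs.total hθ ha₁ hc₁
              have e10 := hs.phi_lt_phi ha hc
              have e11 := iha a₁ ha₁ (sub_phi_left _ _) c₁ hc₁ b₁ hb₁
              have e12 := hs.asymm ha₁ hb₁
              clear iha ihb ihc
              grind
      · rw [hs.plus_lt ha hb hB] at h1
        rw [hs.plus_lt ha hc hC]
        exact iha a₁ ha₁ (sub_plus_left _ _) b hb c hc h1 h2
    · rw [hs.lt_plus hc hb hB] at h2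
      rcases hs.tag_zero_or_ap_or_plus ha with rfl | hA | ⟨a₁, a₂, ha₁, ha₂, rfl⟩
      · exact hs.zero_lt hc (by simp)
      · rw [hs.lt_plus hc ha hA]
        rcases h2 with h2 | rfl
        · exact .inl (ihc c₁ hc₁ (sub_plus_left _ _) h1 h2)
        · exact .inl h1
      · rw [hs.plus_lt ha hb hB] at h1
        rw [hs.plus_lt_plus ha hc]
        rcases h2 with h2 | rfl
        · exact .inl (iha a₁ ha₁ (sub_plus_left _ _) b hb c₁ hc₁ h1 h2)
        · exact .inl h1
  · rcases hs.tag_zero_or_ap_or_plus hc with rfl | hC | ⟨c₁, c₂, hc₁, hc₂, rfl⟩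
    · exact absurd h2 (hs.not_lt_zero hb)
    · rw [hs.plus_lt hb hc hC] at h2
      rcases hs.tag_zero_or_ap_or_plus ha with rfl | hA | ⟨a₁, a₂, ha₁, ha₂, rfl⟩
      · exact hs.zero_lt hc hC.not_tag
      · rw [hs.lt_plus hb ha hA] at h1
        rcases h1 with h1 | rfl
        · exact ihb b₁ hb₁ (sub_plus_left _ _) c hc h1 h2
        · exact h2
      · rw [hs.plus_lt_plus ha hb] at h1
        rw [hs.plus_lt ha hc hC]
        rcases h1 with h1 | ⟨rfl, h1⟩
        · exact iha a₁ ha₁ (sub_plus_left _ _) b₁ hb₁ c hc h1 h2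
        · exact h2
    · rw [hs.plus_lt_plus hb hc] at h2
      rcases hs.tag_zero_or_ap_or_plus ha with rfl | hA | ⟨a₁, a₂, ha₁, ha₂, rfl⟩
      · exact hs.zero_lt hc (by simp)
      · rw [hs.lt_plus hb ha hA] at h1
        rw [hs.lt_plus hc ha hA]
        have := ihb b₁ hb₁ (sub_plus_left _ _) c₁ hc₁
        clear iha ihb ihc
        unfold Le at *
        grind
      · rw [hs.plus_lt_plus ha hb] at h1
        rw [hs.plus_lt_plus ha hc]
        have := iha a₁ ha₁ (sub_plus_left _ _) b₁ hb₁ c₁ hc₁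
        have := iha a₂ ha₂ (sub_plus_right _ _) b₂ hb₂ c₂ hc₂
        clear iha ihb ihc
        grind

theorem le_trans (hs : Sys θ S L K) (hθ : Ord θ) {a b c : M} (ha : a ∈ S) (hb : b ∈ S) (hc : c ∈ S)
    (h1 : Le L a b) (h2 : Le L b c) : Le L a c := by
  rcases h1 with h1 | rfl
  · rcases h2 with h2 | rfl
    · exact .inl (hs.trans hθ ha hb hc h1 h2)
    · exact .inl h1
  · exact h2

theorem lt_of_le_of_lt (hs : Sys θ S L K) (hθ : Ord θ) {a b c : M} (ha : a ∈ S) (hb : b ∈ S)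
    (hc : c ∈ S) (h1 : Le L a b) (h2 : pr b c ∈ L) : pr a c ∈ L := by
  rcases h1 with h1 | rfl
  · exact hs.trans hθ ha hb hc h1 h2
  · exact h2

theorem lt_of_lt_of_le (hs : Sys θ S L K) (hθ : Ord θ) {a b c : M} (ha : a ∈ S) (hb : b ∈ S)
    (hc : c ∈ S) (h1 : pr a b ∈ L) (h2 : Le L b c) : pr a c ∈ L := by
  rcases h2 with h2 | rfl
  · exact hs.trans hθ ha hb hc h1 h2
  · exact h1

/-- The second summand of a term below an additive principal term is below that term. -/
theorem right_lt (hs : Sys θ S L K) (hθ : Ord θ) {a b q : M} (h : tPlus a b ∈ S) (hq : q ∈ S)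
    (hA : AP q) (hlt : pr a q ∈ L) : pr b q ∈ L := by
  obtain ⟨ha, hb, -, ⟨-, hle⟩ | ⟨c, hc, d, hd, rfl, hle⟩⟩ := hs.plus_mem.1 h
  · exact hs.lt_of_le_of_lt hθ hb ha hq hle hlt
  · rw [hs.plus_lt hb hq hA]
    exact hs.lt_of_le_of_lt hθ hc ha hq hle hlt

end Sys

end Order

end KPSet

namespace KPSet

section Accessible

variable {M : Type} [KPModel M] {X : Type} [Ctx M X] {θ S L K : M}

/-! ### Order preserving functions onto initial segments -/

set_option synthInstance.maxHeartbeats 400000 in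
set_option synthInstance.maxSize 4096 in
instance D0.orderEmb (S L : M) (f g : X → M) [IsVar M f] [IsVar M g] :
    D0 M (fun x => OrderEmb S L (f x) (g x)) := by
  refine D0.comp₂ (R := fun a b => OrderEmb S L a b) ?_ f g
  unfold OrderEmb
  infer_instance

instance D0.le (L : M) (f g : X → M) [IsVar M f] [IsVar M g] :
    D0 M (fun x => Le L (f x) (g x)) := by
  unfold Le
  infer_instance

instance Def.initSegLe (S L : M) (f : X → M) [DefFun M f] :
    Def M (fun x => InitSegLe S L (f x)) := by
  refine Def.comp₁ (R := fun a => InitSegLe S L a) ?_ f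
  have h : D0 M (fun p : ((Unit × M) × M) × M => OrderEmb S L p.1.2 p.2 ∧
      ∀ b ∈ S, (∃ x ∈ p.1.2, pr x b ∈ p.2) ↔ Le L b p.1.1.2) := inferInstance
  have := h.def
  unfold InitSegLe
  infer_instance

instance Def.acc (S L : M) (f : X → M) [DefFun M f] : Def M (fun x => Acc S L (f x)) := by
  refine Def.comp₁ (R := fun a => Acc S L a) ?_ f
  have h : D0 M (fun p : Unit × M => ∃ o ∈ S, o = tOmega M ∧ pr p.2 o ∈ L) := inferInstance
  have := h.def
  unfold Acc
  infer_instance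

instance defFun_tPlus (f g : X → M) [DefFun M f] [DefFun M g] :
    DefFun M (fun x => tPlus (f x) (g x)) :=
  (inferInstance : DefFun M (fun x => code 3 (pr (f x) (g x))))

instance defFun_tPhi (f g : X → M) [DefFun M f] [DefFun M g] :
    DefFun M (fun x => tPhi (f x) (g x)) :=
  (inferInstance : DefFun M (fun x => code 4 (pr (f x) (g x))))

instance defFun_tPsi (f : X → M) [DefFun M f] : DefFun M (fun x => tPsi (f x)) :=
  (inferInstance : DefFun M (fun x => code 5 (f x)))

instance defFun_tGamma (f : X → M) [DefFun M f] : DefFun M (fun x => tGamma (f x)) :=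
  (inferInstance : DefFun M (fun x => code 2 (f x)))

theorem OrderEmb.dom {α f x y : M} (h : OrderEmb S L α f) (hp : pr x y ∈ f) : x ∈ α ∧ y ∈ S := by
  obtain ⟨x', hx, y', hy, e⟩ := h.2.1 _ hp
  obtain ⟨rfl, rfl⟩ := pr_inj.1 e
  exact ⟨hx, hy⟩

theorem OrderEmb.unique {α f x y z : M} (h : OrderEmb S L α f) (h1 : pr x y ∈ f) (h2 : pr x z ∈ f) :
    y = z :=
  h.2.2.2.1 x (h.dom h1).1 y (h.dom h1).2 z (h.dom h2).2 ⟨h1, h2⟩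

theorem OrderEmb.lt {α f x y z w : M} (h : OrderEmb S L α f) (hxy : x ∈ y) (h1 : pr x z ∈ f)
    (h2 : pr y w ∈ f) : pr z w ∈ L :=
  h.2.2.2.2 x (h.dom h1).1 y (h.dom h2).1 z (h.dom h1).2 w (h.dom h2).2 ⟨hxy, h1, h2⟩

theorem OrderEmb.reflect {α f x y z w : M} (h : OrderEmb S L α f) (hs : Sys θ S L K)
    (h1 : pr x z ∈ f) (h2 : pr y w ∈ f) (hlt : pr z w ∈ L) : x ∈ y := by
  rcases Ord.trichotomy x (h.1.mem (h.dom h1).1) y (h.1.mem (h.dom h2).1) with hxy | rfl | hxy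
  · exact hxy
  · obtain rfl := h.unique h1 h2
    exact absurd hlt (hs.irrefl (h.dom h1).2)
  · exact absurd hlt (hs.asymm (h.dom h2).2 (h.dom h1).2 (h.lt hxy h2 h1))

/-! ### Comparison of isomorphisms onto initial segments. -/

/-- `f` is an order preserving function from the ordinal `α` onto a downward closed part of `S`. -/
def InitEmb (S L α f : M) : Prop :=
  OrderEmb S L α f ∧ ∀ x y z : M, pr x y ∈ f → z ∈ S → pr z y ∈ L → ∃ w, pr w z ∈ f

/-- By `∈`-induction on the position `x` of `y`: its elements are the positions of the terms below
`y`, and both ranges contain all of these terms. Thus a term has the same position in every such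
function. -/
theorem InitEmb.coherent (hs : Sys θ S L K) {α f β g : M} (hf : InitEmb S L α f)
    (hg : InitEmb S L β g) (x : M) : ∀ x' y : M, pr x y ∈ f → pr x' y ∈ g → x = x' := by
  refine set_induction (P := fun x => ∀ x' y : M, pr x y ∈ f → pr x' y ∈ g → x = x')
    (fun x ih x' y h1 h2 => ?_) x
  refine KPModel.ext fun w => ⟨fun hw => ?_, fun hw => ?_⟩
  · obtain ⟨z, hz, hwz⟩ := hf.1.2.2.1 w (hf.1.1.trans (hf.1.dom h1).1 hw)
    have hlt := hf.1.lt hw hwz h1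
    obtain ⟨w', hw'⟩ := hg.2 x' y z h2 hz hlt
    rw [ih w hw w' z hwz hw']
    exact hg.1.reflect hs hw' h2 hlt
  · obtain ⟨z, hz, hwz⟩ := hg.1.2.2.1 w (hg.1.1.trans (hg.1.dom h2).1 hw)
    have hlt := hg.1.lt hw hwz h2
    obtain ⟨w', hw'⟩ := hf.2 x y z h1 hz hlt
    have hx := hf.1.reflect hs hw' h1 hlt
    rwa [← ih w' hx w z hw' hwz]

theorem InitEmb.lt (hs : Sys θ S L K) (hθ : Ord θ) {α f β g x y z w : M} (hf : InitEmb S L α f)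
    (hg : InitEmb S L β g) (hxy : x ∈ y) (h1 : pr x z ∈ f) (h2 : pr y w ∈ g) : pr z w ∈ L := by
  rcases hs.total hθ (hf.1.dom h1).2 (hg.1.dom h2).2 with h | rfl | h
  · exact h
  · obtain rfl := hf.coherent hs hg x y z h1 h2
    exact absurd hxy (notMem_self x)
  · obtain ⟨y', hy'⟩ := hf.2 x z w h1 (hg.1.dom h2).2 h
    obtain rfl := hf.coherent hs hg y' y w hy' h2
    exact absurd (hf.1.reflect hs hy' h1 h) (mem_asymm hxy)

theorem InitEmb.unique (hs : Sys θ S L K) (hθ : Ord θ) {α f β g x y z : M} (hf : InitEmb S L α f)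
    (hg : InitEmb S L β g) (h1 : pr x y ∈ f) (h2 : pr x z ∈ g) : y = z := by
  rcases hs.total hθ (hf.1.dom h1).2 (hg.1.dom h2).2 with h | rfl | h
  · obtain ⟨w, hw⟩ := hg.2 x z y h2 (hf.1.dom h1).2 h
    obtain rfl := hf.coherent hs hg x w y h1 hw
    exact absurd (hg.1.reflect hs hw h2 h) (notMem_self x)
  · rfl
  · obtain ⟨w, hw⟩ := hf.2 x y z h1 (hg.1.dom h2).2 h
    obtain rfl := hf.coherent hs hg w x z hw h2
    exact absurd (hf.1.reflect hs hw h1 h) (notMem_self w)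

/-- `f` is an order preserving function from the ordinal `α` onto `{b | b ≼ p}`. -/
def EmbLe (S L α f p : M) : Prop :=
  OrderEmb S L α f ∧ ∀ b ∈ S, (∃ x ∈ α, pr x b ∈ f) ↔ Le L b p

theorem EmbLe.initEmb {α f p : M} (h : EmbLe S L α f p) (hs : Sys θ S L K) (hθ : Ord θ)
    (hp : p ∈ S) : InitEmb S L α f := by
  refine ⟨h.1, fun x y z hy hz hlt => ?_⟩
  obtain ⟨hx, hyS⟩ := h.1.dom hy
  have := (h.2 y hyS).1 ⟨x, hx, hy⟩
  obtain ⟨w, -, hw⟩ := (h.2 z hz).2 (.inl (hs.lt_of_lt_of_le hθ hz hyS hp hlt this))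
  exact ⟨w, hw⟩

/-- The initial segment below `a` is isomorphic to an ordinal if the smaller ones are. -/
theorem initSegLt_of_forall (hs : Sys θ S L K) (hθ : Ord θ) {a : M}
    (H : ∀ b ∈ S, pr b a ∈ L → InitSegLe S L b) (ha : a ∈ S) : InitSegLt S L a := by
  have inst : ∀ {Y : Type} [Ctx M Y] (f g k : Y → M) [IsVar M f] [IsVar M g] [IsVar M k],
      D0 M (fun x => EmbLe S L (f x) (g x) (k x)) := by
    intro Y _ f g k _ _ _
    refine D0.comp₃ (R := fun a b c => EmbLe S L a b c) ?_ f g k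
    unfold EmbLe
    infer_instance
  obtain ⟨A, hA⟩ := exists_sep (fun b : M => pr b a ∈ L) S
  -- Collection provides one witness for each `b`, so the ordinal and the function are packed into a
  -- pair and unpacked by bounded quantifiers.
  obtain ⟨C, hC⟩ := exists_coll (fun b w : M => ∃ u ∈ w, ∃ α ∈ u, ∃ f ∈ u, EmbLe S L α f b) A
    (fun b hb => by
      obtain ⟨hb, hlt⟩ := (hA b).1 hb
      obtain ⟨α, f, h⟩ := H b hb hlt
      obtain ⟨u, hu, h1, h2⟩ := mem_mem_pr α f
      exact ⟨pr α f, u, hu, α, h1, f, h2, h⟩)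
  -- The components of the collected pairs are found two levels down, in `U`, and the elements of
  -- these components are in `V`.
  obtain ⟨U', hU'⟩ := exists_sUnion C
  obtain ⟨U, hU⟩ := exists_sUnion U'
  obtain ⟨V, hV⟩ := exists_sUnion U
  -- The new ordinal `D` and the new function `G` are the unions of all ordinals and functions in
  -- `U` that form an isomorphism for some `b ≺ a`. By coherence the choice among several
  -- isomorphisms for one `b` does not matter.
  obtain ⟨D, hD⟩ := exists_sep
    (fun x : M => ∃ b ∈ A, ∃ α ∈ U, ∃ f ∈ U, EmbLe S L α f b ∧ x ∈ α) V
  obtain ⟨G, hG⟩ := exists_sep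
    (fun x : M => ∃ b ∈ A, ∃ α ∈ U, ∃ f ∈ U, EmbLe S L α f b ∧ x ∈ f) V
  have key : ∀ b ∈ A, ∃ α ∈ U, ∃ f ∈ U, EmbLe S L α f b := by
    intro b hb
    obtain ⟨w, hw, u, hu, α, hα, f, hf, h⟩ := hC b hb
    have : u ∈ U' := (hU' u).2 ⟨w, hw, hu⟩
    exact ⟨α, (hU α).2 ⟨u, this, hα⟩, f, (hU f).2 ⟨u, this, hf⟩, h⟩
  have hD' : ∀ x, x ∈ D ↔ ∃ b ∈ A, ∃ α ∈ U, ∃ f ∈ U, EmbLe S L α f b ∧ x ∈ α := by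
    refine fun x => (hD x).trans ⟨fun h => h.2, fun h => ⟨?_, h⟩⟩
    obtain ⟨b, -, α, hα, f, -, -, hx⟩ := h
    exact (hV x).2 ⟨α, hα, hx⟩
  have hG' : ∀ x, x ∈ G ↔ ∃ b ∈ A, ∃ α ∈ U, ∃ f ∈ U, EmbLe S L α f b ∧ x ∈ f := by
    refine fun x => (hG x).trans ⟨fun h => h.2, fun h => ⟨?_, h⟩⟩
    obtain ⟨b, -, α, -, f, hf, -, hx⟩ := h
    exact (hV x).2 ⟨f, hf, hx⟩
  refine ⟨D, G, ⟨fun y hy z hz => ?_, fun p hp => ?_, fun x hx => ?_, fun x _ y _ z _ h => ?_,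
    fun x _ y _ z _ w _ h => ?_⟩, fun b hb => ⟨?_, fun h => ?_⟩⟩
  · obtain ⟨b, hb, α, hα, f, hf, h, hyα⟩ := (hD' y).1 hy
    exact ⟨(hD' z).2 ⟨b, hb, α, hα, f, hf, h, h.1.1.trans hyα hz⟩,
      fun w hw => (h.1.1.mem hyα).trans hz hw⟩
  · obtain ⟨b, hb, α, hα, f, hf, h, hp⟩ := (hG' p).1 hp
    obtain ⟨x, hx, y, hy, rfl⟩ := h.1.2.1 p hp
    exact ⟨x, (hD' x).2 ⟨b, hb, α, hα, f, hf, h, hx⟩, y, hy, rfl⟩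
  · obtain ⟨b, hb, α, hα, f, hf, h, hx⟩ := (hD' x).1 hx
    obtain ⟨y, hy, hxy⟩ := h.1.2.2.1 x hx
    exact ⟨y, hy, (hG' _).2 ⟨b, hb, α, hα, f, hf, h, hxy⟩⟩
  · obtain ⟨b, hb, α, -, f, -, hf, h1⟩ := (hG' _).1 h.1
    obtain ⟨c, hc, β, -, g, -, hg, h2⟩ := (hG' _).1 h.2
    exact (hf.initEmb hs hθ ((hA b).1 hb).1).unique hs hθ (hg.initEmb hs hθ ((hA c).1 hc).1) h1 h2
  · obtain ⟨b, hb, α, -, f, -, hf, h1⟩ := (hG' _).1 h.2.1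
    obtain ⟨c, hc, β, -, g, -, hg, h2⟩ := (hG' _).1 h.2.2
    exact (hf.initEmb hs hθ ((hA b).1 hb).1).lt hs hθ (hg.initEmb hs hθ ((hA c).1 hc).1) h.1 h1 h2
  · rintro ⟨x, -, hx⟩
    obtain ⟨c, hc, α, -, f, -, hf, h⟩ := (hG' _).1 hx
    obtain ⟨hc, hca⟩ := (hA c).1 hc
    exact hs.lt_of_le_of_lt hθ hb hc ha ((hf.2 b hb).1 ⟨x, (hf.1.dom h).1, h⟩) hca
  · have hbA := (hA b).2 ⟨hb, h⟩
    obtain ⟨α, hα, f, hf, h⟩ := key b hbA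
    obtain ⟨x, hx, hxb⟩ := (h.2 b hb).2 (.inr rfl)
    exact ⟨x, (hD' x).2 ⟨b, hbA, α, hα, f, hf, h, hx⟩, (hG' _).2 ⟨b, hbA, α, hα, f, hf, h, hxb⟩⟩

/-- The function is prolonged by the value `a` at the argument `α`, so its new domain is `α + 1`. -/
theorem InitSegLt.initSegLe {a : M} (h : InitSegLt S L a) (ha : a ∈ S) : InitSegLe S L a := by
  obtain ⟨α, f, h, hr⟩ := h
  obtain ⟨g, hg⟩ := exists_union f (upair (pr α a) (pr α a))
  have hg' : ∀ x y, pr x y ∈ g ↔ pr x y ∈ f ∨ (x = α ∧ y = a) := fun x y => by simp [hg]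
  refine ⟨succ α, g, ⟨ord_succ h.1, fun p hp => ?_, fun x hx => ?_, fun x _ y _ z _ h' => ?_,
    fun x _ y _ z _ w _ h' => ?_⟩, fun b hb => ?_⟩
  · rcases (hg p).1 hp with hp | hp
    · obtain ⟨x, hx, y, hy, rfl⟩ := h.2.1 p hp
      exact ⟨x, mem_succ.2 (.inl hx), y, hy, rfl⟩
    · rw [mem_upair, or_self] at hp
      exact ⟨α, mem_succ.2 (.inr rfl), a, ha, hp⟩
  · rcases mem_succ.1 hx with hx | rfl
    · obtain ⟨y, hy, hxy⟩ := h.2.2.1 x hx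
      exact ⟨y, hy, (hg' _ _).2 (.inl hxy)⟩
    · exact ⟨a, ha, (hg' _ _).2 (.inr ⟨rfl, rfl⟩)⟩
  · rw [hg', hg'] at h'
    rcases h' with ⟨h1 | ⟨rfl, rfl⟩, h2 | ⟨h3, rfl⟩⟩
    · exact h.unique h1 h2
    · exact absurd (h3 ▸ (h.dom h1).1) (notMem_self _)
    · exact absurd (h.dom h2).1 (notMem_self _)
    · rfl
  · rw [hg', hg'] at h'
    rcases h' with ⟨hxy, h1 | ⟨rfl, rfl⟩, h2 | ⟨rfl, rfl⟩⟩
    · exact h.lt hxy h1 h2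
    · exact (hr z (h.dom h1).2).1 ⟨x, hxy, h1⟩
    · exact absurd (h.1.trans (h.dom h2).1 hxy) (notMem_self _)
    · exact absurd hxy (notMem_self _)
  · constructor
    · rintro ⟨x, -, hx⟩
      rcases (hg' _ _).1 hx with hx | ⟨-, rfl⟩
      · exact .inl ((hr b hb).1 ⟨x, (h.dom hx).1, hx⟩)
      · exact .inr rfl
    · rintro (hlt | rfl)
      · obtain ⟨x, hx, hxb⟩ := (hr b hb).2 hlt
        exact ⟨x, mem_succ.2 (.inl hx), (hg' _ _).2 (.inl hxb)⟩
      · exact ⟨α, mem_succ.2 (.inr rfl), (hg' _ _).2 (.inr ⟨rfl, rfl⟩)⟩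

/-! ### The accessible part -/

theorem Acc.lt_omega {a : M} (h : Acc S L a) : pr a (tOmega M) ∈ L := by
  obtain ⟨-, ⟨_, -, rfl, h⟩, -⟩ := h
  exact h

namespace Sys

/-- This closure property is the form in which Δ₀-collection enters the rest of the argument. -/
theorem acc_of_forall (hs : Sys θ S L K) (hθ : Ord θ) {a : M} (ha : a ∈ S)
    (hO : pr a (tOmega M) ∈ L) (H : ∀ b ∈ S, pr b a ∈ L → Acc S L b) : Acc S L a :=
  ⟨ha, ⟨_, hs.omega_mem, rfl, hO⟩,
    (initSegLt_of_forall hs hθ (fun b hb h => (H b hb h).2.2) ha).initSegLe ha⟩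

/-- No function is restricted: all values of the function for `a` are shown to be accessible by
induction on their position, using `acc_of_forall`. -/
theorem acc_le (hs : Sys θ S L K) (hθ : Ord θ) {a b : M} (ha : Acc S L a) (hb : b ∈ S)
    (hle : Le L b a) : Acc S L b := by
  obtain ⟨α, f, h⟩ := ha.2.2
  have hi : InitEmb S L α f := EmbLe.initEmb h hs hθ ha.1
  have key : ∀ x y : M, pr x y ∈ f → Acc S L y := by
    refine set_induction (P := fun x => ∀ y : M, pr x y ∈ f → Acc S L y) fun x ih y hxy => ?_
    obtain ⟨hx, hy⟩ := hi.1.dom hxy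
    refine hs.acc_of_forall hθ hy (hs.lt_of_le_of_lt hθ hy ha.1 hs.omega_mem
      ((h.2 y hy).1 ⟨x, hx, hxy⟩) ha.lt_omega) fun b hb hby => ?_
    obtain ⟨w, hw⟩ := hi.2 x y b hxy hb hby
    exact ih w (hi.1.reflect hs hw hxy hby) b hw
  obtain ⟨x, -, hx⟩ := (h.2 b hb).2 hle
  exact key x b hx

/-- Induction along `≺` is reduced to set induction on the position in the ordinal, so it is
available for every definable predicate. -/
theorem acc_induction (hs : Sys θ S L K) (hθ : Ord θ) {P : M → Prop}
    (hP : Def M (fun p : Unit × M => P p.2))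
    (H : ∀ a, Acc S L a → (∀ b ∈ S, pr b a ∈ L → P b) → P a) {a : M} (ha : Acc S L a) : P a := by
  have hD := fun {X : Type} [Ctx M X] (f : X → M) [DefFun M f] => Def.comp₁ (R := P) hP f
  obtain ⟨α, f, h⟩ := id ha.2.2
  have hi : InitEmb S L α f := EmbLe.initEmb h hs hθ ha.1
  have key : ∀ x y : M, pr x y ∈ f → P y := by
    refine set_induction (P := fun x => ∀ y : M, pr x y ∈ f → P y) fun x ih y hxy => ?_
    obtain ⟨hx, hy⟩ := hi.1.dom hxy
    refine H y (hs.acc_le hθ ha hy ((h.2 y hy).1 ⟨x, hx, hxy⟩)) fun b hb hby => ?_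
    obtain ⟨w, hw⟩ := hi.2 x y b hxy hb hby
    exact ih w (hi.1.reflect hs hw hxy hby) b hw
  obtain ⟨x, -, hx⟩ := (h.2 a ha.1).2 (.inr rfl)
  exact key x a hx

theorem acc_zero (hs : Sys θ S L K) (hθ : Ord θ) : Acc S L (tZero M) :=
  hs.acc_of_forall hθ hs.zero_mem (hs.zero_lt hs.omega_mem (by simp))
    fun b hb h => absurd h (hs.not_lt_zero hb)

/-- By induction on the accessible `b`: a term below `a + b` is either `≼ a` or a sum `a + d` with
`d ≺ b`. -/
theorem acc_plus (hs : Sys θ S L K) (hθ : Ord θ) {a b : M} (ha : Acc S L a) (hb : Acc S L b) :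
    tPlus a b ∈ S → Acc S L (tPlus a b) := by
  refine hs.acc_induction hθ (P := fun b => tPlus a b ∈ S → Acc S L (tPlus a b)) inferInstance
    (fun b _ ih h => ?_) hb
  have hA : AP a := (hs.plus_mem.1 h).2.2.1
  refine hs.acc_of_forall hθ h ((hs.plus_lt h hs.omega_mem ap_omega).2 ha.lt_omega)
    fun c hc hlt => ?_
  rcases hs.tag_zero_or_ap_or_plus hc with rfl | hC | ⟨c₁, c₂, hc₁, hc₂, rfl⟩
  · exact hs.acc_zero hθ
  · exact hs.acc_le hθ ha hc ((hs.lt_plus h hc hC).1 hlt)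
  · rcases (hs.plus_lt_plus hc h).1 hlt with h1 | ⟨rfl, h2⟩
    · exact hs.acc_le hθ ha hc (.inl ((hs.plus_lt hc ha.1 hA).2 h1))
    · exact ih c₂ hc₂ h2 hc

/-- Main induction on `a`, side induction on `b`, and inside both an induction on the build-up of
the terms below `φ a b`. The three clauses for `φ c d ≺ φ a b` use the main induction, the side
induction and the accessibility of `b`. -/
theorem acc_phi (hs : Sys θ S L K) (hθ : Ord θ) {a b : M} (ha : Acc S L a) (hb : Acc S L b) :
    tPhi a b ∈ S → Acc S L (tPhi a b) := by
  refine hs.acc_induction hθ (P := fun a => Acc S L a → ∀ b, Acc S L b → tPhi a b ∈ S →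
    Acc S L (tPhi a b)) inferInstance (fun a ha iha _ b hb => ?_) ha ha b hb
  refine hs.acc_induction hθ (P := fun b => Acc S L b → tPhi a b ∈ S → Acc S L (tPhi a b))
    inferInstance (fun b hb ihb _ h => ?_) hb hb
  refine hs.acc_of_forall hθ h ((hs.phi_lt h hs.omega_mem sc_omega).2 ⟨ha.lt_omega, hb.lt_omega⟩) ?_
  refine sub_induction (P := fun x => x ∈ S → pr x (tPhi a b) ∈ L → Acc S L x)
    (fun x ih hx hlt => ?_)
  rcases hs.cases_kind hx with rfl | hX | ⟨c, d, hc, hd, rfl⟩ | ⟨c, d, hc, hd, rfl⟩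
  · exact hs.acc_zero hθ
  · rcases (hs.lt_phi h hx hX).1 hlt with h1 | h1
    · exact hs.acc_le hθ ha hx h1
    · exact hs.acc_le hθ hb hx h1
  · rw [hs.plus_lt hx h ap_phi] at hlt
    exact hs.acc_plus hθ (ih c (sub_plus_left _ _) hc hlt)
      (ih d (sub_plus_right _ _) hd (hs.right_lt hθ hx h ap_phi hlt)) hx
  · rcases (hs.phi_lt_phi hx h).1 hlt with ⟨h1, h2⟩ | ⟨rfl, h2⟩ | ⟨h1, h2⟩
    · exact iha c hc h1 (hs.acc_le hθ ha hc (.inl h1)) d (ih d (sub_phi_right _ _) hd h2) hx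
    · exact ihb d hd h2 (hs.acc_le hθ hb hd (.inl h2)) hx
    · exact hs.acc_le hθ hb hx (.inl h2)

/-- Terms below a strongly critical term are accessible if the strongly critical ones are. -/
theorem acc_of_sc (hs : Sys θ S L K) (hθ : Ord θ) {p : M} (hp : p ∈ S) (hA : SC p)
    (H : ∀ b ∈ S, SC b → pr b p ∈ L → Acc S L b) : ∀ b ∈ S, pr b p ∈ L → Acc S L b := by
  have := sub_induction (P := fun x => x ∈ S → pr x p ∈ L → Acc S L x) (fun x ih hx hlt => ?_)
  · exact this
  rcases hs.cases_kind hx with rfl | hX | ⟨c, d, hc, hd, rfl⟩ | ⟨c, d, hc, hd, rfl⟩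
  · exact hs.acc_zero hθ
  · exact H x hx hX hlt
  · rw [hs.plus_lt hx hp hA.ap] at hlt
    exact hs.acc_plus hθ (ih c (sub_plus_left _ _) hc hlt)
      (ih d (sub_plus_right _ _) hd (hs.right_lt hθ hx hp hA.ap hlt)) hx
  · rw [hs.phi_lt hx hp hA] at hlt
    exact hs.acc_phi hθ (ih c (sub_phi_left _ _) hc hlt.1) (ih d (sub_phi_right _ _) hd hlt.2) hx

/-- By `∈`-induction on the index. The strongly critical terms below `Γ_x` are the `Γ_y` with `y ∈
x`, and the remaining ones are handled by `acc_of_sc`. -/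
theorem acc_gamma (hs : Sys θ S L K) (hθ : Ord θ) (x : M) :
    tGamma x ∈ S → Acc S L (tGamma x) := by
  refine set_induction (P := fun x => tGamma x ∈ S → Acc S L (tGamma x)) (fun x ih hx => ?_) x
  refine hs.acc_of_forall hθ hx (hs.gamma_lt_omega hx) (hs.acc_of_sc hθ hx sc_gamma ?_)
  intro b hb hB hlt
  rcases hs.cases_sc hb hB with rfl | ⟨y, hy, rfl⟩ | ⟨y, hy, -, rfl⟩
  · exact absurd hlt (hs.not_omega_lt hx sc_gamma)
  · exact ih y ((hs.gamma_lt_gamma hb hx).1 hlt) hb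
  · exact absurd hlt (hs.not_psi_lt_gamma hb hx)

end Sys

end Accessible

end KPSet

namespace KPSet

section WellOrdering

variable {M : Type} [KPModel M] {X : Type} [Ctx M X] {θ S L K : M}

namespace Sys

/-! ### The arguments of `ψ` in a term -/

theorem K_plus (hs : Sys θ S L K) {x a b : M} (hx : x ∈ S) (h : tPlus a b ∈ S) :
    pr x (tPlus a b) ∈ K ↔ pr x a ∈ K ∨ pr x b ∈ K := by
  obtain ⟨ha, hb, -⟩ := hs.plus_mem.1 h
  rw [hs.2.2.2 x hx _ h, KC_iff]
  simp [ha, hb]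

theorem K_phi (hs : Sys θ S L K) {x a b : M} (hx : x ∈ S) (h : tPhi a b ∈ S) :
    pr x (tPhi a b) ∈ K ↔ pr x a ∈ K ∨ pr x b ∈ K := by
  obtain ⟨ha, hb, -⟩ := hs.phi_mem.1 h
  rw [hs.2.2.2 x hx _ h, KC_iff]
  simp [ha, hb]

theorem K_psi (hs : Sys θ S L K) {x a : M} (hx : x ∈ S) (h : tPsi a ∈ S) :
    pr x (tPsi a) ∈ K ↔ x = a ∨ pr x a ∈ K := by
  obtain ⟨ha, -⟩ := hs.psi_mem.1 h
  rw [hs.2.2.2 x hx _ h, KC_iff]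
  simp [ha]

theorem K_zero (hs : Sys θ S L K) {x : M} (hx : x ∈ S) : pr x (tZero M) ∉ K := by
  rw [hs.2.2.2 x hx _ hs.zero_mem, KC_iff]
  simp

theorem K_omega (hs : Sys θ S L K) {x : M} (hx : x ∈ S) : pr x (tOmega M) ∉ K := by
  rw [hs.2.2.2 x hx _ hs.omega_mem, KC_iff]
  simp

theorem K_gamma (hs : Sys θ S L K) {x y : M} (hx : x ∈ S) (h : tGamma y ∈ S) :
    pr x (tGamma y) ∉ K := by
  rw [hs.2.2.2 x hx _ h, KC_iff]
  simp

end Sys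

/-- `ψ x` is accessible for all arguments `x` of `ψ` in `a`. -/
def AccArgs (S L K a : M) : Prop := ∀ x ∈ S, pr x a ∈ K → Acc S L (tPsi x)

instance Def.accArgs (S L K : M) (f : X → M) [DefFun M f] :
    Def M (fun x => AccArgs S L K (f x)) := by
  refine Def.comp₁ (R := fun a => AccArgs S L K a) ?_ f
  unfold AccArgs
  infer_instance

/-- `P` holds below `p` for the terms satisfying `AccArgs`. -/
def Below (S L K : M) (P : M → Prop) (p : M) : Prop :=
  ∀ b ∈ S, pr b p ∈ L → AccArgs S L K b → P b

/-- `P` is progressive for the terms satisfying `AccArgs`. -/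
def Prog (S L K : M) (P : M → Prop) : Prop :=
  ∀ a ∈ S, AccArgs S L K a → Below S L K P a → P a

/-- Transfinite induction up to `a`. -/
def TI (S L K a : M) : Prop :=
  ∀ P : M → Prop, Def M (fun p : Unit × M => P p.2) → Prog S L K P → Below S L K P a

namespace Sys

theorem accArgs_plus (hs : Sys θ S L K) {a b : M} (h : tPlus a b ∈ S) :
    AccArgs S L K (tPlus a b) ↔ AccArgs S L K a ∧ AccArgs S L K b := by
  unfold AccArgs
  refine ⟨fun H => ⟨fun x hx hk => H x hx ((hs.K_plus hx h).2 (.inl hk)),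
    fun x hx hk => H x hx ((hs.K_plus hx h).2 (.inr hk))⟩, fun H x hx hk => ?_⟩
  rcases (hs.K_plus hx h).1 hk with hk | hk
  exacts [H.1 x hx hk, H.2 x hx hk]

theorem accArgs_phi (hs : Sys θ S L K) {a b : M} (h : tPhi a b ∈ S) :
    AccArgs S L K (tPhi a b) ↔ AccArgs S L K a ∧ AccArgs S L K b := by
  unfold AccArgs
  refine ⟨fun H => ⟨fun x hx hk => H x hx ((hs.K_phi hx h).2 (.inl hk)),
    fun x hx hk => H x hx ((hs.K_phi hx h).2 (.inr hk))⟩, fun H x hx hk => ?_⟩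
  rcases (hs.K_phi hx h).1 hk with hk | hk
  exacts [H.1 x hx hk, H.2 x hx hk]

/-- A countable term is accessible if the terms `ψ x` for the arguments `x` of `ψ` in it are. -/
theorem acc_of_accArgs (hs : Sys θ S L K) (hθ : Ord θ) (a : M) :
    a ∈ S → pr a (tOmega M) ∈ L → AccArgs S L K a → Acc S L a := by
  refine sub_induction (P := fun a => a ∈ S → pr a (tOmega M) ∈ L → AccArgs S L K a → Acc S L a)
    (fun a ih ha hlt hM => ?_) a
  rcases hs.cases_kind ha with rfl | hA | ⟨c, d, hc, hd, rfl⟩ | ⟨c, d, hc, hd, rfl⟩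
  · exact hs.acc_zero hθ
  · rcases hs.cases_sc ha hA with rfl | ⟨y, hy, rfl⟩ | ⟨y, hy, -, rfl⟩
    · exact absurd hlt (hs.irrefl ha)
    · exact hs.acc_gamma hθ y ha
    · exact hM y hy ((hs.K_psi hy ha).2 (.inl rfl))
  · rw [hs.plus_lt ha hs.omega_mem ap_omega] at hlt
    rw [hs.accArgs_plus ha] at hM
    exact hs.acc_plus hθ (ih c (sub_plus_left _ _) hc hlt hM.1)
      (ih d (sub_plus_right _ _) hd (hs.right_lt hθ ha hs.omega_mem ap_omega hlt) hM.2) ha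
  · rw [hs.phi_lt ha hs.omega_mem sc_omega] at hlt
    rw [hs.accArgs_phi ha] at hM
    exact hs.acc_phi hθ (ih c (sub_phi_left _ _) hc hlt.1 hM.1)
      (ih d (sub_phi_right _ _) hd hlt.2 hM.2) ha

/-! ### The terms `e_k` -/

theorem one_mem (hs : Sys θ S L K) : tPhi (tZero M) (tZero M) ∈ S := by
  refine hs.phi_mem.2 ⟨hs.zero_mem, hs.zero_mem, _, hs.omega_mem, rfl, .inl ?_⟩
  have := hs.zero_lt hs.omega_mem (by simp)
  exact ⟨this, this, .inl ⟨by simp, by simp⟩⟩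

/-- Needed to see that nothing lies strictly between `Ω` and `Ω + 1`. -/
theorem not_lt_one (hs : Sys θ S L K) (a : M) :
    a ∈ S → AP a → pr a (tPhi (tZero M) (tZero M)) ∉ L := by
  intro ha hA h
  rcases hs.cases_ap ha hA with hA | ⟨b, c, hb, hc, rfl⟩
  · rcases (hs.lt_phi hs.one_mem ha hA).1 h with (h | rfl) | (h | rfl)
    · exact hs.not_lt_zero ha h
    · exact sc_zero hA
    · exact hs.not_lt_zero ha h
    · exact sc_zero hA
  · rcases (hs.phi_lt_phi ha hs.one_mem).1 h with ⟨h, -⟩ | ⟨-, h⟩ | ⟨-, h⟩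
    · exact hs.not_lt_zero hb h
    · exact hs.not_lt_zero hc h
    · exact hs.not_lt_zero ha h

/-- The last part makes `ψ e_k` a normal form and `AccArgs` trivially true of `e_k`. The second part
permits the formation of `φ 0 e_k` by the clause for arguments above `Ω`. -/
theorem tE_spec (hs : Sys θ S L K) (k : ℕ) :
    tE M k ∈ S ∧ pr (tOmega M) (tE M k) ∈ L ∧ ∀ x ∈ S, pr x (tE M k) ∉ K := by
  induction k with
  | zero =>
    have h0 := hs.zero_lt hs.omega_mem (by simp)
    have h1 := (hs.phi_lt hs.one_mem hs.omega_mem sc_omega).2 ⟨h0, h0⟩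
    have h : tE M 0 ∈ S := hs.plus_mem.2
      ⟨hs.omega_mem, hs.one_mem, ap_omega, .inl ⟨ap_phi, .inl h1⟩⟩
    refine ⟨h, (hs.lt_plus h hs.omega_mem ap_omega).2 (.inr rfl), fun x hx hk => ?_⟩
    rcases (hs.K_plus hx h).1 hk with hk | hk
    · exact hs.K_omega hx hk
    · rcases (hs.K_phi hx hs.one_mem).1 hk with hk | hk <;> exact hs.K_zero hx hk
  | succ k ih =>
    obtain ⟨h1, h2, h3⟩ := ih
    have h : tE M (k + 1) ∈ S := hs.phi_mem.2
      ⟨hs.zero_mem, h1, _, hs.omega_mem, rfl, .inr ⟨by simp, h2⟩⟩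
    refine ⟨h, (hs.lt_phi h hs.omega_mem sc_omega).2 (.inr (.inl h2)), fun x hx hk => ?_⟩
    rcases (hs.K_phi hx h).1 hk with hk | hk
    · exact hs.K_zero hx hk
    · exact h3 x hx hk

theorem psi_tE_mem (hs : Sys θ S L K) (k : ℕ) : tPsi (tE M k) ∈ S :=
  hs.psi_mem.2 ⟨(hs.tE_spec k).1, fun x hx h => absurd h ((hs.tE_spec k).2.2 x hx)⟩

/-! ### Transfinite induction up to `e_0` -/

/-- A progressive predicate holds below `Ω`. -/
theorem below_omega (hs : Sys θ S L K) (hθ : Ord θ) {P : M → Prop}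
    (hP : Def M (fun p : Unit × M => P p.2)) (h : Prog S L K P) : Below S L K P (tOmega M) := by
  intro b hb hlt hM
  have hD := fun {X : Type} [Ctx M X] (f : X → M) [DefFun M f] => Def.comp₁ (R := P) hP f
  refine hs.acc_induction hθ (P := fun b => AccArgs S L K b → P b) inferInstance
    (fun a ha ih hM => ?_) (hs.acc_of_accArgs hθ b hb hlt hM) hM
  exact h a ha.1 hM fun c hc hca hM => ih c hc hca hM

theorem accArgs_omega (hs : Sys θ S L K) : AccArgs S L K (tOmega M) :=
  fun _ hx h => absurd h (hs.K_omega hx)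

/-- The terms below `Ω + 1` are those below `Ω`, covered by `below_omega`, and `Ω` itself, which is
added by progressivity. -/
theorem ti_zero (hs : Sys θ S L K) (hθ : Ord θ) : TI S L K (tE M 0) := by
  intro P hP h b hb hlt hM
  have h1 := hs.below_omega hθ hP h
  have h2 := h _ hs.omega_mem hs.accArgs_omega h1
  have he := (hs.tE_spec 0).1
  rcases hs.tag_zero_or_ap_or_plus hb with rfl | hB | ⟨c, d, hc, hd, rfl⟩
  · exact h1 _ hb (hs.zero_lt hs.omega_mem (by simp)) hM
  · rcases (hs.lt_plus he hb hB).1 hlt with hlt | rfl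
    · exact h1 _ hb hlt hM
    · exact h2
  · rcases (hs.plus_lt_plus hb he).1 hlt with h3 | ⟨rfl, h3⟩
    · exact h1 _ hb ((hs.plus_lt hb hs.omega_mem ap_omega).2 h3) hM
    -- A sum `Ω + d` would need `d ≺ 1`, but the leading summand of `d` is additive principal and
    -- hence not below `1`.
    · obtain ⟨-, -, -, ⟨hA, -⟩ | ⟨e, he, f, hf, rfl, -⟩⟩ := hs.plus_mem.1 hb
      · exact absurd h3 (hs.not_lt_one d hd hA)
      · exact absurd ((hs.plus_lt hd hs.one_mem ap_phi).1 h3)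
          (hs.not_lt_one e he (hs.plus_mem.1 hd).2.2.1)

end Sys

/-! ### The jump -/

theorem exists_relation (R : M → M → Prop) [h : D0 M (fun p : (Unit × M) × M => R p.1.2 p.2)]
    (a b : M) : ∃ h : M, ∀ z y, pr z y ∈ h ↔ z ∈ a ∧ y ∈ b ∧ R z y := by
  have hD := fun {X : Type} [Ctx M X] (f g : X → M) [IsVar M f] [IsVar M g] =>
    D0.comp₂ (R := R) h f g
  obtain ⟨A, hA⟩ := exists_image₂ (fun x y : M => pr x y) a b
  obtain ⟨u, hu⟩ := exists_sep (fun p : M => ∃ z ∈ a, ∃ y ∈ b, p = pr z y ∧ R z y) A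
  refine ⟨u, fun z y => ?_⟩
  rw [hu, hA]
  constructor
  · rintro ⟨-, z', hz, y', hy, e, h⟩
    obtain ⟨rfl, rfl⟩ := pr_inj.1 e
    exact ⟨hz, hy, h⟩
  · rintro ⟨hz, hy, h⟩
    exact ⟨⟨z, hz, y, hy, rfl⟩, z, hz, y, hy, rfl, h⟩

/-- `h` behaves like the addition `z ↦ h 0 + z`, defined on an initial segment of `S`. -/
def Shift (S L K h : M) : Prop :=
  (∀ z y : M, pr z y ∈ h → z ∈ S ∧ y ∈ S ∧ (AccArgs S L K y → AccArgs S L K z)) ∧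
  (∀ z y z' : M, pr z y ∈ h → z' ∈ S → pr z' z ∈ L → ∃ y' : M, pr z' y' ∈ h) ∧
  (∀ z y z' y' : M, pr z y ∈ h → pr z' y' ∈ h → pr z z' ∈ L → pr y y' ∈ L) ∧
  (∀ z y y₀ x : M, pr z y ∈ h → pr (tZero M) y₀ ∈ h → x ∈ S → pr x y ∈ L →
    pr x y₀ ∈ L ∨ ∃ z' : M, pr z' z ∈ L ∧ pr z' x ∈ h)

/-- If `P` holds below `h 0` then it holds below `h q`. -/
def Jump (S L K : M) (P : M → Prop) (q : M) : Prop :=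
  ∀ h : M, Shift S L K h → ∀ y₀ y : M, pr (tZero M) y₀ ∈ h → pr q y ∈ h →
    Below S L K P y₀ → Below S L K P y

set_option synthInstance.maxHeartbeats 400000 in
set_option synthInstance.maxSize 4096 in
instance Def.shift (S L K : M) (f : X → M) [DefFun M f] : Def M (fun x => Shift S L K (f x)) := by
  refine Def.comp₁ (R := fun a => Shift S L K a) ?_ f
  unfold Shift
  infer_instance

theorem Def.below {P : M → Prop} (hP : Def M (fun p : Unit × M => P p.2)) (f : X → M) [DefFun M f] :
    Def M (fun x => Below S L K P (f x)) := by
  have hD := fun {X : Type} [Ctx M X] (f : X → M) [DefFun M f] => Def.comp₁ (R := P) hP f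
  refine Def.comp₁ (R := fun a => Below S L K P a) ?_ f
  unfold Below
  infer_instance

theorem Def.jump {P : M → Prop} (hP : Def M (fun p : Unit × M => P p.2)) (f : X → M) [DefFun M f] :
    Def M (fun x => Jump S L K P (f x)) := by
  have hD := fun {X : Type} [Ctx M X] (f : X → M) [DefFun M f] => Def.below (S := S) (L := L) (K := K) hP f
  refine Def.comp₁ (R := fun a => Jump S L K P a) ?_ f
  unfold Jump
  infer_instance

/-- A term `x` below `h q` is below `h 0` or equal to some `h z` with `z ≺ q`. In the second case
`AccArgs` passes from `x` to `z`, the hypothesis on `z` gives `P` below `x`, and progressivity gives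
`P x`. -/
theorem Prog.jump {P : M → Prop} (h : Prog S L K P) : Prog S L K (Jump S L K P) := by
  intro q hq _ ih g hg y₀ y h0 hy hB x hx hlt hM
  rcases hg.2.2.2 q y y₀ x hy h0 hx hlt with h1 | ⟨z, hz, hzx⟩
  · exact hB x hx h1 hM
  · obtain ⟨hzS, -, hzM⟩ := hg.1 z x hzx
    exact h x hx hM (ih z hzS hz (hzM hM) g hg y₀ x h0 hzx hB)

namespace Sys

/-- The tail of a sum may be replaced by a smaller term. -/
theorem plus_mem_of_lt (hs : Sys θ S L K) (hθ : Ord θ) {c z z' : M} (h : tPlus c z ∈ S)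
    (hz' : z' ∈ S) (h0 : z' ≠ tZero M) (hlt : pr z' z ∈ L) : tPlus c z' ∈ S := by
  obtain ⟨hc, hz, hA, hn⟩ := hs.plus_mem.1 h
  refine hs.plus_mem.2 ⟨hc, hz', hA, ?_⟩
  rcases hs.tag_zero_or_ap_or_plus hz' with h' | hZ' | ⟨e, f, he, hf, rfl⟩
  · exact absurd h' h0
  · refine .inl ⟨hZ', ?_⟩
    rcases hn with ⟨hZ, hle⟩ | ⟨e, he, f, hf, rfl, hle⟩
    · exact hs.le_trans hθ hz' hz hc (.inl hlt) hle
    · exact hs.le_trans hθ hz' he hc ((hs.lt_plus hz hz' hZ').1 hlt) hle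
  · refine .inr ⟨e, he, f, hf, rfl, ?_⟩
    rcases hn with ⟨hZ, hle⟩ | ⟨e', he', f', hf', rfl, hle⟩
    · exact hs.le_trans hθ he hz hc (.inl ((hs.plus_lt hz' hz hZ).1 hlt)) hle
    · refine hs.le_trans hθ he he' hc ?_ hle
      rcases (hs.plus_lt_plus hz' hz).1 hlt with h1 | ⟨h1, -⟩
      exacts [.inl h1, .inr h1]

theorem ne_zero_of_plus (hs : Sys θ S L K) {c z : M} (h : tPlus c z ∈ S) : z ≠ tZero M := by
  rintro rfl
  obtain ⟨-, -, -, ⟨h, -⟩ | ⟨e, -, f, -, h, -⟩⟩ := hs.plus_mem.1 h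
  · exact ap_zero h
  · exact zero_ne_plus h

theorem zero_lt_of_ap (hs : Sys θ S L K) {c : M} (h : c ∈ S) (hA : AP c) : pr (tZero M) c ∈ L :=
  hs.zero_lt h hA.not_tag

/-- Shifting by `c` a function like `z ↦ h 0 + z` gives `z ↦ h c + z`. -/
theorem exists_shift (hs : Sys θ S L K) (hθ : Ord θ) {h c : M} (hh : Shift S L K h) (hc : c ∈ S)
    (hA : AP c) : ∃ g : M, Shift S L K g ∧ ∀ z y, pr z y ∈ g ↔
      (z = tZero M ∧ pr c y ∈ h) ∨ (tPlus c z ∈ S ∧ pr (tPlus c z) y ∈ h) := by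
  obtain ⟨hh1, hh2, hh3, hh4⟩ := hh
  have : D0 M (fun p : (Unit × M) × M => (p.1.2 = tZero M ∧ pr c p.2 ∈ h) ∨
      ∃ w ∈ S, w = tPlus c p.1.2 ∧ pr w p.2 ∈ h) := by
    unfold tPlus
    infer_instance
  obtain ⟨g, hg⟩ := exists_relation
    (fun z y : M => (z = tZero M ∧ pr c y ∈ h) ∨ ∃ w ∈ S, w = tPlus c z ∧ pr w y ∈ h) S S
  have hg' : ∀ z y, pr z y ∈ g ↔
      (z = tZero M ∧ pr c y ∈ h) ∨ (tPlus c z ∈ S ∧ pr (tPlus c z) y ∈ h) := by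
    intro z y
    rw [hg]
    constructor
    · rintro ⟨hz, hy, h1 | ⟨_, hw, rfl, h1⟩⟩
      exacts [.inl h1, .inr ⟨hw, h1⟩]
    · rintro (⟨rfl, h1⟩ | ⟨hw, h1⟩)
      · exact ⟨hs.zero_mem, (hh1 _ _ h1).2.1, .inl ⟨rfl, h1⟩⟩
      · exact ⟨(hs.plus_mem.1 hw).2.1, (hh1 _ _ h1).2.1, .inr ⟨_, hw, rfl, h1⟩⟩
  have hc0 := hs.zero_lt_of_ap hc hA
  refine ⟨g, ⟨fun z y hzy => ?_, fun z y z' hzy hz' hlt => ?_, fun z y z' y' h1 h2 hlt => ?_,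
    fun z y y₀ x h1 h2 hx hlt => ?_⟩, hg'⟩
  · rcases (hg' z y).1 hzy with ⟨rfl, h1⟩ | ⟨hw, h1⟩
    · exact ⟨hs.zero_mem, (hh1 _ _ h1).2.1, fun _ x hx hk => absurd hk (hs.K_zero hx)⟩
    · exact ⟨(hs.plus_mem.1 hw).2.1, (hh1 _ _ h1).2.1,
        fun hM => ((hs.accArgs_plus hw).1 ((hh1 _ _ h1).2.2 hM)).2⟩
  · rcases (hg' z y).1 hzy with ⟨rfl, h1⟩ | ⟨hw, h1⟩
    · exact absurd hlt (hs.not_lt_zero hz')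
    · by_cases h0 : z' = tZero M
      · subst h0
        obtain ⟨y', hy'⟩ := hh2 _ y c h1 hc ((hs.lt_plus hw hc hA).2 (.inr rfl))
        exact ⟨y', (hg' _ _).2 (.inl ⟨rfl, hy'⟩)⟩
      · have hw' := hs.plus_mem_of_lt hθ hw hz' h0 hlt
        obtain ⟨y', hy'⟩ := hh2 _ y _ h1 hw' ((hs.plus_lt_plus hw' hw).2 (.inr ⟨rfl, hlt⟩))
        exact ⟨y', (hg' _ _).2 (.inr ⟨hw', hy'⟩)⟩
  · rcases (hg' z' y').1 h2 with ⟨rfl, h2⟩ | ⟨hw', h2⟩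
    · exact absurd hlt (hs.not_lt_zero ((hg _ _).1 h1).1)
    · rcases (hg' z y).1 h1 with ⟨rfl, h3⟩ | ⟨hw, h3⟩
      · exact hh3 _ _ _ _ h3 h2 ((hs.lt_plus hw' hc hA).2 (.inr rfl))
      · exact hh3 _ _ _ _ h3 h2 ((hs.plus_lt_plus hw hw').2 (.inr ⟨rfl, hlt⟩))
  · have h2 : pr c y₀ ∈ h := by
      rcases (hg' _ _).1 h2 with ⟨-, h2⟩ | ⟨hw, -⟩
      · exact h2
      · exact absurd rfl (hs.ne_zero_of_plus hw)
    obtain ⟨x₀, hx₀⟩ := hh2 _ _ _ h2 hs.zero_mem hc0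
    have hlt₀ := hh3 _ _ _ _ hx₀ h2 hc0
    rcases (hg' z y).1 h1 with ⟨rfl, h5⟩ | ⟨hw, h5⟩
    -- The shifted function takes the value `h c` at `0`, so every term below this value falls under
    -- the first alternative.
    · rcases hh4 _ _ _ _ h5 hx₀ hx hlt with h3 | ⟨z', hz', h3⟩
      · exact .inl (hs.trans hθ hx (hh1 _ _ hx₀).2.1 (hh1 _ _ h2).2.1 h3 hlt₀)
      · exact .inl (hh3 _ _ _ _ h3 h2 hz')
    · rcases hh4 _ _ _ _ h5 hx₀ hx hlt with h3 | ⟨z', hz', h3⟩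
      · exact .inl (hs.trans hθ hx (hh1 _ _ hx₀).2.1 (hh1 _ _ h2).2.1 h3 hlt₀)
      · have hz'S := (hh1 _ _ h3).1
        have hzS := (hs.plus_mem.1 hw).2.1
        rcases hs.tag_zero_or_ap_or_plus hz'S with rfl | hZ | ⟨e, f, he, hf, rfl⟩
        · exact .inl (hh3 _ _ _ _ h3 h2 hc0)
        · rcases (hs.lt_plus hw hz'S hZ).1 hz' with h4 | rfl
          · exact .inl (hh3 _ _ _ _ h3 h2 h4)
          -- The position `c` of `h` becomes the position `0` of the shifted function.
          · refine .inr ⟨tZero M, hs.zero_lt hzS fun h0 => ?_, (hg' _ _).2 (.inl ⟨rfl, h3⟩)⟩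
            exact hs.ne_zero_of_plus hw (hs.eq_zero hzS h0)
        · rcases (hs.plus_lt_plus hz'S hw).1 hz' with h4 | ⟨rfl, h4⟩
          · exact .inl (hh3 _ _ _ _ h3 h2 ((hs.plus_lt hz'S hc hA).2 h4))
          · exact .inr ⟨f, h4, (hg' _ _).2 (.inr ⟨hz'S, h3⟩)⟩

/-- The jump at `c` carries `P` from below `h 0` to below `h c`. The jump at `d`, applied to `h`
shifted by `c`, carries it on to below `h (c + d)`. -/
theorem jump_plus (hs : Sys θ S L K) (hθ : Ord θ) {P : M → Prop} {c d : M} (h : tPlus c d ∈ S)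
    (hc : Jump S L K P c) (hd : Jump S L K P d) : Jump S L K P (tPlus c d) := by
  intro k hk y₀ y h0 hy hB
  obtain ⟨hcS, hdS, hA, -⟩ := hs.plus_mem.1 h
  obtain ⟨y₁, h1⟩ := hk.2.1 _ _ c hy hcS ((hs.lt_plus h hcS hA).2 (.inr rfl))
  obtain ⟨g, hg, hg'⟩ := hs.exists_shift hθ hk hcS hA
  exact hd g hg y₁ y ((hg' _ _).2 (.inl ⟨rfl, h1⟩)) ((hg' _ _).2 (.inr ⟨h, hy⟩))
    (hc k hk y₀ y₁ h0 h1 hB)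

/-- By induction on the build-up of terms below `ω^b`. Terms up to `Ω` are covered by progressivity
of the jump, sums by `jump_plus`, and the powers `ω^d` with `d ≺ b` by hypothesis. -/
theorem jump_below (hs : Sys θ S L K) (hθ : Ord θ) {P : M → Prop}
    (hP : Def M (fun p : Unit × M => P p.2)) (hprog : Prog S L K P) {b : M}
    (hb : tPhi (tZero M) b ∈ S)
    (H : ∀ d ∈ S, pr d b ∈ L → AccArgs S L K d → tPhi (tZero M) d ∈ S →
      Jump S L K P (tPhi (tZero M) d)) : Below S L K (Jump S L K P) (tPhi (tZero M) b) := by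
  have hD := fun {X : Type} [Ctx M X] (f : X → M) [DefFun M f] =>
    Def.jump (S := S) (L := L) (K := K) hP f
  have hJ := hprog.jump
  have hJO := hs.below_omega hθ (Def.jump hP _) hJ
  have hbS := (hs.phi_mem.1 hb).2.1
  refine sub_induction (P := fun z => z ∈ S → pr z (tPhi (tZero M) b) ∈ L → AccArgs S L K z →
    Jump S L K P z) (fun z ih hz hlt hM => ?_)
  rcases hs.cases_kind hz with rfl | hZ | ⟨c, d, hc, hd, rfl⟩ | ⟨c, d, hc, hd, rfl⟩
  · exact hJ _ hz hM fun x hx hx0 => absurd hx0 (hs.not_lt_zero hx)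
  · rcases hs.cases_sc hz hZ with rfl | ⟨y, -, rfl⟩ | ⟨y, -, -, rfl⟩
    · exact hJ _ hz hM hJO
    · exact hJO _ hz (hs.gamma_lt_omega hz) hM
    · exact hJO _ hz (hs.psi_lt_omega hz) hM
  · rw [hs.plus_lt hz hb ap_phi] at hlt
    rw [hs.accArgs_plus hz] at hM
    exact hs.jump_plus hθ hz (ih c (sub_plus_left _ _) hc hlt hM.1)
      (ih d (sub_plus_right _ _) hd (hs.right_lt hθ hz hb ap_phi hlt) hM.2)
  · obtain ⟨-, -, _, -, rfl, ⟨h1, h2, -⟩ | ⟨h1, -⟩⟩ := hs.phi_mem.1 hz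
    · exact hJO _ hz ((hs.phi_lt hz hs.omega_mem sc_omega).2 ⟨h1, h2⟩) hM
    · obtain rfl := hs.eq_zero hc h1
      rcases (hs.phi_lt_phi hz hb).1 hlt with ⟨h, -⟩ | ⟨-, h⟩ | ⟨h, -⟩
      · exact absurd h (hs.irrefl hc)
      · exact H d hd h ((hs.accArgs_phi hz).1 hM).2 hz
      · exact absurd h (hs.irrefl hc)

/-- This is the shift by `0`, with which the jump is evaluated in the end. -/
theorem exists_shift_id (S L K : M) :
    ∃ h : M, Shift S L K h ∧ ∀ z ∈ S, pr z z ∈ h := by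
  obtain ⟨h, hh⟩ := exists_relation (fun z y : M => z = y) S S
  refine ⟨h, ⟨fun z y h1 => ?_, fun z y z' _ hz' _ => ⟨z', (hh _ _).2 ⟨hz', hz', rfl⟩⟩,
    fun z y z' y' h1 h2 hlt => ?_, fun z y y₀ x h1 _ hx hlt => ?_⟩,
    fun z hz => (hh _ _).2 ⟨hz, hz, rfl⟩⟩
  · obtain ⟨hz, -, rfl⟩ := (hh _ _).1 h1
    exact ⟨hz, hz, id⟩
  · obtain ⟨-, -, rfl⟩ := (hh _ _).1 h1
    obtain ⟨-, -, rfl⟩ := (hh _ _).1 h2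
    exact hlt
  · obtain ⟨-, -, rfl⟩ := (hh _ _).1 h1
    exact .inr ⟨x, hlt, (hh _ _).2 ⟨hx, hx, rfl⟩⟩

/-- Gentzen's argument: transfinite induction up to `a` is applied to the statement that the jump of
`P` holds at `ω^d`. This statement is progressive in `d` by `jump_below`, and it is definable
whenever `P` is. -/
theorem ti_phi (hs : Sys θ S L K) (hθ : Ord θ) {a : M} (ha : tPhi (tZero M) a ∈ S)
    (h : TI S L K a) : TI S L K (tPhi (tZero M) a) := by
  intro P hP hprog
  have hD := fun {X : Type} [Ctx M X] (f : X → M) [DefFun M f] =>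
    Def.jump (S := S) (L := L) (K := K) hP f
  have hJ := hprog.jump
  have key : Below S L K (Jump S L K P) (tPhi (tZero M) a) := by
    refine hs.jump_below hθ hP hprog ha fun d hd hlt hM => ?_
    refine h (fun d => tPhi (tZero M) d ∈ S → Jump S L K P (tPhi (tZero M) d)) inferInstance
      (fun b hb hM ih hbS => ?_) d hd hlt hM
    refine hJ _ hbS ((hs.accArgs_phi hbS).2 ⟨fun x hx hk => absurd hk (hs.K_zero hx), hM⟩) ?_
    exact hs.jump_below hθ hP hprog hbS fun d hd hlt hM => ih d hd hlt hM
  intro x hx hlt hM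
  obtain ⟨g, hg, hid⟩ := exists_shift_id S L K
  -- For the identity the jump at `x` starts from `P` below `0`, which is vacuous, and ends with `P`
  -- below `x`.
  exact hprog x hx hM (key x hx hlt hM g hg _ _ (hid _ hs.zero_mem) (hid x hx)
    fun y hy h0 => absurd h0 (hs.not_lt_zero hy))

/-- The induction on `k` is external: `TI` ranges over all definable predicates and is not itself a
formula, and each step uses it for a more complex predicate. -/
theorem ti_tE (hs : Sys θ S L K) (hθ : Ord θ) (k : ℕ) : TI S L K (tE M k) := by
  induction k with
  | zero => exact hs.ti_zero hθ
  | succ k ih => exact hs.ti_phi hθ (hs.tE_spec (k + 1)).1 ih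

/-! ### Accessibility of `ψ e_k` -/

/-- It suffices to treat `ψ y` with `y ≺ a`. The hypothesis applies to `y` once `AccArgs` is known
for `y`; by normal form the arguments of `ψ` in `y` are below `y`, hence below `a`, so an induction
on terms supplies their accessibility. -/
theorem prog_acc_psi (hs : Sys θ S L K) (hθ : Ord θ) :
    Prog S L K (fun a => tPsi a ∈ S → Acc S L (tPsi a)) := by
  intro a ha _ ih hψ
  have key : ∀ t : M, t ∈ S → ∀ x ∈ S, pr x t ∈ K → pr x a ∈ L → Acc S L (tPsi x) := by
    refine sub_induction (P := fun t => t ∈ S → ∀ x ∈ S, pr x t ∈ K → pr x a ∈ L →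
      Acc S L (tPsi x)) (fun t iht ht x hx hk hlt => ?_)
    rcases hs.cases ht with rfl | rfl | ⟨y, hy, rfl⟩ | ⟨c, d, hc, hd, -, rfl⟩ |
      ⟨c, d, hc, hd, -, rfl⟩ | ⟨d, hd, hn, rfl⟩
    · exact absurd hk (hs.K_zero hx)
    · exact absurd hk (hs.K_omega hx)
    · exact absurd hk (hs.K_gamma hx ht)
    · rcases (hs.K_plus hx ht).1 hk with hk | hk
      · exact iht c (sub_plus_left _ _) hc x hx hk hlt
      · exact iht d (sub_plus_right _ _) hd x hx hk hlt
    · rcases (hs.K_phi hx ht).1 hk with hk | hk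
      · exact iht c (sub_phi_left _ _) hc x hx hk hlt
      · exact iht d (sub_phi_right _ _) hd x hx hk hlt
    -- For `t = ψ d` the inner hypothesis concerns the arguments in `d`. If `x` is `d` itself, these
    -- are below `d ≺ a`, which verifies `AccArgs` for `d`.
    · have hQ := iht d (sub_psi d) hd
      rcases (hs.K_psi hx ht).1 hk with rfl | hk
      · exact ih x hx hlt (fun y hy hk => hQ y hy hk (hs.trans hθ hy hx ha (hn y hy hk) hlt)) ht
      · exact hQ x hx hk hlt
  refine hs.acc_of_forall hθ hψ (hs.psi_lt_omega hψ) (hs.acc_of_sc hθ hψ sc_psi ?_)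
  intro b hb hB hlt
  rcases hs.cases_sc hb hB with rfl | ⟨y, hy, rfl⟩ | ⟨y, hy, -, rfl⟩
  · exact absurd hlt (hs.not_omega_lt hψ sc_psi)
  · exact hs.acc_gamma hθ y hb
  · exact key _ hb y hy ((hs.K_psi hy hb).2 (.inl rfl)) ((hs.psi_lt_psi hb hψ).1 hlt)

theorem acc_psi_tE (hs : Sys θ S L K) (hθ : Ord θ) (k : ℕ) : Acc S L (tPsi (tE M k)) := by
  have h := hs.prog_acc_psi hθ
  obtain ⟨h1, -, h2⟩ := hs.tE_spec k
  exact h _ h1 (fun x hx hk => absurd hk (h2 x hx)) (hs.ti_tE hθ k _ inferInstance h)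
    (hs.psi_tE_mem k)

theorem initSegLt_psi_tE (hs : Sys θ S L K) (hθ : Ord θ) (k : ℕ) :
    InitSegLt S L (tPsi (tE M k)) :=
  initSegLt_of_forall hs hθ (fun _ hb hlt => (hs.acc_le hθ (hs.acc_psi_tE hθ k) hb (.inl hlt)).2.2)
    (hs.psi_tE_mem k)

end Sys

end WellOrdering

/-! ### From truth in all models to derivability. -/

theorem eval_psiEAcc {M : Type} [KPModel M] {k n : ℕ} (e : Fin n → M) (θ : Tm n)
    (h : Ord (θ.eval KPModel.ρ e)) : (psiEAcc k θ).eval KPModel.ρ e := by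
  obtain ⟨S, L, K, hs⟩ := exists_sys (θ.eval KPModel.ρ e)
  rw [psiEAcc, Fml.eval_subst]
  simp only [Fml.eval]
  refine ⟨S, L, K, tPsi (tE M k), (eval_isSystem _ _ _ _ _).2 hs, ?_, (eval_isAcc _ _ _ _).2 ?_⟩
  · exact eval_isPsiE _ _ _ hs.zero_mem hs.omega_mem hs.one_mem (fun j => (hs.tE_spec j).1)
      (hs.psi_tE_mem k) rfl
  · exact hs.acc_psi_tE h k

theorem eval_psiEOrderType {M : Type} [KPModel M] {k n : ℕ} (e : Fin n → M) (θ : Tm n)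
    (h : Ord (θ.eval KPModel.ρ e)) : (psiEOrderType k θ).eval KPModel.ρ e := by
  obtain ⟨S, L, K, hs⟩ := exists_sys (θ.eval KPModel.ρ e)
  rw [psiEOrderType, Fml.eval_subst]
  simp only [Fml.eval]
  refine ⟨S, L, K, tPsi (tE M k), (eval_isSystem _ _ _ _ _).2 hs, ?_, (eval_initSegLt _ _ _ _).2 ?_⟩
  · exact eval_isPsiE _ _ _ hs.zero_mem hs.omega_mem hs.one_mem (fun j => (hs.tE_spec j).1)
      (hs.psi_tE_mem k) rfl
  · exact hs.initSegLt_psi_tE h k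

theorem KPProves_allOrd {A : Fml 1} (h : ∀ (M : Type) [KPModel M] (e : Fin 1 → M),
    Ord (Tm.eval KPModel.ρ e (v 0)) → A.eval KPModel.ρ e) : KPProves (allOrd A) := by
  refine KPProves_of_eval _ fun M _ => ?_
  rw [allOrd]
  simp only [Fml.eval, Fml.eval_imp, eval_isOrd]
  exact fun a ha => h M _ ha

end KPSet

theorem mainTheorem6 (n : ℕ) :
    KPSet.KPProves (KPSet.allOrd (KPSet.psiEAcc n (KPSet.v 0))) ∧
      KPSet.KPProves (KPSet.allOrd (KPSet.psiEOrderType n (KPSet.v 0))) :=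
  ⟨KPSet.KPProves_allOrd fun _ _ e => KPSet.eval_psiEAcc e _,
    KPSet.KPProves_allOrd fun _ _ e => KPSet.eval_psiEOrderType e _⟩
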